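/- Let $p$ be a prime. For every real number $x>0$ there is a countable residually finite group $C_x$ with the following properties. (1) $C_x$ has cohomological dimension $2$ modulo $p$: for every nonzero unital (not necessarily commutative) ring $R$ in which $p$ is invertible, the cohomological dimension of $C_x$ over $R$, i.e. the projective dimension of the trivial $R[C_x]$-module $R$, equals $2$. (2) The $\ell^2$-Betti numbers of $C_x$ satisfy $b_1^{(2)}(C_x)=\infty$, $b_2^{(2)}(C_x)=x$ and $b_n^{(2)}(C_x)=0$ for all $n\ge 3$. Here $b_n^{(2)}(G)=\dim_{\mathcal N(G)}H_n(G;\mathcal N(G))\in[0,\infty]$, where $\mathcal N(G)$ is the group von Neumann algebra of $G$ and $\dim_{\mathcal N(G)}$ is Lück's dimension function for arbitrary $\mathcal N(G)$-modules. (3) $C_x$ is a free product of groups $\mathbb Z/p^i\times F_{r+1}^2$: there are integers $r_i\ge 0$, $i\in\mathbb N=\{0,1,2,\dots\}$, such that $C_x$ is isomorphic to the free product, over all $i$ with $r_i\ne 0$, of the groups $\mathbb Z/p^i\mathbb Z\times F_{r_i+1}\times F_{r_i+1}$, where $F_k$ denotes the free group of rank $k$. -/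

import Mathlib

open CategoryTheory

universe u

noncomputable section

/-! ### The group von Neumann algebra -/

/-- The Hilbert space `ℓ²(G)` of square-summable complex functions on `G`. -/
abbrev EllTwo (G : Type) : Type := lp (fun _ : G => ℂ) 2

section Regular

variable (G : Type) [Group G]

/-- The unitary operator `λ(g)` on `ℓ²(G)`, given by `(λ(g) f)(h) = f(g⁻¹ h)`. -/
def leftTranslation (g : G) : EllTwo G →ₗᵢ[ℂ] EllTwo G where
  toFun f := ⟨fun h => f (g⁻¹ * h), by
    have hp : 0 < (2 : ENNReal).toReal := by norm_num
    have hf := (memℓp_gen_iff hp).1 (lp.memℓp f)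
    exact (memℓp_gen_iff hp).2 (((Equiv.mulLeft g⁻¹).summable_iff).2 hf)⟩
  map_add' f f' := by ext h; simp; rfl
  map_smul' c f := by ext h; simp
  norm_map' f := by
    have hp : 0 < (2 : ENNReal).toReal := by norm_num
    simp only [lp.norm_eq_tsum_rpow hp]
    congr 1
    exact (Equiv.mulLeft g⁻¹).tsum_eq fun h => ‖f h‖ ^ (2 : ENNReal).toReal

/-- The left regular representation `λ : G → B(ℓ²(G))`. -/
def leftRegular : G →* (EllTwo G →L[ℂ] EllTwo G) where
  toFun g := (leftTranslation G g).toContinuousLinearMap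
  map_one' := by ext f h; simp [leftTranslation]
  map_mul' g g' := by ext f h; simp [leftTranslation, mul_assoc]

/-- The group von Neumann algebra `N(G) = λ(G)''`, the double commutant of `λ(G)` in
`B(ℓ²(G))`. (Mathlib's `StarSubalgebra.centralizer ℂ s` is the commutant of `s ∪ s*`, and
`λ(G)* = λ(G)`.) -/
def groupVN : VonNeumannAlgebra (EllTwo G) where
  toStarSubalgebra := StarSubalgebra.centralizer ℂ
    (StarSubalgebra.centralizer ℂ (Set.range (leftRegular G)) : Set (EllTwo G →L[ℂ] EllTwo G))
  centralizer_centralizer' := by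
    change Set.centralizer (Set.centralizer
      ((StarSubalgebra.centralizer ℂ (StarSubalgebra.centralizer ℂ
        (Set.range (leftRegular G)) : Set (EllTwo G →L[ℂ] EllTwo G)) :
          StarSubalgebra ℂ (EllTwo G →L[ℂ] EllTwo G)) : Set (EllTwo G →L[ℂ] EllTwo G))) = _
    rw [StarSubalgebra.coe_centralizer_centralizer, Set.centralizer_centralizer_centralizer]
    exact (StarSubalgebra.coe_centralizer_centralizer ℂ (Set.range (leftRegular G))).symm

/-- The canonical homomorphism `G → N(G)`, `g ↦ λ(g)`. -/
def groupToVN : G →* groupVN G where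
  toFun g := ⟨leftRegular G g, by
    have h := StarSubalgebra.coe_centralizer_centralizer ℂ (Set.range (leftRegular G))
    change leftRegular G g ∈ ((StarSubalgebra.centralizer ℂ (StarSubalgebra.centralizer ℂ
        (Set.range (leftRegular G)) : Set (EllTwo G →L[ℂ] EllTwo G)) :
          StarSubalgebra ℂ (EllTwo G →L[ℂ] EllTwo G)) : Set (EllTwo G →L[ℂ] EllTwo G))
    rw [h]
    exact Set.subset_centralizer_centralizer (Or.inl ⟨g, rfl⟩)⟩
  map_one' := Subtype.ext (map_one (leftRegular G))
  map_mul' g g' := Subtype.ext (map_mul (leftRegular G) g g')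

open Classical in
/-- The von Neumann trace `τ(T) = ⟨T δ₁, δ₁⟩` on `N(G)`. -/
def vnTrace (T : groupVN G) : ℂ :=
  inner ℂ (lp.single 2 (1 : G) (1 : ℂ) : EllTwo G)
    ((T : EllTwo G →L[ℂ] EllTwo G) (lp.single 2 (1 : G) (1 : ℂ)))

end Regular

/-! ### The extended dimension function -/

/-- Lück's dimension of an arbitrary left module `M` over a ring `N` with a trace `τ`:
the supremum of `dim P` over the finitely generated projective submodules `P` of `M`. Here a
finitely generated projective module is one that is isomorphic to the image `Nⁿ A` of an
idempotent matrix `A ∈ Mₙ(N)` acting from the right on row vectors, and then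
`dim P = τ(A₁₁) + ⋯ + τ(Aₙₙ)`, which for a finite trace on a von Neumann algebra is a nonnegative
real number. -/
def luckDim {N : Type} [Ring N] (τ : N → ℂ) (M : Type) [AddCommGroup M] [Module N M] : ENNReal :=
  ⨆ (n : ℕ) (A : Matrix (Fin n) (Fin n) N) (_ : IsIdempotentElem A) (P : Submodule N M)
    (_ : Nonempty (LinearMap.range A.vecMulLinear ≃ₗ[N] P)),
    ENNReal.ofReal (∑ i, τ (A i i)).re

/-! ### Group homology with coefficients in `N(G)` -/

section Bar

variable {G : Type} [Group G] {N : Type} [Ring N] (φ : G →* N)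

/-- The differential of `N ⊗_{ℤ[G]} (bar resolution of G)`, where `N` is a right `ℤ[G]`-module
through a homomorphism `φ` from `G` to the multiplicative monoid of `N`:
`T [g₀|…|gₙ] ↦ T φ(g₀) [g₁|…|gₙ] + ∑_{j<n} (-1)^{j+1} T […|gⱼgⱼ₊₁|…]
  + (-1)^{n+1} T [g₀|…|gₙ₋₁]`. It is linear over `N` acting from the left. -/
def barD (n : ℕ) : ((Fin (n + 1) → G) →₀ N) →ₗ[N] ((Fin n → G) →₀ N) :=
  Finsupp.lsum ℕ fun g =>
    Finsupp.lsingle (fun i => g i.succ) ∘ₗ LinearMap.toSpanSingleton N N (φ (g 0)) +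
      ∑ j : Fin (n + 1), (-1 : ℤ) ^ ((j : ℕ) + 1) •
        (Finsupp.lsingle (Fin.contractNth j (· * ·) g) : N →ₗ[N] ((Fin n → G) →₀ N))

/-- The `ℤ[G]`-module underlying the complex above, with `g` acting as right multiplication by
`φ(g⁻¹)`; it serves to compare that complex with Mathlib's. -/
def coeffRep : Rep ℤ G :=
  Rep.of (X := N) (k := ℤ) (G := G)
    { toFun := fun g => (AddMonoidHom.mulRight (φ g⁻¹)).toIntLinearMap
      map_one' := by ext x; simp
      map_mul' := fun g h => by ext x; simp [mul_assoc] }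

theorem barD_single (n : ℕ) (g : Fin (n + 1) → G) (a : N) :
    barD φ n (Finsupp.single g a) = Finsupp.single (fun i => g i.succ) (a * φ (g 0)) +
      ∑ j : Fin (n + 1), (-1 : ℤ) ^ ((j : ℕ) + 1) •
        Finsupp.single (Fin.contractNth j (· * ·) g) a := by
  simp only [barD, Finsupp.lsum_single, LinearMap.add_apply, LinearMap.comp_apply,
    LinearMap.toSpanSingleton_apply, Finsupp.lsingle_apply, LinearMap.sum_apply,
    LinearMap.smul_apply, smul_eq_mul]

theorem barD_eq (n : ℕ) (x : (Fin (n + 1) → G) →₀ N) :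
    barD φ n x = (groupHomology.inhomogeneousChains.d (coeffRep φ) n).hom x := by
  induction x using Finsupp.induction_linear with
  | zero => exact (map_zero _).trans (map_zero _).symm
  | add x y hx hy => exact (map_add _ x y).trans ((congrArg₂ (· + ·) hx hy).trans
      (map_add _ x y).symm)
  | single g a =>
    refine Eq.trans ?_ (groupHomology.inhomogeneousChains.d_single (A := coeffRep φ) n g a).symm
    rw [barD_single]
    have h : (coeffRep φ).ρ (g 0)⁻¹ a = a * φ (g 0) := by
      change a * φ ((g 0)⁻¹)⁻¹ = _
      rw [inv_inv]
    rw [h]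
    rfl

theorem barD_comp_barD (n : ℕ) : barD φ n ∘ₗ barD φ (n + 1) = 0 := by
  have h := groupHomology.inhomogeneousChains.d_comp_d (A := coeffRep φ) (n := n)
  refine LinearMap.ext fun x => ?_
  exact (congrArg (barD φ n) (barD_eq φ (n + 1) x)).trans
    ((barD_eq φ n _).trans (congrArg (fun f => f.hom x) h))

/-- The complex `N ⊗_{ℤ[G]} (bar resolution of G)` of left `N`-modules. -/
def barComplexOver : ChainComplex (ModuleCat.{0} N) ℕ :=
  ChainComplex.of (fun n => ModuleCat.of N ((Fin n → G) →₀ N))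
    (fun n => ModuleCat.ofHom (barD φ n)) fun n => by
      rw [← ModuleCat.ofHom_comp, barD_comp_barD]; rfl

end Bar

/-- The `n`-th `ℓ²`-Betti number `b_n^{(2)}(G) = dim_{N(G)} H_n(G; N(G))`. -/
def ell2Betti (G : Type) [Group G] (n : ℕ) : ENNReal :=
  luckDim (vnTrace G) ((barComplexOver (groupToVN G)).homology n)

/-! ### Cohomological dimension -/

section CohDim

variable (R : Type u) [Ring R] (G : Type) [Group G]

/-- The augmentation `R[G] → R`, sending each group element to `1`. -/
def augmentation : MonoidAlgebra R G →+* R :=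
  MonoidAlgebra.liftNCRingHom (RingHom.id R) (1 : G →* R) fun x _ => Commute.one_right x

/-- The cohomological dimension `cd_R(G)`: the projective dimension of the trivial `R[G]`-module
`R`, that is, the supremum of all `n` such that `Extⁿ_{R[G]}(R, M) = Hⁿ(G; M)` is nonzero for some
`R[G]`-module `M`. -/
def cohomologicalDimension : WithBot ℕ∞ :=
  projectiveDimension ((ModuleCat.restrictScalars (augmentation R G)).obj (ModuleCat.of R R))

end CohDim

end

/-!
For positive integers `k_i`, let `C` be the free product of the groups `G_i = P_i × F × F`, where
`P_i` is finite and `F` is free of rank `k_i`. All assertions are read off from one explicit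
resolution of length two.

*The resolution.* Let `R` be a ring in which the orders `|P_i|` are invertible. Averaging over `P_i`
gives an idempotent `e_i` of `R[C]` that commutes with the two free groups of `G_i`; let `a_j` and
`b_k` be the generators of these. The resolution `0 → Q₂ → Q₁ → R[C] → R → 0` has
`Q₂ = ⨁ R[C] e_i`, over all `i` and all pairs `(j, k)`, and `Q₁` is the direct sum of a copy of
`R[C] e_i` for every `a_j` and every `b_k`, and of a copy of `R[C] (1 - e_i)` for every `i`. The
differentials are those of the tensor product of the resolutions of the two free groups, with the
inclusion `R[C] (1 - e_i) → R[C]` on the last summands. Exactness is a statement about derivations: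
derivations of free groups and free products can be prescribed on generators and on factors
(`exists_isDerivation_freeGroup`, `exists_isDerivation_coprodI`), and Fox derivatives show that
`Q₂ → Q₁` is injective (`dTwo_injective`, `exists_dTwo_eq`, `exists_dOne_eq`).

*Cohomological dimension.* The map `Q₂ → Q₁` becomes zero after reduction modulo the augmentation
ideal, but `Q₂` does not. Hence it has no retraction, and the projective dimension is exactly two
(`cohomologicalDimension_freeProd`).

*`ℓ²`-Betti numbers.* Extension of scalars to `N = N(C)` turns both the bar resolution and the
resolution above into complexes that compute the homology with coefficients in `N`. It vanishes in
degrees at least three. In degree two it is the direct sum over `i` of the modules of arrays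
`(y_{jk})` with entries in `N e_i` that satisfy `∑_j y_{jk} (a_j - 1) = 0` for all `k` and
`∑_k y_{jk} (b_k - 1) = 0` for all `j`. Such a module is the image of a projection matrix. Its trace
is `(k_i - 1)² / |P_i|`, because `a - 1` is injective on `ℓ²(C)` for `a` of infinite order, and
because a matrix over `N` and its adjoint have the same rank (`exists_isAnnihilatorProj`, by the
mean ergodic theorem; `exists_proj_kernel`, `exists_proj_grid`). The same comparison of ranks shows
that traces of idempotents are monotone under embeddings of their images, so that the dimension of
a direct sum of images of projections is the sum of the traces (`luckDim_fixedRows`). In degree one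
it suffices to exhibit cycles: elements `g_0, …, g_n` of infinite order in different factors give a
module of cycles of dimension `n` that meets the boundaries only in zero
(`le_ell2Betti_freeProd_one`).

*The choice of the parameters.* With `P_i` of order `pⁱ` and `k_i = r_i + 1`, the second `ℓ²`-Betti
number is `∑ r_i² / pⁱ`. A greedy choice of the digits `r_i` makes this sum equal to `x`, with
infinitely many `r_i` different from zero (`exists_hasSum_sq_div_pow`).

*Residual finiteness.* A free product of residually finite groups is residually finite
(`residuallyFinite_coprodI`): a reduced word survives in a free product of finite quotients, and a
free product of finite groups acts on finite sets by truncated translations.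
-/

/-! ### Residual finiteness of free products -/

section ResiduallyFinite

/-- The action of `K` on `W`, truncated to a subset `Ω`: elements of `K` move the points of `Ω`
whose whole `K`-orbit lies in `Ω`, and fix the other points. -/
theorem exists_truncated_action {K W : Type*} [Group K] [MulAction K W] (Ω : Set W) :
    ∃ ρ : K →* Equiv.Perm Ω, ∀ (k : K) (v : Ω), MulAction.orbit K (v : W) ⊆ Ω →
      (ρ k v : W) = k • (v : W) := by
  classical
  let good : Ω → Prop := fun v => ∀ k : K, k • (v : W) ∈ Ω
  let f : K → Ω → Ω := fun k v => if h : good v then ⟨k • (v : W), h k⟩ else v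
  have hf1 : ∀ v, f 1 v = v := by
    intro v
    by_cases h : good v <;> simp [f, h]
  have hfm : ∀ k l v, f (k * l) v = f k (f l v) := by
    intro k l v
    by_cases h : good v
    · have h' : good ⟨l • (v : W), h l⟩ := fun m => by
        change m • l • (v : W) ∈ Ω
        rw [smul_smul]; exact h _
      simp [f, h, h', mul_smul]
    · simp [f, h]
  let act : MulAction K Ω :=
    { smul := f, one_smul := hf1, mul_smul := hfm }
  refine ⟨MulAction.toPermHom K Ω, fun k v hv => ?_⟩
  have h : good v := fun m => hv ⟨m, rfl⟩
  change ((f k v : Ω) : W) = _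
  simp [f, h]

/-- A free product of finite groups is residually finite: a nontrivial product `q₁ ⋯ qₙ` of
elements of the factors moves the point `1` of the finite set of all translates
`Qᵢ q_{k+1} ⋯ qₙ` with `q_k ∈ Qᵢ`, on which the factors act by truncated left translations. -/
theorem residuallyFinite_coprodI_of_finite {ι : Type*} {Q : ι → Type*} [∀ i, Group (Q i)]
    [∀ i, Finite (Q i)] : Group.ResiduallyFinite (Monoid.CoprodI Q) := by
  classical
  -- Once a set `t` contains a suitable finite set `s`, every action by truncated translations on
  -- `t` moves `1` to `w`. By induction, `s` grows by the translates of the suffixes of `w`.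
  have key : ∀ w : Monoid.CoprodI Q, ∃ s : Set (Monoid.CoprodI Q), s.Finite ∧ 1 ∈ s ∧ w ∈ s ∧
      ∀ t : Set (Monoid.CoprodI Q), s ⊆ t → ∀ ρ : ∀ i, Q i →* Equiv.Perm t,
        (∀ i (k : Q i) (v : t), (∀ l : Q i, Monoid.CoprodI.of l * (v : Monoid.CoprodI Q) ∈ t) →
          (ρ i k v : Monoid.CoprodI Q) = Monoid.CoprodI.of k * v) →
        ∀ v : t, (v : Monoid.CoprodI Q) = 1 →
          (Monoid.CoprodI.lift ρ w v : Monoid.CoprodI Q) = w := by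
    intro w
    induction w using Monoid.CoprodI.induction_left with
    | one => exact ⟨{1}, Set.finite_singleton _, rfl, rfl, fun t ht ρ hρ v hv => by simp [hv]⟩
    | mul m x ih =>
      rename_i i
      obtain ⟨s, hs, h1, hx, h⟩ := ih
      refine ⟨s ∪ Set.range (fun l : Q i => Monoid.CoprodI.of l * x),
        hs.union (Set.finite_range _), Or.inl h1, Or.inr ⟨m, rfl⟩, fun t ht ρ hρ v hv => ?_⟩
      have e := h t (Set.subset_union_left.trans ht) ρ hρ v hv
      rw [map_mul, Equiv.Perm.mul_apply, Monoid.CoprodI.lift_of, hρ, e]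
      intro l
      rw [e]
      exact ht (Or.inr ⟨l, rfl⟩)
  apply Group.residuallyFinite_of_forall_exists_finite_monoidHom
  intro w hw
  obtain ⟨s, hs, h1, -, h⟩ := key w
  choose ρ hρ using fun i =>
    letI := MulAction.compHom (Monoid.CoprodI Q) (Monoid.CoprodI.of (M := Q) (i := i))
    exists_truncated_action (K := Q i) s
  have : Finite s := hs
  refine ⟨Equiv.Perm s, inferInstance, inferInstance, Monoid.CoprodI.lift ρ, fun hc => hw ?_⟩
  have := h s le_rfl ρ (fun i k v hv => hρ i k v (by rintro _ ⟨l, rfl⟩; exact hv l)) ⟨1, h1⟩ rfl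
  rw [← this, hc]
  rfl

/-- Finitely many nontrivial elements survive in a common finite quotient. -/
theorem Group.ResiduallyFinite.exists_normal_finiteIndex_list {G : Type*} [Group G]
    [Group.ResiduallyFinite G] (l : List G) :
    ∃ N : Subgroup G, N.Normal ∧ N.FiniteIndex ∧ ∀ g ∈ l, g ≠ 1 → g ∉ N := by
  induction l with
  | nil => exact ⟨⊤, inferInstance, inferInstance, by simp⟩
  | cons g l ih =>
    obtain ⟨N, hN, hN', h⟩ := ih
    by_cases hg : g = 1
    · exact ⟨N, hN, hN', by simpa [hg] using h⟩
    · obtain ⟨H, hH⟩ := Group.exists_finiteIndexNormalSubgroup_notMem g hg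
      refine ⟨N ⊓ H.toSubgroup, inferInstance, inferInstance, fun x hx hx1 hm => ?_⟩
      rcases List.mem_cons.1 hx with rfl | hx
      · exact hH hm.2
      · exact h x hx hx1 hm.1

/-- A free product of residually finite groups is residually finite. -/
theorem residuallyFinite_coprodI {ι : Type*} {G : ι → Type*} [∀ i, Group (G i)]
    [∀ i, Group.ResiduallyFinite (G i)] : Group.ResiduallyFinite (Monoid.CoprodI G) := by
  classical
  rw [Group.residuallyFinite_iff_exists_finiteIndex]
  intro g hg
  obtain ⟨w, rfl⟩ := (Monoid.CoprodI.Word.equiv (M := G)).symm.surjective g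
  change w.prod ≠ 1 at hg
  -- a finite quotient of each factor in which the letters of `w` from this factor survive
  choose N hN hN' hNw using fun i => Group.ResiduallyFinite.exists_normal_finiteIndex_list
    (w.toList.filterMap fun x => if h : x.1 = i then some (h ▸ x.2) else none)
  have hNw' : ∀ x ∈ w.toList, x.2 ∉ N x.1 := by
    intro x hx
    refine hNw x.1 x.2 (List.mem_filterMap.2 ⟨x, hx, by simp⟩) (w.ne_one x hx)
  let Q : ι → Type _ := fun i => G i ⧸ N i
  let π : Monoid.CoprodI G →* Monoid.CoprodI Q :=
    Monoid.CoprodI.lift fun i => Monoid.CoprodI.of.comp (QuotientGroup.mk' (N i))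
  let w' : Monoid.CoprodI.Word Q :=
    { toList := w.toList.map fun x => ⟨x.1, (x.2 : G x.1 ⧸ N x.1)⟩
      ne_one := by
        intro x hx
        obtain ⟨y, hy, rfl⟩ := List.mem_map.1 hx
        simpa [Q] using hNw' y hy
      chain_ne := by
        have := w.chain_ne
        rw [List.isChain_map]
        exact this }
  -- the image of the reduced word `w` is reduced, and hence nontrivial
  have hw' : w'.prod = π w.prod := by
    simp only [Monoid.CoprodI.Word.prod, w', map_list_prod, List.map_map]
    congr 1
  have hne : π w.prod ≠ 1 := by
    rw [← hw']
    intro h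
    have h2 : w' = Monoid.CoprodI.Word.empty :=
      (Monoid.CoprodI.Word.equiv (M := Q)).symm.injective
        (h.trans Monoid.CoprodI.Word.prod_empty.symm)
    have h3 : w.toList = [] := by
      have := congrArg Monoid.CoprodI.Word.toList h2
      simpa [w', Monoid.CoprodI.Word.empty] using this
    apply hg
    simp [Monoid.CoprodI.Word.prod, h3]
  have : Group.ResiduallyFinite (Monoid.CoprodI Q) := residuallyFinite_coprodI_of_finite
  obtain ⟨H, hH⟩ := Group.exists_finiteIndexNormalSubgroup_notMem _ hne
  exact ⟨(H.comap π).toSubgroup, inferInstance, hH⟩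

theorem Group.ResiduallyFinite.of_injective {G H : Type*} [Group G] [Group H]
    [Group.ResiduallyFinite H] (f : G →* H) (hf : Function.Injective f) :
    Group.ResiduallyFinite G := by
  rw [Group.residuallyFinite_iff_exists_finiteIndex]
  intro g hg
  obtain ⟨N, hN⟩ := Group.exists_finiteIndexNormalSubgroup_notMem (f g)
    (by rwa [Ne, map_eq_one_iff f hf])
  exact ⟨(N.comap f).toSubgroup, inferInstance, hN⟩

theorem residuallyFinite_multiplicative_int : Group.ResiduallyFinite (Multiplicative ℤ) := by
  apply Group.residuallyFinite_of_forall_exists_finite_monoidHom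
  intro g hg
  let m := (Multiplicative.toAdd g).natAbs + 1
  refine ⟨Multiplicative (ZMod m), inferInstance, inferInstance,
    AddMonoidHom.toMultiplicative (Int.castAddHom (ZMod m)), fun h => hg ?_⟩
  have h1 : ((Multiplicative.toAdd g : ℤ) : ZMod m) = 0 := h
  rw [ZMod.intCast_zmod_eq_zero_iff_dvd] at h1
  have h2 : Multiplicative.toAdd g = 0 := by
    refine Int.eq_zero_of_abs_lt_dvd h1 ?_
    simp only [m]
    push_cast
    exact lt_add_one _
  exact h2

theorem residuallyFinite_freeGroup (X : Type*) : Group.ResiduallyFinite (FreeGroup X) := by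
  have h : Group.ResiduallyFinite (FreeGroup Unit) := by
    have := residuallyFinite_multiplicative_int
    exact Group.ResiduallyFinite.of_injective (H := Multiplicative ℤ)
      (FreeGroup.mulEquivIntOfUnique : FreeGroup Unit ≃* Multiplicative ℤ).toMonoidHom
      (MulEquiv.injective _)
  have := residuallyFinite_coprodI (G := fun _ : X => FreeGroup Unit)
  exact Group.ResiduallyFinite.of_injective (freeGroupEquivCoprodI (ι := X)).toMonoidHom
    (MulEquiv.injective _)

end ResiduallyFinite

instance countable_freeGroup (X : Type*) [Countable X] : Countable (FreeGroup X) :=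
  inferInstanceAs (Countable (Quot _))

theorem countable_coprodI {ι : Type*} {G : ι → Type*} [∀ i, Group (G i)] [Countable ι]
    [∀ i, Countable (G i)] : Countable (Monoid.CoprodI G) := by
  have : Countable (FreeMonoid (Σ i, G i)) := inferInstanceAs (Countable (List _))
  exact inferInstanceAs (Countable (Quotient _))

/-! ### Derivations of groups -/

section Derivations

/-- `D : K → M` is a derivation (crossed homomorphism) with respect to the action of `K` on the
`S`-module `M` through `ρ : K → S`. -/
def IsDerivation {K S M : Type*} [Group K] [Ring S] [AddCommGroup M] [Module S M] (ρ : K →* S)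
    (D : K → M) : Prop :=
  ∀ g h, D (g * h) = D g + ρ g • D h

namespace IsDerivation

variable {K S M : Type*} [Group K] [Ring S] [AddCommGroup M] [Module S M] {ρ : K →* S}
  {D : K → M}

theorem map_one (hD : IsDerivation ρ D) : D 1 = 0 := by
  simpa using hD 1 1

theorem map_inv_eq_zero (hD : IsDerivation ρ D) {g : K} (hg : D g = 0) : D g⁻¹ = 0 := by
  have h := hD g⁻¹ g
  rw [inv_mul_cancel, hD.map_one, hg, smul_zero, add_zero] at h
  exact h.symm

theorem inner (ρ : K →* S) (m : M) : IsDerivation ρ fun g => (ρ g - 1) • m := by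
  intro g h
  simp only [map_mul, smul_smul, ← add_smul]
  congr 1
  noncomm_ring

theorem add {D' : K → M} (hD : IsDerivation ρ D) (hD' : IsDerivation ρ D') :
    IsDerivation ρ fun g => D g + D' g := by
  intro g h
  simp only [hD g h, hD' g h, smul_add]
  abel

theorem sub {D' : K → M} (hD : IsDerivation ρ D) (hD' : IsDerivation ρ D') :
    IsDerivation ρ fun g => D g - D' g := by
  intro g h
  simp only [hD g h, hD' g h, smul_sub]
  abel

theorem smul (hD : IsDerivation ρ D) (s : S) (hs : ∀ g, Commute s (ρ g)) :
    IsDerivation ρ fun g => s • D g := by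
  intro g h
  simp only [hD g h, smul_add, smul_smul, (hs g).eq]

/-- A derivation of a free group that vanishes on the generators vanishes. -/
theorem freeGroup_eq_zero {X : Type*} {ρ : FreeGroup X →* S} {D : FreeGroup X → M}
    (hD : IsDerivation ρ D) (h : ∀ x, D (FreeGroup.of x) = 0) (g : FreeGroup X) : D g = 0 := by
  induction g using FreeGroup.induction_on with
  | C1 => exact hD.map_one
  | of x => exact h x
  | inv_of x hx => exact hD.map_inv_eq_zero hx
  | mul x y hx hy => rw [hD, hx, hy, smul_zero, add_zero]

/-- A derivation of a free product that vanishes on the factors vanishes. -/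
theorem coprodI_eq_zero {ι : Type*} {G : ι → Type*} [∀ i, Group (G i)]
    {ρ : Monoid.CoprodI G →* S} {D : Monoid.CoprodI G → M}
    (hD : IsDerivation ρ D) (h : ∀ i (x : G i), D (Monoid.CoprodI.of x) = 0)
    (g : Monoid.CoprodI G) : D g = 0 := by
  induction g using Monoid.CoprodI.induction_on with
  | one => exact hD.map_one
  | of i x => exact h i x
  | mul x y hx hy => rw [hD, hx, hy, smul_zero, add_zero]

end IsDerivation

variable {S M : Type*} [Ring S] [AddCommGroup M] [Module S M]

/-- The action of `K` on the multiplicative copy of `M`; derivations `K → M` are the sections of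
the resulting semidirect product. -/
def actionHom {K : Type*} [Group K] (ρ : K →* S) : K →* MulAut (Multiplicative M) :=
  MonoidHom.mk'
    (fun g =>
      { toFun := fun m => Multiplicative.ofAdd (ρ g • m.toAdd)
        invFun := fun m => Multiplicative.ofAdd (ρ g⁻¹ • m.toAdd)
        left_inv := fun m => by simp [smul_smul, ← map_mul]
        right_inv := fun m => by simp [smul_smul, ← map_mul]
        map_mul' := fun m m' => by simp })
    fun g h => by
      ext m
      change Multiplicative.ofAdd (ρ (g * h) • m.toAdd) =
        Multiplicative.ofAdd (ρ g • ρ h • m.toAdd)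
      rw [map_mul, smul_smul]

theorem actionHom_apply {K : Type*} [Group K] (ρ : K →* S) (g : K) (m : Multiplicative M) :
    (actionHom ρ g m).toAdd = ρ g • m.toAdd := rfl

theorem isDerivation_of_section {K : Type*} [Group K] (ρ : K →* S)
    (f : K →* Multiplicative M ⋊[actionHom ρ] K) (hf : ∀ g, (f g).right = g) :
    IsDerivation ρ fun g => (f g).left.toAdd := by
  intro g h
  simp only [map_mul, SemidirectProduct.mul_left, toAdd_mul, actionHom_apply, hf]

/-- Derivations of a free group can be prescribed on the generators. -/
theorem exists_isDerivation_freeGroup {X : Type*} (ρ : FreeGroup X →* S) (c : X → M) :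
    ∃ D : FreeGroup X → M, IsDerivation ρ D ∧ ∀ x, D (FreeGroup.of x) = c x := by
  let f : FreeGroup X →* Multiplicative M ⋊[actionHom ρ] FreeGroup X :=
    FreeGroup.lift fun x => ⟨Multiplicative.ofAdd (c x), FreeGroup.of x⟩
  have hf : (SemidirectProduct.rightHom (φ := actionHom (M := M) ρ)).comp f = MonoidHom.id _ := by
    ext x; simp [f]
  exact ⟨_, isDerivation_of_section ρ f fun g => DFunLike.congr_fun hf g, fun x => by simp [f]⟩

/-- Derivations of a free product can be prescribed on the factors. -/
theorem exists_isDerivation_coprodI {ι : Type*} {G : ι → Type*} [∀ i, Group (G i)]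
    (ρ : Monoid.CoprodI G →* S) (D : ∀ i, G i → M)
    (hD : ∀ i, IsDerivation (ρ.comp Monoid.CoprodI.of) (D i)) :
    ∃ D' : Monoid.CoprodI G → M, IsDerivation ρ D' ∧ ∀ i x, D' (Monoid.CoprodI.of x) = D i x := by
  let f : Monoid.CoprodI G →* Multiplicative M ⋊[actionHom ρ] Monoid.CoprodI G :=
    Monoid.CoprodI.lift fun i =>
      { toFun := fun x => ⟨Multiplicative.ofAdd (D i x), Monoid.CoprodI.of x⟩
        map_one' := by
          ext
          · simp [(hD i).map_one]
          · simp
        map_mul' := fun x y => by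
          ext
          · rw [hD i x y]; rfl
          · simp }
  have hf : (SemidirectProduct.rightHom (φ := actionHom (M := M) ρ)).comp f = MonoidHom.id _ := by
    ext i x; simp [f]
  exact ⟨_, isDerivation_of_section ρ f fun g => DFunLike.congr_fun hf g,
    fun i x => by simp [f]⟩

/-- A derivation of `A × B` is glued from derivations of the factors if these satisfy the relation
that expresses that `A` and `B` commute. -/
theorem IsDerivation.prod {A B : Type*} [Group A] [Group B] {ρ : A × B →* S} {DA : A → M}
    {DB : B → M} (hA : IsDerivation (ρ.comp (MonoidHom.inl A B)) DA)
    (hB : IsDerivation (ρ.comp (MonoidHom.inr A B)) DB)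
    (hAB : ∀ a b, (ρ (a, 1) - 1) • DB b = (ρ (1, b) - 1) • DA a) :
    IsDerivation ρ fun x => DA x.1 + ρ (x.1, 1) • DB x.2 := by
  rintro ⟨a, b⟩ ⟨a', b'⟩
  have h1 := hA a a'
  have h2 := hB b b'
  have h3 := hAB a' b
  simp only [MonoidHom.comp_apply, MonoidHom.inl_apply, MonoidHom.inr_apply] at h1 h2
  have e1 : ρ (a, b) = ρ (a, 1) * ρ (1, b) := by rw [← map_mul]; simp
  have e2 : ρ (a * a', 1) = ρ (a, 1) * ρ (a', 1) := by rw [← map_mul]; simp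
  have e3 : ρ (1, b) * ρ (a', 1) = ρ (a', 1) * ρ (1, b) := by
    rw [← map_mul, ← map_mul]; simp
  have h4 : ρ (a', 1) • DB b = DB b + (ρ (1, b) • DA a' - DA a') := by
    rw [sub_smul, one_smul, sub_smul, one_smul] at h3
    rw [← h3]; abel
  simp only [Prod.mk_mul_mk, h1, h2, e1, e2, smul_add, ← smul_smul]
  rw [h4, smul_smul (ρ (1, b)) (ρ (a', 1)), e3, ← smul_smul (ρ (a', 1))]
  simp only [smul_add, smul_sub]
  abel

end Derivations

/-! ### Projective modules cut out of free modules by idempotents -/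

section WeightedFree

variable {S : Type*} [Ring S] {T : Type*} (w : T → S)

/-- The endomorphism of the free module on `T` that multiplies the coordinate `t` by `w t` from
the right. -/
noncomputable def weightMap : (T →₀ S) →ₗ[S] (T →₀ S) :=
  Finsupp.linearCombination S fun t => Finsupp.single t (w t)

theorem weightMap_single (t : T) (s : S) :
    weightMap w (Finsupp.single t s) = Finsupp.single t (s * w t) := by
  simp [weightMap]

theorem weightMap_apply (y : T →₀ S) (t : T) : weightMap w y t = y t * w t := by
  classical
  induction y using Finsupp.induction_linear with
  | zero => simp
  | add x y hx hy => simp [hx, hy, add_mul]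
  | single t' s =>
    rw [weightMap_single, Finsupp.single_apply, Finsupp.single_apply]
    split_ifs with h
    · rw [h]
    · simp

/-- The direct sum of the left ideals `S w_t`, for idempotents `w_t`. -/
noncomputable def weightedFree : Submodule S (T →₀ S) :=
  LinearMap.eqLocus (weightMap w) LinearMap.id

theorem mem_weightedFree {y : T →₀ S} : y ∈ weightedFree w ↔ weightMap w y = y := Iff.rfl

theorem mem_weightedFree' {y : T →₀ S} : y ∈ weightedFree w ↔ ∀ t, y t * w t = y t := by
  rw [mem_weightedFree, Finsupp.ext_iff]
  simp only [weightMap_apply]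

variable {w}

theorem weightMap_mem (hw : ∀ t, IsIdempotentElem (w t)) (y : T →₀ S) :
    weightMap w y ∈ weightedFree w := by
  rw [mem_weightedFree']
  intro t
  rw [weightMap_apply, mul_assoc, (hw t).eq]

/-- The projection of the free module onto `weightedFree w`. -/
noncomputable def weightProj (hw : ∀ t, IsIdempotentElem (w t)) :
    (T →₀ S) →ₗ[S] weightedFree w :=
  (weightMap w).codRestrict _ (weightMap_mem hw)

theorem weightProj_comp_subtype (hw : ∀ t, IsIdempotentElem (w t)) :
    weightProj hw ∘ₗ (weightedFree w).subtype = LinearMap.id :=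
  LinearMap.ext fun y => Subtype.ext y.2

theorem projective_weightedFree (hw : ∀ t, IsIdempotentElem (w t)) :
    Module.Projective S (weightedFree w) :=
  Module.Projective.of_split _ _ (weightProj_comp_subtype hw)

/-- The restriction of a linear map of free modules to a map between `weightedFree` modules. -/
noncomputable def weightRestrict {T' : Type*} (w : T → S) (w' : T' → S)
    (f : (T →₀ S) →ₗ[S] (T' →₀ S)) (hf : ∀ y, weightMap w' (f y) = f y) :
    weightedFree w →ₗ[S] weightedFree w' :=
  (f ∘ₗ (weightedFree w).subtype).codRestrict _ fun y => hf y

theorem coe_weightRestrict {T' : Type*} {w : T → S} {w' : T' → S}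
    (f : (T →₀ S) →ₗ[S] (T' →₀ S)) (hf : ∀ y, weightMap w' (f y) = f y) (y : weightedFree w) :
    (weightRestrict w w' f hf y : T' →₀ S) = f y := rfl

end WeightedFree

/-! ### Group rings and their augmentation -/

section GroupRing

variable {R : Type u} [Ring R] {G : Type} [Group G]

theorem augmentation_single (g : G) (r : R) :
    augmentation R G (MonoidAlgebra.single g r) = r := by
  simp [augmentation]

theorem augmentation_of (g : G) : augmentation R G (MonoidAlgebra.of R G g) = 1 := by
  simp [augmentation_single]

theorem single_eq_mul_of (g : G) (r : R) :
    (MonoidAlgebra.single g r : MonoidAlgebra R G) =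
      MonoidAlgebra.single 1 r * MonoidAlgebra.of R G g := by
  simp [MonoidAlgebra.single_mul_single]

variable {M : Type*} [AddCommGroup M] [Module (MonoidAlgebra R G) M]

/-- The additive, left `R`-linear extension of a function `G → M` to the group ring. -/
noncomputable def groupRingLift (f : G → M) : MonoidAlgebra R G →+ M :=
  (Finsupp.liftAddHom fun g =>
    ((AddMonoidHom.flip (smulAddHom (MonoidAlgebra R G) M)) (f g)).comp
      (MonoidAlgebra.singleAddHom (1 : G))).comp MonoidAlgebra.coeffAddEquiv.toAddMonoidHom

theorem groupRingLift_single (f : G → M) (g : G) (r : R) :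
    groupRingLift f (MonoidAlgebra.single g r) =
      (MonoidAlgebra.single 1 r : MonoidAlgebra R G) • f g := by
  simp [groupRingLift, MonoidAlgebra.singleAddHom]

/-- If `f (g h) = f g + g m` for all `g`, then `s (h - 1) ↦ s m` under the extension of `f`. -/
theorem groupRingLift_mul_sub_one (f : G → M) (h : G) (m : M)
    (hf : ∀ g, f (g * h) = f g + MonoidAlgebra.of R G g • m) (s : MonoidAlgebra R G) :
    groupRingLift f (s * (MonoidAlgebra.of R G h - 1)) = s • m := by
  induction s using MonoidAlgebra.induction_linear with
  | zero => simp
  | add x y hx hy => rw [add_mul, map_add, hx, hy, add_smul]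
  | single g r =>
    rw [mul_sub, mul_one, MonoidAlgebra.of_apply, MonoidAlgebra.single_mul_single, mul_one,
      map_sub, groupRingLift_single, groupRingLift_single, hf, smul_add, add_sub_cancel_left,
      smul_smul, single_eq_mul_of g r]

end GroupRing

/-! ### The resolution for a free product of groups `P × F × F` -/

section Resolution

variable {ι : Type} (P : ι → Type) [∀ i, Group (P i)] (X : ι → Type)

/-- The free product of the groups `P i × F × F`, with `F` free on `X i`. -/
abbrev FreeProd : Type :=
  Monoid.CoprodI fun i => P i × (FreeGroup (X i) × FreeGroup (X i))

variable {P X}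

/-- The inclusion of the finite factor `P i`. -/
def inP (i : ι) : P i →* FreeProd P X :=
  (Monoid.CoprodI.of (M := fun i => P i × (FreeGroup (X i) × FreeGroup (X i))) (i := i)).comp
    (MonoidHom.inl _ _)

/-- The inclusion of the first free factor of index `i`. -/
def inA (i : ι) : FreeGroup (X i) →* FreeProd P X :=
  (Monoid.CoprodI.of (M := fun i => P i × (FreeGroup (X i) × FreeGroup (X i))) (i := i)).comp
    ((MonoidHom.inr _ _).comp (MonoidHom.inl _ _))

/-- The inclusion of the second free factor of index `i`. -/
def inB (i : ι) : FreeGroup (X i) →* FreeProd P X :=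
  (Monoid.CoprodI.of (M := fun i => P i × (FreeGroup (X i) × FreeGroup (X i))) (i := i)).comp
    ((MonoidHom.inr _ _).comp (MonoidHom.inr _ _))

theorem commute_inP_inA (i : ι) (h : P i) (f : FreeGroup (X i)) :
    Commute (inP i h : FreeProd P X) (inA i f) := by
  simp only [Commute, SemiconjBy, inP, inA, MonoidHom.comp_apply, ← map_mul]; simp

theorem commute_inP_inB (i : ι) (h : P i) (f : FreeGroup (X i)) :
    Commute (inP i h : FreeProd P X) (inB i f) := by
  simp only [Commute, SemiconjBy, inP, inB, MonoidHom.comp_apply, ← map_mul]; simp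

theorem commute_inA_inB (i : ι) (f f' : FreeGroup (X i)) :
    Commute (inA i f : FreeProd P X) (inB i f') := by
  simp only [Commute, SemiconjBy, inA, inB, MonoidHom.comp_apply, ← map_mul]; simp

theorem inP_mul_inA_mul_inB (i : ι) (x : P i × (FreeGroup (X i) × FreeGroup (X i))) :
    (Monoid.CoprodI.of x : FreeProd P X) = inP i x.1 * (inA i x.2.1 * inB i x.2.2) := by
  simp only [inP, inA, inB, MonoidHom.comp_apply]
  rw [← map_mul Monoid.CoprodI.of, ← map_mul Monoid.CoprodI.of]
  simp

/-- The retraction of the free product onto its factor of index `i`. -/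
noncomputable def retr (i : ι) :
    FreeProd P X →* P i × (FreeGroup (X i) × FreeGroup (X i)) :=
  letI := Classical.decEq ι
  Monoid.CoprodI.lift (Pi.mulSingle i (MonoidHom.id _))

theorem retr_of (i : ι) (x : P i × (FreeGroup (X i) × FreeGroup (X i))) :
    retr i (Monoid.CoprodI.of x : FreeProd P X) = x := by
  classical
  simp [retr]

theorem retr_inA (i : ι) (f : FreeGroup (X i)) : retr i (inA i f : FreeProd P X) = (1, f, 1) :=
  retr_of i _

theorem retr_inB (i : ι) (f : FreeGroup (X i)) : retr i (inB i f : FreeProd P X) = (1, 1, f) :=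
  retr_of i _

/-- The index set of the generators in degree two: pairs of generators of the free groups. -/
abbrev GenTwo (X : ι → Type) : Type := Σ i, X i × X i

/-- The index set of the generators in degree one: for each `i`, the generators of the two free
groups, and one generator that takes care of the finite group `P i`. -/
abbrev GenOne (X : ι → Type) : Type := Σ i, Option (X i ⊕ X i)

variable (R : Type u) [Ring R]

local notation "RC" => MonoidAlgebra R (FreeProd P X)

local notation "ν" => MonoidAlgebra.of R (FreeProd P X)

variable [∀ i, Fintype (P i)]

/-- The scalar `|P i|⁻¹`, as an element of the group ring. -/
noncomputable def invCard (i : ι) : RC :=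
  MonoidAlgebra.single 1 (Ring.inverse (Fintype.card (P i) : R))

/-- The idempotent `|P i|⁻¹ ∑ h` of the group ring, the sum over `h ∈ P i`. -/
noncomputable def avg (i : ι) : RC := invCard R i * ∑ h : P i, ν (inP i h)

theorem augmentation_avg {i : ι} (hP : IsUnit (Fintype.card (P i) : R)) :
    augmentation R (FreeProd P X) (avg R i) = 1 := by
  simp only [avg, invCard, map_mul, map_sum, augmentation_of, augmentation_single]
  simp [Ring.inverse_mul_cancel _ hP]

theorem invCard_commute {i : ι} (hP : IsUnit (Fintype.card (P i) : R)) (s : RC) :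
    Commute (invCard R i) s := by
  refine MonoidAlgebra.single_commute (fun g => Commute.one_left g) (fun r => ?_) s
  obtain ⟨c, hc⟩ := hP
  rw [← hc, Ring.inverse_unit]
  exact Commute.units_inv_left (hc ▸ Nat.cast_commute _ r)

theorem invCard_mul_card {i : ι} (hP : IsUnit (Fintype.card (P i) : R)) :
    invCard R i * (Fintype.card (P i) : RC) = 1 := by
  rw [invCard, MonoidAlgebra.natCast_def, MonoidAlgebra.single_mul_single,
    Ring.inverse_mul_cancel _ hP, mul_one, MonoidAlgebra.one_def]

variable {R}

theorem inP_mul_avg {i : ι} (hP : IsUnit (Fintype.card (P i) : R)) (h : P i) :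
    ν (inP i h) * avg R i = avg R i := by
  rw [avg, ← mul_assoc, ← (invCard_commute R hP _).eq, mul_assoc, Finset.mul_sum]
  congr 1
  simp only [← map_mul]
  exact Fintype.sum_equiv (Equiv.mulLeft h) _ _ fun _ => rfl

theorem avg_mul_self {i : ι} (hP : IsUnit (Fintype.card (P i) : R)) :
    IsIdempotentElem (avg R i : RC) := by
  unfold IsIdempotentElem
  conv_lhs => enter [1]; rw [avg]
  rw [mul_assoc, Finset.sum_mul, Finset.sum_congr rfl fun h _ => inP_mul_avg hP h,
    Finset.sum_const, Finset.card_univ, nsmul_eq_mul, ← mul_assoc, invCard_mul_card R hP, one_mul]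

theorem avg_commute {i : ι} (hP : IsUnit (Fintype.card (P i) : R)) (g : FreeProd P X)
    (hg : ∀ h : P i, Commute (inP i h) g) : Commute (avg R i) (ν g) :=
  (invCard_commute R hP _).mul_left
    (Commute.sum_left _ _ _ fun h _ => (hg h).map ν)

theorem avg_commute_inA {i : ι} (hP : IsUnit (Fintype.card (P i) : R)) (f : FreeGroup (X i)) :
    Commute (avg R i) (ν (inA i f)) :=
  avg_commute hP _ fun h => commute_inP_inA i h f

theorem avg_commute_inB {i : ι} (hP : IsUnit (Fintype.card (P i) : R)) (f : FreeGroup (X i)) :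
    Commute (avg R i) (ν (inB i f)) :=
  avg_commute hP _ fun h => commute_inP_inB i h f

theorem one_sub_avg {i : ι} (hP : IsUnit (Fintype.card (P i) : R)) :
    1 - (avg R i : RC) = ∑ h : P i, -invCard R i * (ν (inP i h) - 1) := by
  rw [← Finset.mul_sum, Finset.sum_sub_distrib, Finset.sum_const, Finset.card_univ,
    nsmul_eq_mul, mul_one, neg_mul, mul_sub, invCard_mul_card R hP, avg]
  abel

/-- The generator of index `j` of the first free factor of index `i`. -/
noncomputable abbrev genA (R : Type u) [Ring R] {i : ι} (j : X i) : RC := ν (inA i (FreeGroup.of j))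

/-- The generator of index `k` of the second free factor of index `i`. -/
noncomputable abbrev genB (R : Type u) [Ring R] {i : ι} (k : X i) : RC := ν (inB i (FreeGroup.of k))

variable (R)

/-- The idempotents in degree two: `e_i`, the average over `P i`. -/
noncomputable def wTwo (t : GenTwo X) : RC := avg R t.1

/-- The idempotents in degree one: the average `e_i` over `P i` for the generators of the free
groups, and `1 - e_i` for the additional generator. -/
noncomputable def wOne : GenOne X → RC
  | ⟨i, none⟩ => 1 - avg R i
  | ⟨i, some _⟩ => avg R i

/-- The values of the differential on the generators in degree one: `(a_j - 1) e_i`, `(b_k - 1) e_i`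
and `1 - e_i`, where `e_i` is the average over `P i`. -/
noncomputable def dOneGen : GenOne X → RC
  | ⟨i, none⟩ => 1 - avg R i
  | ⟨i, some (Sum.inl j)⟩ => (genA R j - 1) * avg R i
  | ⟨i, some (Sum.inr k)⟩ => (genB R k - 1) * avg R i

/-- The differential in degree one, on the whole free module. -/
noncomputable def dOne : (GenOne X →₀ RC) →ₗ[RC] RC :=
  Finsupp.linearCombination RC (dOneGen R)

/-- The values of the differential on the generators in degree two, which express that the
generators of the two free groups commute: `(a_j - 1) e_i [b_k] - (b_k - 1) e_i [a_j]`. -/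
noncomputable def dTwoGen (t : GenTwo X) : GenOne X →₀ RC :=
  Finsupp.single ⟨t.1, some (Sum.inr t.2.2)⟩ ((genA R t.2.1 - 1) * avg R t.1) -
    Finsupp.single ⟨t.1, some (Sum.inl t.2.1)⟩ ((genB R t.2.2 - 1) * avg R t.1)

/-- The differential in degree two, on the whole free module. -/
noncomputable def dTwo : (GenTwo X →₀ RC) →ₗ[RC] (GenOne X →₀ RC) :=
  Finsupp.linearCombination RC (dTwoGen R)

variable {R}

theorem isIdempotentElem_wTwo (hP : ∀ i, IsUnit (Fintype.card (P i) : R)) (t : GenTwo X) :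
    IsIdempotentElem (wTwo R t : RC) :=
  avg_mul_self (hP t.1)

theorem isIdempotentElem_wOne (hP : ∀ i, IsUnit (Fintype.card (P i) : R)) (t : GenOne X) :
    IsIdempotentElem (wOne R t : RC) := by
  rcases t with ⟨i, _ | _⟩
  · exact (avg_mul_self (hP i)).one_sub
  · exact avg_mul_self (hP i)

theorem weightMap_dTwo (hP : ∀ i, IsUnit (Fintype.card (P i) : R)) (y : GenTwo X →₀ RC) :
    weightMap (wOne R) (dTwo R y) = dTwo R y := by
  rw [← LinearMap.comp_apply]
  congr 1
  refine Finsupp.lhom_ext' fun t => LinearMap.ext_ring ?_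
  simp only [LinearMap.comp_apply, Finsupp.lsingle_apply, dTwo,
    Finsupp.linearCombination_single, one_smul, dTwoGen, map_sub, weightMap_single, wOne]
  rw [mul_assoc, mul_assoc, (avg_mul_self (hP t.1)).eq]

theorem dTwo_weightMap (hP : ∀ i, IsUnit (Fintype.card (P i) : R)) (y : GenTwo X →₀ RC) :
    dTwo R (weightMap (wTwo R) y) = dTwo R y := by
  rw [← LinearMap.comp_apply]
  congr 1
  refine Finsupp.lhom_ext' fun t => LinearMap.ext_ring ?_
  have hA := ((avg_commute_inA (hP t.1) (FreeGroup.of t.2.1)).sub_right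
    (Commute.one_right (avg R t.1 : RC))).eq
  have hB := ((avg_commute_inB (hP t.1) (FreeGroup.of t.2.2)).sub_right
    (Commute.one_right (avg R t.1 : RC))).eq
  have e := (avg_mul_self (R := R) (X := X) (hP t.1)).eq
  simp only [LinearMap.comp_apply, Finsupp.lsingle_apply, dTwo, weightMap_single,
    Finsupp.linearCombination_single, one_mul, one_smul, dTwoGen, wTwo, smul_sub,
    Finsupp.smul_single, smul_eq_mul]
  rw [← mul_assoc, ← mul_assoc, hA, hB, mul_assoc, mul_assoc, e]

theorem dOne_dTwo (hP : ∀ i, IsUnit (Fintype.card (P i) : R)) (y : GenTwo X →₀ RC) :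
    dOne R (dTwo R y) = 0 := by
  rw [← LinearMap.comp_apply, ← LinearMap.zero_apply (σ₁₂ := RingHom.id RC) y]
  congr 1
  refine Finsupp.lhom_ext' fun t => LinearMap.ext_ring ?_
  have hA := ((avg_commute_inA (hP t.1) (FreeGroup.of t.2.1)).sub_right
    (Commute.one_right (avg R t.1 : RC))).eq
  have hB := ((avg_commute_inB (hP t.1) (FreeGroup.of t.2.2)).sub_right
    (Commute.one_right (avg R t.1 : RC))).eq
  have e := (avg_mul_self (R := R) (X := X) (hP t.1)).eq
  have hAB : Commute (genA R t.2.1 : RC) (genB R t.2.2) :=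
    (commute_inA_inB t.1 _ _).map ν
  have hAB' := ((hAB.sub_left (Commute.one_left _)).sub_right (Commute.one_right _)).eq
  simp only [LinearMap.comp_apply, Finsupp.lsingle_apply, dTwo, dOne,
    Finsupp.linearCombination_single, one_smul, dTwoGen, map_sub, smul_eq_mul, dOneGen,
    LinearMap.zero_apply]
  rw [mul_assoc, ← mul_assoc (avg R t.1), hB, mul_assoc, e, ← mul_assoc, hAB',
    mul_assoc (_ - 1) (avg R t.1), ← mul_assoc (avg R t.1), hA, mul_assoc _ (avg R t.1), e,
    ← mul_assoc, sub_self]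

theorem augmentation_dOne (hP : ∀ i, IsUnit (Fintype.card (P i) : R)) (y : GenOne X →₀ RC) :
    augmentation R _ (dOne R y) = 0 := by
  induction y using Finsupp.induction_linear with
  | zero => simp
  | add x y hx hy => simp [hx, hy]
  | single t s =>
    rw [dOne, Finsupp.linearCombination_single, smul_eq_mul, map_mul]
    rcases t with ⟨i, _ | _ | _⟩ <;> simp [dOneGen, augmentation_avg R (hP i), augmentation_single]

end Resolution

/-! ### Exactness of the resolution -/

section Exactness

variable {ι : Type} {P : ι → Type} [∀ i, Group (P i)] {X : ι → Type} {R : Type u} [Ring R]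

local notation "RC" => MonoidAlgebra R (FreeProd P X)

local notation "ν" => MonoidAlgebra.of R (FreeProd P X)

/-- The inclusion of the factor of index `i`. -/
abbrev inFactor (i : ι) : P i × (FreeGroup (X i) × FreeGroup (X i)) →* FreeProd P X :=
  Monoid.CoprodI.of (M := fun i => P i × (FreeGroup (X i) × FreeGroup (X i))) (i := i)

/-- The map `(s_j) ↦ ∑ s_j (a_j - 1)` has an additive left inverse, which is made of Fox
derivatives on the cosets of the free group: the group is `(C / F) × F` as a right `F`-set, since
`F` is a retract. -/
theorem exists_fox_inA (i : ι) :
    ∃ L : RC →+ (X i →₀ RC), ∀ j s, L (s * (genA R j - 1)) = Finsupp.single j s := by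
  obtain ⟨D, hD, hDj⟩ := exists_isDerivation_freeGroup
    ((ν).comp (inA i)) (fun j : X i => (Finsupp.single j (1 : RC) : X i →₀ RC))
  let π : FreeProd P X → FreeGroup (X i) := fun g => (retr i g).2.1
  refine ⟨groupRingLift fun g => ν (g * inA i (π g)⁻¹) • D (π g), fun j s => ?_⟩
  rw [groupRingLift_mul_sub_one _ _ (Finsupp.single j 1)]
  · simp
  intro g
  have hπ : π (g * inA i (FreeGroup.of j)) = π g * FreeGroup.of j := by
    simp only [π, map_mul, retr_inA]; rfl
  simp only [hπ]
  rw [hD, hDj, smul_add, smul_smul, MonoidHom.comp_apply, ← map_mul]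
  congr 3
  · rw [mul_inv_rev, map_mul, mul_assoc, ← mul_assoc (inA i (FreeGroup.of j)), ← map_mul,
      mul_inv_cancel, map_one, one_mul]
  · rw [mul_inv_rev, map_mul, map_inv, map_inv]; group

variable {M : Type*} [AddCommGroup M] [Module (MonoidAlgebra R (FreeProd P X)) M]

/-- A derivation of the factor `P i × F × F` that vanishes on `P i` can be prescribed on the
generators of the free groups, subject to the relations of the direct product. -/
theorem exists_isDerivation_factor (i : ι) (α β : X i → M)
    (hα : ∀ (h : P i) j, ν (inP i h) • α j = α j) (hβ : ∀ (h : P i) k, ν (inP i h) • β k = β k)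
    (hαβ : ∀ j k, (genA R j - 1 : RC) • β k = (genB R k - 1 : RC) • α j) :
    ∃ D : P i × (FreeGroup (X i) × FreeGroup (X i)) → M,
      IsDerivation ((ν).comp (inFactor i)) D ∧ (∀ h, D (h, 1, 1) = 0) ∧
      (∀ j, D (1, FreeGroup.of j, 1) = α j) ∧ ∀ k, D (1, 1, FreeGroup.of k) = β k := by
  obtain ⟨DA, hDA, hDA'⟩ := exists_isDerivation_freeGroup ((ν).comp (inA i)) α
  obtain ⟨DB, hDB, hDB'⟩ := exists_isDerivation_freeGroup ((ν).comp (inB i)) β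
  have hpDA : ∀ h f, (ν (inP i h) - 1) • DA f = 0 := by
    intro h
    refine (hDA.smul _ fun g => ?_).freeGroup_eq_zero fun j => ?_
    · exact (((commute_inP_inA i h g).map ν).sub_left (Commute.one_left _))
    · rw [hDA', sub_smul, hα, one_smul, sub_self]
  have hpDB : ∀ h f, (ν (inP i h) - 1) • DB f = 0 := by
    intro h
    refine (hDB.smul _ fun g => ?_).freeGroup_eq_zero fun j => ?_
    · exact (((commute_inP_inB i h g).map ν).sub_left (Commute.one_left _))
    · rw [hDB', sub_smul, hβ, one_smul, sub_self]
  have hca : ∀ a b, Commute (ν (inA i a) - 1 : RC) (ν (inB i b)) := fun a b =>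
    ((commute_inA_inB i a b).map ν).sub_left (Commute.one_left _)
  have hcb : ∀ a b, Commute (ν (inB i b) - 1 : RC) (ν (inA i a)) := fun a b =>
    ((commute_inA_inB i a b).symm.map ν).sub_left (Commute.one_left _)
  -- both sides are derivations in `a` and in `b`
  have hAB : ∀ a b, (ν (inA i a) - 1) • DB b = (ν (inB i b) - 1) • DA a := by
    intro a b
    have h1 : ∀ j b, (ν (inA i (FreeGroup.of j)) - 1) • DB b =
        (ν (inB i b) - 1) • DA (FreeGroup.of j) := by
      intro j b
      rw [← sub_eq_zero]
      refine ((hDB.smul _ fun g => hca _ g).sub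
        (IsDerivation.inner _ (DA (FreeGroup.of j)))).freeGroup_eq_zero (fun k => ?_) b
      rw [hDB', hDA']
      exact sub_eq_zero.2 (hαβ j k)
    rw [← sub_eq_zero]
    refine ((IsDerivation.inner ((ν).comp (inA i)) (DB b)).sub
      (hDA.smul _ fun g => hcb g b)).freeGroup_eq_zero (fun j => ?_) a
    exact sub_eq_zero.2 (h1 j b)
  let ρ : P i × (FreeGroup (X i) × FreeGroup (X i)) →* RC := (ν).comp (inFactor i)
  have hD0 := IsDerivation.prod (ρ := ρ.comp (MonoidHom.inr _ _)) hDA hDB hAB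
  have hD := IsDerivation.prod (ρ := ρ) (DA := fun _ => 0)
    (fun g h => by simp) hD0 (fun h x => by
      rw [smul_zero, smul_add, smul_smul]
      have h1 : (ρ (h, 1) - 1) • DA x.1 = 0 := hpDA h x.1
      have h2 : (ρ (h, 1) - 1) • DB x.2 = 0 := hpDB h x.2
      have h3 : Commute (ρ (h, 1) - 1) (ρ.comp (MonoidHom.inr _ _) (x.1, 1)) :=
        ((commute_inP_inA i h x.1).map ν).sub_left (Commute.one_left _)
      rw [h1, h3.eq, ← smul_smul, h2, smul_zero, add_zero])
  refine ⟨_, hD, fun h => ?_, fun j => ?_, fun k => ?_⟩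
  · simp [hDA.map_one, hDB.map_one]
  · have h1 : ρ (1, 1) = 1 := map_one ρ
    simp [hDA', hDB.map_one, h1]
  · have h1 : ρ (1, 1) = 1 := map_one ρ
    have h2 : ρ (1, 1, 1) = 1 := map_one ρ
    simp [hDA.map_one, hDB', h1, h2]

/-- Derivations of the free product that are inner on the groups `P i`. -/
theorem exists_isDerivation_freeProd (α β : ∀ i, X i → M) (u : ι → M)
    (hα : ∀ i (h : P i) j, ν (inP i h) • α i j = α i j)
    (hβ : ∀ i (h : P i) k, ν (inP i h) • β i k = β i k)
    (hαβ : ∀ i j k, (genA R j - 1 : RC) • β i k = (genB R k - 1 : RC) • α i j) :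
    ∃ D : FreeProd P X → M, IsDerivation ν D ∧
      (∀ i h, D (inP i h) = (ν (inP i h) - 1) • u i) ∧
      (∀ i j, D (inA i (FreeGroup.of j)) = α i j + (genA R j - 1 : RC) • u i) ∧
      ∀ i k, D (inB i (FreeGroup.of k)) = β i k + (genB R k - 1 : RC) • u i := by
  choose D hD hDP hDA hDB using fun i =>
    exists_isDerivation_factor i (α i) (β i) (hα i) (hβ i) (hαβ i)
  obtain ⟨D', hD', h⟩ := exists_isDerivation_coprodI ν _ fun i =>
    (hD i).add (IsDerivation.inner _ (u i))
  refine ⟨D', hD', fun i x => ?_, fun i j => ?_, fun i k => ?_⟩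
  · exact (h i (x, 1, 1)).trans (by rw [hDP, zero_add]; rfl)
  · exact (h i (1, FreeGroup.of j, 1)).trans (by rw [hDA]; rfl)
  · exact (h i (1, 1, FreeGroup.of k)).trans (by rw [hDB]; rfl)

variable [∀ i, Fintype (P i)]

/-- Exactness in degree two: the Fox derivatives of the coordinate of `dTwo R y` at the generator
of index `k` of the second free group are the coordinates of `y` at the pairs `(j, k)`. -/
theorem dTwo_injective (hP : ∀ i, IsUnit (Fintype.card (P i) : R)) {y : GenTwo X →₀ RC}
    (hy : y ∈ weightedFree (wTwo R)) (h : dTwo R y = 0) : y = 0 := by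
  classical
  ext1 ⟨i, j, k⟩
  obtain ⟨L, hL⟩ := exists_fox_inA (R := R) (P := P) (X := X) i
  have key : ∀ y : GenTwo X →₀ RC,
      L (dTwo R y ⟨i, some (Sum.inr k)⟩) j = weightMap (wTwo R) y ⟨i, j, k⟩ := by
    intro y
    induction y using Finsupp.induction_linear with
    | zero => simp
    | add x y hx hy => simp [hx, hy]
    | single t s =>
      obtain ⟨i', j', k'⟩ := t
      have hA := ((avg_commute_inA (hP i') (FreeGroup.of j')).sub_right
        (Commute.one_right (avg R i' : RC))).eq
      rw [dTwo, Finsupp.linearCombination_single, dTwoGen, weightMap_single, ← hA]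
      by_cases hi : i' = i
      · subst hi
        by_cases hk : k' = k
        · subst hk
          simp only [Finsupp.smul_apply, Finsupp.sub_apply, Finsupp.single_eq_same, smul_eq_mul]
          rw [Finsupp.single_eq_of_ne (by simp), sub_zero, ← mul_assoc, hL,
            Finsupp.single_apply, Finsupp.single_apply, wTwo]
          simp
        · rw [Finsupp.smul_apply, Finsupp.sub_apply, Finsupp.single_eq_of_ne (by simp [Ne.symm hk]),
            Finsupp.single_eq_of_ne (by simp), Finsupp.single_eq_of_ne (by simp [Ne.symm hk])]
          simp
      · rw [Finsupp.smul_apply, Finsupp.sub_apply,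
          Finsupp.single_eq_of_ne (by simp [Ne.symm hi]),
          Finsupp.single_eq_of_ne (by simp [Ne.symm hi]),
          Finsupp.single_eq_of_ne (by simp [Ne.symm hi])]
        simp
  have := key y
  rw [(mem_weightedFree _).1 hy, h] at this
  simpa using this.symm

/-- An additive map on the group ring that is adapted to the resolution: it inverts the
differential in degree one modulo the relations `hαβ`. It is the linear extension of the derivation
that takes the prescribed values on the free groups, up to the inner derivation given by the value
at the additional generator. -/
theorem exists_lift_dOneGen (hP : ∀ i, IsUnit (Fintype.card (P i) : R)) (m : GenOne X → M)
    (hm : ∀ t, (wOne R t : RC) • m t = m t)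
    (hαβ : ∀ i j k, (genA R j - 1 : RC) • m ⟨i, some (Sum.inr k)⟩ =
      (genB R k - 1 : RC) • m ⟨i, some (Sum.inl j)⟩) :
    ∃ D : RC →+ M, ∀ t (s : RC), D (s * dOneGen R t) = s • m t := by
  have hp : ∀ i (h : P i) x, ν (inP i h) • m ⟨i, some x⟩ = m ⟨i, some x⟩ := by
    intro i h x
    rw [← hm ⟨i, some x⟩, smul_smul, wOne, inP_mul_avg (hP i)]
  have hu : ∀ i, (avg R i : RC) • m ⟨i, none⟩ = 0 := by
    intro i
    rw [← hm, smul_smul, wOne, mul_sub, mul_one, (avg_mul_self (hP i)).eq, sub_self, zero_smul]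
  obtain ⟨D, hD, hDP, hDA, hDB⟩ := exists_isDerivation_freeProd
    (fun i j => m ⟨i, some (Sum.inl j)⟩) (fun i k => m ⟨i, some (Sum.inr k)⟩)
    (fun i => m ⟨i, none⟩) (fun i h j => hp i h _) (fun i h k => hp i h _) hαβ
  have hl : ∀ g s, groupRingLift D (s * (ν g - 1)) = s • D g := fun g =>
    groupRingLift_mul_sub_one D g (D g) fun g' => hD g' g
  refine ⟨groupRingLift D, ?_⟩
  have hsome : ∀ i x g (s : RC), Commute (avg R i) (ν g) →
      D g = m ⟨i, some x⟩ + (ν g - 1) • m ⟨i, none⟩ →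
      groupRingLift D (s * ((ν g - 1) * avg R i)) = s • m ⟨i, some x⟩ := by
    intro i x g s hc hg
    have hc' := (hc.sub_right (Commute.one_right _)).eq
    rw [← hc', ← mul_assoc, hl, hg, smul_add, smul_smul, mul_assoc, hc', ← mul_assoc,
      ← smul_smul _ (avg R i) (m ⟨i, none⟩), hu, smul_zero, add_zero, ← smul_smul]
    congr 1
    exact hm ⟨i, some x⟩
  rintro ⟨i, _ | j | k⟩ s
  · rw [dOneGen, one_sub_avg (hP i), Finset.mul_sum, map_sum]
    simp only [← mul_assoc, hl, hDP]
    simp only [smul_smul, ← Finset.sum_smul, mul_assoc]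
    rw [← Finset.mul_sum, ← one_sub_avg (hP i), ← smul_smul]
    congr 1
    exact hm ⟨i, none⟩
  · exact hsome i _ _ s (avg_commute_inA (hP i) _) (hDA i j)
  · exact hsome i _ _ s (avg_commute_inB (hP i) _) (hDB i k)

/-- Exactness in degree one: in the cokernel of the differential in degree two, the class of `y` can
be recovered from `dOne R y`. -/
theorem exists_dTwo_eq (hP : ∀ i, IsUnit (Fintype.card (P i) : R)) {y : GenOne X →₀ RC}
    (hy : y ∈ weightedFree (wOne R)) (h : dOne R y = 0) :
    ∃ z ∈ weightedFree (wTwo R), dTwo R z = y := by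
  let W := LinearMap.range (dTwo (P := P) (X := X) R)
  -- the values are the classes of the generators of degree one in the cokernel
  obtain ⟨D, hD⟩ := exists_lift_dOneGen hP
    (fun t => W.mkQ (Finsupp.single t (wOne R t))) (fun t => by
      rw [← map_smul, Finsupp.smul_single, smul_eq_mul, (isIdempotentElem_wOne hP t).eq])
    (fun i j k => by
      rw [← map_smul, ← map_smul, ← sub_eq_zero, ← map_sub, Submodule.mkQ_apply,
        Submodule.Quotient.mk_eq_zero]
      exact ⟨Finsupp.single ⟨i, j, k⟩ 1, by simp [dTwo, dTwoGen, wOne]⟩)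
  have key : ∀ y, D (dOne R y) = W.mkQ (weightMap (wOne R) y) := by
    intro y
    induction y using Finsupp.induction_linear with
    | zero => simp
    | add x y hx hy => rw [map_add, map_add, hx, hy, map_add, map_add]
    | single t s =>
      rw [dOne, Finsupp.linearCombination_single, smul_eq_mul, hD, weightMap_single, ← map_smul,
        Finsupp.smul_single, smul_eq_mul]
  have h1 := key y
  rw [h, map_zero, (mem_weightedFree _).1 hy, Submodule.mkQ_apply, eq_comm,
    Submodule.Quotient.mk_eq_zero] at h1
  obtain ⟨z, hz⟩ := h1
  exact ⟨weightMap (wTwo R) z, weightMap_mem (isIdempotentElem_wTwo hP) z,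
    (dTwo_weightMap hP z).trans hz⟩

/-- Exactness in degree zero: modulo the image of `dOne R`, the map `g ↦ g - 1` is a derivation that
vanishes on generators of the group, and hence vanishes. -/
theorem exists_dOne_eq (hP : ∀ i, IsUnit (Fintype.card (P i) : R)) {s : RC}
    (h : augmentation R _ s = 0) : ∃ y ∈ weightedFree (wOne R), dOne R y = s := by
  let J := LinearMap.range (dOne (P := P) (X := X) R)
  have hgen : ∀ t (s : RC), s * dOneGen R t ∈ J := fun t s =>
    ⟨Finsupp.single t s, by simp [dOne]⟩
  have hfac : ∀ i g, (ν g - 1) * avg R i ∈ J → ν g - 1 ∈ J := by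
    intro i g h
    have := J.add_mem h (hgen ⟨i, none⟩ (ν g - 1))
    rwa [dOneGen, ← mul_add, add_sub_cancel, mul_one] at this
  have hder : ∀ {K : Type} [Group K] (f : K →* FreeProd P X),
      IsDerivation ((ν).comp f) fun g => J.mkQ (ν (f g) - 1) := by
    intro K _ f g h
    rw [← map_smul, ← map_add]
    simp only [map_mul, MonoidHom.comp_apply, smul_eq_mul]
    noncomm_ring
  have hJ : ∀ {x : RC}, J.mkQ x = 0 ↔ x ∈ J := fun {x} => by
    rw [Submodule.mkQ_apply, Submodule.Quotient.mk_eq_zero]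
  have hone : ∀ g, J.mkQ (ν g - 1) = 0 := by
    refine (hder (MonoidHom.id _)).coprodI_eq_zero fun i x => ?_
    change J.mkQ (ν (Monoid.CoprodI.of x) - 1) = 0
    rw [inP_mul_inA_mul_inB]
    have h0 := hder (MonoidHom.id (FreeProd P X))
    have h1 : J.mkQ (ν (inP i x.1) - 1) = 0 := by
      refine hJ.2 (hfac i _ ?_)
      rw [sub_mul, inP_mul_avg (hP i), one_mul, sub_self]
      exact J.zero_mem
    have h2 : J.mkQ (ν (inA i x.2.1) - 1) = 0 := by
      refine (hder (inA i)).freeGroup_eq_zero (fun j => hJ.2 (hfac i _ ?_)) _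
      simpa [dOneGen] using hgen ⟨i, some (Sum.inl j)⟩ 1
    have h3 : J.mkQ (ν (inB i x.2.2) - 1) = 0 := by
      refine (hder (inB i)).freeGroup_eq_zero (fun j => hJ.2 (hfac i _ ?_)) _
      simpa [dOneGen] using hgen ⟨i, some (Sum.inr j)⟩ 1
    have e1 := h0 (inP i x.1) (inA i x.2.1 * inB i x.2.2)
    have e2 := h0 (inA i x.2.1) (inB i x.2.2)
    simp only [MonoidHom.id_apply] at e1 e2
    rw [e1, e2, h1, h2, h3]
    simp
  have hs : ∀ s : RC, J.mkQ (s - MonoidAlgebra.single 1 (augmentation R _ s)) = 0 := by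
    intro s
    induction s using MonoidAlgebra.induction_linear with
    | zero => simp
    | add x y hx hy =>
      rw [map_add, MonoidAlgebra.single_add, add_sub_add_comm, map_add, hx, hy, add_zero]
    | single g r =>
      have : (MonoidAlgebra.single g r : RC) - MonoidAlgebra.single 1 r =
          (MonoidAlgebra.single 1 r : RC) • (ν g - 1) := by
        rw [smul_eq_mul, mul_sub, ← single_eq_mul_of, mul_one]
      rw [augmentation_single, this, map_smul, hone, smul_zero]
  have := hs s
  rw [h, MonoidAlgebra.single_zero, sub_zero, hJ] at this
  obtain ⟨y, hy⟩ := this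
  refine ⟨weightMap (wOne R) y, weightMap_mem (isIdempotentElem_wOne hP) y, ?_⟩
  rw [← hy, ← LinearMap.comp_apply]
  congr 1
  refine Finsupp.lhom_ext' fun t => LinearMap.ext_ring ?_
  simp only [LinearMap.comp_apply, Finsupp.lsingle_apply, dOne, weightMap_single,
    Finsupp.linearCombination_single, one_mul, smul_eq_mul]
  obtain ⟨i, _ | j | k⟩ := t
  · exact (avg_mul_self (hP i)).one_sub.eq
  · simp only [wOne, dOneGen]
    rw [← ((avg_commute_inA (hP i) (FreeGroup.of j)).sub_right (Commute.one_right _)).eq,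
      ← mul_assoc, (avg_mul_self (hP i)).eq]
  · simp only [wOne, dOneGen]
    rw [← ((avg_commute_inB (hP i) (FreeGroup.of k)).sub_right (Commute.one_right _)).eq,
      ← mul_assoc, (avg_mul_self (hP i)).eq]

end Exactness

/-! ### The cohomological dimension -/

section ProjDim

/-- A module with a projective resolution `0 → Q₂ → Q₁ → Q₀ → Z → 0` in which `Q₂ → Q₁` has no
retraction has projective dimension two. -/
theorem projectiveDimension_eq_two {S : Type u} [Ring S] {Z : ModuleCat.{u} S}
    {Q₀ Q₁ Q₂ : Type u} [AddCommGroup Q₀] [Module S Q₀] [AddCommGroup Q₁] [Module S Q₁]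
    [AddCommGroup Q₂] [Module S Q₂] [Module.Projective S Q₀] [Module.Projective S Q₁]
    [Module.Projective S Q₂] (ε : Q₀ →ₗ[S] Z) (d₁ : Q₁ →ₗ[S] Q₀) (d₂ : Q₂ →ₗ[S] Q₁)
    (hε : Function.Surjective ε) (h₀ : LinearMap.ker ε = LinearMap.range d₁)
    (h₁ : LinearMap.ker d₁ = LinearMap.range d₂) (h₂ : Function.Injective d₂)
    (hr : ∀ s : Q₁ →ₗ[S] Q₂, s ∘ₗ d₂ ≠ LinearMap.id) :
    projectiveDimension Z = 2 := by
  let d : Q₁ →ₗ[S] LinearMap.ker ε := d₁.codRestrict _ fun x => h₀ ▸ ⟨x, rfl⟩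
  have hd : Function.Surjective d := by
    rintro ⟨y, hy⟩
    rw [h₀] at hy
    obtain ⟨x, rfl⟩ := hy
    exact ⟨x, rfl⟩
  have hkd : LinearMap.ker d = LinearMap.range d₂ := by
    rw [← h₁, LinearMap.ker_codRestrict]
  have hA := LinearMap.shortExact_shortComplexKer hε
  have hB := LinearMap.shortExact_shortComplexKer hd
  have hp0 : Projective (ModuleCat.of S Q₀) := inferInstance
  have hp1 : Projective (ModuleCat.of S Q₁) := inferInstance
  have hp2 : Module.Projective S (LinearMap.ker d) :=
    Module.Projective.of_equiv ((LinearEquiv.ofInjective d₂ h₂).trans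
      (LinearEquiv.ofEq _ _ hkd.symm))
  have hp2' : Projective (ModuleCat.of S (LinearMap.ker d)) := inferInstance
  have hAi := hA.hasProjectiveDimensionLT_X₃_iff 0 hp0
  have hAi' := hA.hasProjectiveDimensionLT_X₃_iff 1 hp0
  have hBi := hB.hasProjectiveDimensionLT_X₃_iff 0 hp1
  refine le_antisymm ?_ ?_
  · exact (projectiveDimension_le_iff _ 2).2 (hAi'.2 (hBi.2
      (inferInstanceAs (HasProjectiveDimensionLT (ModuleCat.of S (LinearMap.ker d)) 1))))
  · refine (projectiveDimension_ge_iff _ 2).2 fun h => ?_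
    have h3 := hAi.1 h
    have h4 : Projective (ModuleCat.of S (LinearMap.ker ε)) :=
      projective_iff_hasProjectiveDimensionLT_one.2 h3
    have h5 : Module.Projective S (LinearMap.ker ε) := (IsProjective.iff_projective _).2 h4
    obtain ⟨σ, hσ⟩ := Module.projective_lifting_property d LinearMap.id hd
    let e := LinearEquiv.ofInjective d₂ h₂
    have hmem : ∀ x, (LinearMap.id - σ ∘ₗ d : Q₁ →ₗ[S] Q₁) x ∈ LinearMap.range d₂ := by
      intro x
      rw [← hkd, LinearMap.mem_ker, LinearMap.sub_apply, map_sub]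
      have := LinearMap.congr_fun hσ (d x)
      simp only [LinearMap.comp_apply, LinearMap.id_apply] at this ⊢
      rw [this, sub_self]
    refine hr (e.symm.toLinearMap ∘ₗ (LinearMap.id - σ ∘ₗ d).codRestrict _ hmem) ?_
    ext x
    have hx : d (d₂ x) = 0 := by
      rw [← LinearMap.mem_ker, hkd]; exact ⟨x, rfl⟩
    have : (LinearMap.id - σ ∘ₗ d).codRestrict _ hmem (d₂ x) = e x := by
      ext
      simp [hx, e]
    simp [this]

/-- A linear map `d : Q₂ → Q₁` has no retraction if some `y` with `d y = s b - s' a` is not killed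
by a map to a module on which `s` and `s'` act as zero. -/
theorem comp_ne_id_of_eq_smul_sub {S Q₁ Q₂ Z : Type*} [Ring S] [AddCommGroup Q₁] [Module S Q₁]
    [AddCommGroup Q₂] [Module S Q₂] [AddCommGroup Z] [Module S Z] (d : Q₂ →ₗ[S] Q₁)
    (f : Q₂ →ₗ[S] Z) {y : Q₂} {a b : Q₁} {s s' : S} (hd : d y = s • b - s' • a) (hf : f y ≠ 0)
    (hs : ∀ z : Z, s • z = 0) (hs' : ∀ z : Z, s' • z = 0) (r : Q₁ →ₗ[S] Q₂) :
    r ∘ₗ d ≠ LinearMap.id := by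
  intro h
  have h1 : r (d y) = y := LinearMap.congr_fun h y
  rw [hd] at h1
  apply hf
  rw [← h1, map_sub, map_sub, map_smul, map_smul, map_smul, map_smul, hs, hs', sub_self]

end ProjDim

section CohDim

variable {ι : Type} {P : ι → Type} [∀ i, Group (P i)] {X : ι → Type} {R : Type u} [Ring R]
  [∀ i, Fintype (P i)]

local notation "RC" => MonoidAlgebra R (FreeProd P X)

/-- The differential in degree two, between the projective modules. -/
noncomputable def diffTwo (hP : ∀ i, IsUnit (Fintype.card (P i) : R)) :
    weightedFree (wTwo R : GenTwo X → RC) →ₗ[RC] weightedFree (wOne R : GenOne X → RC) :=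
  weightRestrict _ _ (dTwo R) (weightMap_dTwo hP)

/-- The differential in degree one, on the projective module. -/
noncomputable def diffOne : weightedFree (wOne R : GenOne X → RC) →ₗ[RC] RC :=
  dOne R ∘ₗ Submodule.subtype _

theorem diffTwo_injective (hP : ∀ i, IsUnit (Fintype.card (P i) : R)) :
    Function.Injective (diffTwo (X := X) hP) := by
  refine (injective_iff_map_eq_zero _).2 fun y h => Subtype.ext (dTwo_injective hP y.2 ?_)
  exact (coe_weightRestrict _ (weightMap_dTwo hP) y).symm.trans (congrArg Subtype.val h)

theorem diffOne_eq_zero_iff (hP : ∀ i, IsUnit (Fintype.card (P i) : R))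
    (y : weightedFree (wOne R : GenOne X → RC)) :
    diffOne y = 0 ↔ ∃ z, diffTwo hP z = y := by
  constructor
  · intro h
    obtain ⟨z, hz, hzy⟩ := exists_dTwo_eq hP y.2 h
    exact ⟨⟨z, hz⟩, Subtype.ext hzy⟩
  · rintro ⟨z, rfl⟩
    exact dOne_dTwo hP _

theorem exists_diffOne_iff (hP : ∀ i, IsUnit (Fintype.card (P i) : R)) (s : RC) :
    (∃ y : weightedFree (wOne R : GenOne X → RC), diffOne y = s) ↔ augmentation R _ s = 0 := by
  constructor
  · rintro ⟨y, rfl⟩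
    exact augmentation_dOne hP _
  · intro h
    obtain ⟨y, hy, hys⟩ := exists_dOne_eq hP h
    exact ⟨⟨y, hy⟩, hys⟩

/-- The trivial module of the group ring. -/
noncomputable abbrev trivMod (R : Type u) [Ring R] (G : Type) [Group G] :
    ModuleCat.{u} (MonoidAlgebra R G) :=
  (ModuleCat.restrictScalars (augmentation R G)).obj (ModuleCat.of R R)

/-- The augmentation, as a linear map to the trivial module. -/
noncomputable def augLinear (R : Type u) [Ring R] (G : Type) [Group G] :
    MonoidAlgebra R G →ₗ[MonoidAlgebra R G] trivMod R G where
  toFun s := (augmentation R G s : R)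
  map_add' x y := map_add (augmentation R G) x y
  map_smul' s x := map_mul (augmentation R G) s x

theorem augLinear_surjective (R : Type u) [Ring R] (G : Type) [Group G] :
    Function.Surjective (augLinear R G) := fun r =>
  ⟨MonoidAlgebra.single 1 (show R from r), augmentation_single (G := G) 1 (show R from r)⟩

/-- The differential in degree two has no retraction, since it is zero modulo the augmentation
ideal, and the module in degree two is not. -/
theorem diffTwo_not_split [Nontrivial R] (hP : ∀ i, IsUnit (Fintype.card (P i) : R))
    (t : GenTwo X) (s : weightedFree (wOne R : GenOne X → RC) →ₗ[RC]
      weightedFree (wTwo R : GenTwo X → RC)) : s ∘ₗ diffTwo hP ≠ LinearMap.id := by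
  have hd : diffTwo hP (weightProj (isIdempotentElem_wTwo hP) (Finsupp.single t 1)) =
      (genA R t.2.1 - 1 : RC) • weightProj (isIdempotentElem_wOne hP)
        (Finsupp.single ⟨t.1, some (Sum.inr t.2.2)⟩ 1) -
      (genB R t.2.2 - 1 : RC) • weightProj (isIdempotentElem_wOne hP)
        (Finsupp.single ⟨t.1, some (Sum.inl t.2.1)⟩ 1) := by
    apply Subtype.ext
    refine (dTwo_weightMap hP _).trans ?_
    change _ = (genA R t.2.1 - 1 : RC) • weightMap (wOne R) (Finsupp.single _ 1) -
      (genB R t.2.2 - 1 : RC) • weightMap (wOne R) (Finsupp.single _ 1)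
    rw [weightMap_single, weightMap_single]
    simp [dTwo, dTwoGen, wOne]
  have hz : ∀ (g : FreeProd P X) (z : trivMod R (FreeProd P X)),
      (MonoidAlgebra.of R (FreeProd P X) g - 1) • z = 0 := by
    intro g z
    change (augmentation R _ (MonoidAlgebra.of R (FreeProd P X) g - 1)) * (show R from z) = 0
    rw [map_sub, augmentation_of, map_one, sub_self, zero_mul]
  refine comp_ne_id_of_eq_smul_sub (Z := trivMod R (FreeProd P X))
    (Q₁ := weightedFree (wOne R : GenOne X → RC)) (Q₂ := weightedFree (wTwo R : GenTwo X → RC)) _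
    (augLinear R _ ∘ₗ Finsupp.lapply t ∘ₗ Submodule.subtype _) hd ?_ (hz _) (hz _) s
  change augmentation R _ (weightMap (wTwo R) (Finsupp.single t 1) t) ≠ 0
  rw [weightMap_apply, Finsupp.single_eq_same, one_mul, wTwo, augmentation_avg R (hP _)]
  exact one_ne_zero

theorem cohomologicalDimension_freeProd [Nontrivial R]
    (hP : ∀ i, IsUnit (Fintype.card (P i) : R)) (t : GenTwo X) :
    cohomologicalDimension R (FreeProd P X) = 2 := by
  have := projective_weightedFree (isIdempotentElem_wOne (X := X) hP)
  have := projective_weightedFree (isIdempotentElem_wTwo (X := X) hP)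
  refine projectiveDimension_eq_two (Z := trivMod R (FreeProd P X)) (Q₀ := RC)
    (Q₁ := weightedFree (wOne R : GenOne X → RC)) (Q₂ := weightedFree (wTwo R : GenTwo X → RC))
    (augLinear R (FreeProd P X)) diffOne (diffTwo hP)
    (augLinear_surjective R _) ?_ ?_ (diffTwo_injective hP) (diffTwo_not_split hP t)
  · exact Submodule.ext fun s => (exists_diffOne_iff hP s).symm
  · exact Submodule.ext fun y => diffOne_eq_zero_iff hP y

end CohDim

/-! ### The trace of the group von Neumann algebra -/

section VNTrace

variable {G : Type}

open Classical in
/-- The basis vector of `ℓ²(G)` at `g`. -/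
noncomputable def delta (g : G) : EllTwo G := lp.single 2 g (1 : ℂ)

theorem inner_delta (g : G) (f : EllTwo G) : inner ℂ (delta g) f = f g := by
  classical
  simp [delta, lp.inner_single_left]

theorem delta_apply (g h : G) [Decidable (g = h)] : delta g h = if g = h then 1 else 0 := by
  classical
  rw [delta, lp.single_apply, Pi.single_apply]
  split_ifs <;> simp_all

theorem ellTwo_ext {f f' : EllTwo G} (h : ∀ g, f g = f' g) : f = f' :=
  lp.ext (funext h)

variable [Group G]

theorem leftRegular_apply (g h : G) (f : EllTwo G) : leftRegular G g f h = f (g⁻¹ * h) := rfl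

theorem leftRegular_delta (g h : G) : leftRegular G g (delta h) = delta (g * h) := by
  classical
  refine ellTwo_ext fun x => ?_
  rw [leftRegular_apply, delta_apply, delta_apply]
  simp [eq_inv_mul_iff_mul_eq]

/-- The right translation `(ρ(g) f)(h) = f(h g)` on `ℓ²(G)`. -/
noncomputable def rightTranslation (g : G) : EllTwo G →ₗᵢ[ℂ] EllTwo G where
  toFun f := ⟨fun h => f (h * g), by
    have hp : 0 < (2 : ENNReal).toReal := by norm_num
    have hf := (memℓp_gen_iff hp).1 (lp.memℓp f)
    exact (memℓp_gen_iff hp).2 (((Equiv.mulRight g).summable_iff).2 hf)⟩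
  map_add' f f' := by ext h; simp; rfl
  map_smul' c f := by ext h; simp
  norm_map' f := by
    have hp : 0 < (2 : ENNReal).toReal := by norm_num
    simp only [lp.norm_eq_tsum_rpow hp]
    congr 1
    exact (Equiv.mulRight g).tsum_eq fun h => ‖f h‖ ^ (2 : ENNReal).toReal

theorem rightTranslation_apply (g h : G) (f : EllTwo G) : rightTranslation g f h = f (h * g) := rfl

theorem rightTranslation_delta (g h : G) : rightTranslation g (delta h) = delta (h * g⁻¹) := by
  classical
  refine ellTwo_ext fun x => ?_
  rw [rightTranslation_apply, delta_apply, delta_apply]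
  simp [mul_inv_eq_iff_eq_mul]

theorem star_leftRegular (g : G) : star (leftRegular G g) = leftRegular G g⁻¹ := by
  rw [ContinuousLinearMap.star_eq_adjoint, eq_comm, ContinuousLinearMap.eq_adjoint_iff]
  intro x y
  rw [lp.inner_eq_tsum, lp.inner_eq_tsum,
    ← (Equiv.mulLeft g⁻¹).tsum_eq fun c => inner ℂ (leftRegular G g⁻¹ x c) (y c)]
  simp [leftRegular_apply]

theorem mem_groupVN_iff {T : EllTwo G →L[ℂ] EllTwo G} :
    T ∈ groupVN G ↔ ∀ s : EllTwo G →L[ℂ] EllTwo G,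
      (∀ g, leftRegular G g * s = s * leftRegular G g) → s * T = T * s := by
  have hs : ∀ s : EllTwo G →L[ℂ] EllTwo G, s ∈ StarSubalgebra.centralizer ℂ
      (Set.range (leftRegular G)) ↔ ∀ g, leftRegular G g * s = s * leftRegular G g := by
    intro s
    rw [StarSubalgebra.mem_centralizer_iff]
    constructor
    · intro h g; exact (h _ ⟨g, rfl⟩).1
    · rintro h _ ⟨g, rfl⟩
      exact ⟨h g, by rw [star_leftRegular]; exact h _⟩
  change T ∈ StarSubalgebra.centralizer ℂ
    (StarSubalgebra.centralizer ℂ (Set.range (leftRegular G)) : Set (EllTwo G →L[ℂ] EllTwo G)) ↔ _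
  rw [StarSubalgebra.mem_centralizer_iff]
  constructor
  · intro h s hs'; exact (h s ((hs s).2 hs')).1
  · intro h s hs'
    exact ⟨h s ((hs s).1 hs'), h _ ((hs _).1 (star_mem hs'))⟩

theorem rightTranslation_comm (T : groupVN G) (g : G) (f : EllTwo G) :
    (T : EllTwo G →L[ℂ] EllTwo G) (rightTranslation g f) =
      rightTranslation g ((T : EllTwo G →L[ℂ] EllTwo G) f) := by
  have h := mem_groupVN_iff.1 T.2 (rightTranslation g).toContinuousLinearMap fun g' => by
    ext f x
    change rightTranslation g f (g'⁻¹ * x) = f (g'⁻¹ * (x * g))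
    rw [rightTranslation_apply, mul_assoc]
  exact (congrArg (fun A : EllTwo G →L[ℂ] EllTwo G => A f) h).symm

theorem vn_apply_delta (T : groupVN G) (g : G) :
    (T : EllTwo G →L[ℂ] EllTwo G) (delta g) =
      rightTranslation g⁻¹ ((T : EllTwo G →L[ℂ] EllTwo G) (delta 1)) := by
  rw [← rightTranslation_comm, rightTranslation_delta, inv_inv, one_mul]

theorem vnTrace_eq (T : groupVN G) :
    vnTrace G T = ((T : EllTwo G →L[ℂ] EllTwo G) (delta 1)) 1 := inner_delta _ _

theorem vnTrace_eq_inner (T : groupVN G) :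
    vnTrace G T = inner ℂ (delta 1) ((T : EllTwo G →L[ℂ] EllTwo G) (delta 1)) := rfl

theorem vnTrace_add (S T : groupVN G) : vnTrace G (S + T) = vnTrace G S + vnTrace G T := by
  simp only [vnTrace_eq]; rfl

/-- The trace on the group von Neumann algebra, as an additive map. -/
noncomputable def vnTraceHom (G : Type) [Group G] : groupVN G →+ ℂ where
  toFun := vnTrace G
  map_zero' := by rw [vnTrace_eq]; rfl
  map_add' := vnTrace_add

theorem coe_star_vn (T : groupVN G) : ((star T : groupVN G) : EllTwo G →L[ℂ] EllTwo G) =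
    ContinuousLinearMap.adjoint (T : EllTwo G →L[ℂ] EllTwo G) := rfl

theorem star_apply_delta_one (T : groupVN G) (g : G) :
    ((star T : groupVN G) : EllTwo G →L[ℂ] EllTwo G) (delta 1) g =
      star (((T : EllTwo G →L[ℂ] EllTwo G) (delta 1)) g⁻¹) := by
  rw [← inner_delta g, coe_star_vn, ContinuousLinearMap.adjoint_inner_right, vn_apply_delta,
    ← inner_conj_symm, inner_delta, rightTranslation_apply, one_mul]
  rfl

/-- The coefficients `(T δ₁)(g)` determine the trace of a product. -/
theorem hasSum_vnTrace_mul (S T : groupVN G) :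
    HasSum (fun g => ((S : EllTwo G →L[ℂ] EllTwo G) (delta 1)) g⁻¹ *
      ((T : EllTwo G →L[ℂ] EllTwo G) (delta 1)) g) (vnTrace G (S * T)) := by
  have h := lp.hasSum_inner (𝕜 := ℂ) (((star S : groupVN G) : EllTwo G →L[ℂ] EllTwo G) (delta 1))
    ((T : EllTwo G →L[ℂ] EllTwo G) (delta 1))
  rw [coe_star_vn, ContinuousLinearMap.adjoint_inner_left, ← coe_star_vn] at h
  have e : (fun g => ((S : EllTwo G →L[ℂ] EllTwo G) (delta 1)) g⁻¹ *
      ((T : EllTwo G →L[ℂ] EllTwo G) (delta 1)) g) = fun g =>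
      inner ℂ (((star S : groupVN G) : EllTwo G →L[ℂ] EllTwo G) (delta 1) g)
        ((T : EllTwo G →L[ℂ] EllTwo G) (delta 1) g) := by
    funext g
    rw [star_apply_delta_one, RCLike.inner_apply]
    simp [mul_comm]
  rw [e]
  exact h

theorem vnTrace_mul_comm (S T : groupVN G) : vnTrace G (S * T) = vnTrace G (T * S) := by
  have h := hasSum_vnTrace_mul S T
  rw [← (Equiv.inv G).hasSum_iff] at h
  refine h.unique ?_
  convert hasSum_vnTrace_mul T S using 2 with g
  simp [mul_comm]

theorem vnTrace_star_mul_self (T : groupVN G) :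
    vnTrace G (star T * T) = (‖(T : EllTwo G →L[ℂ] EllTwo G) (delta 1)‖ : ℂ) ^ 2 := by
  rw [vnTrace_eq_inner]
  change inner ℂ (delta 1) (((star T : groupVN G) : EllTwo G →L[ℂ] EllTwo G)
    ((T : EllTwo G →L[ℂ] EllTwo G) (delta 1))) = _
  rw [coe_star_vn, ContinuousLinearMap.adjoint_inner_right, inner_self_eq_norm_sq_to_K]
  rfl

theorem vnTrace_groupToVN (g : G) [Decidable (g = 1)] :
    vnTrace G (groupToVN G g) = if g = 1 then 1 else 0 := by
  classical
  rw [vnTrace_eq]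
  change leftRegular G g (delta 1) 1 = _
  rw [leftRegular_delta, delta_apply, mul_one]
  simp

theorem star_groupToVN (g : G) : star (groupToVN G g) = groupToVN G g⁻¹ :=
  Subtype.ext (star_leftRegular g)

/-- Elements of the von Neumann algebra are determined by their value at `δ₁`. -/
theorem vn_ext {S T : groupVN G}
    (h : (S : EllTwo G →L[ℂ] EllTwo G) (delta 1) = (T : EllTwo G →L[ℂ] EllTwo G) (delta 1)) :
    S = T := by
  have h1 : ∀ g, (S : EllTwo G →L[ℂ] EllTwo G) (delta g) =
      (T : EllTwo G →L[ℂ] EllTwo G) (delta g) :=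
    fun g => (vn_apply_delta S g).trans (by rw [h]; exact (vn_apply_delta T g).symm)
  have h2 : ContinuousLinearMap.adjoint (S : EllTwo G →L[ℂ] EllTwo G) =
      ContinuousLinearMap.adjoint (T : EllTwo G →L[ℂ] EllTwo G) := by
    refine ContinuousLinearMap.ext fun f => ellTwo_ext fun g => ?_
    rw [← inner_delta, ← inner_delta, ContinuousLinearMap.adjoint_inner_right,
      ContinuousLinearMap.adjoint_inner_right, h1]
  exact Subtype.ext (ContinuousLinearMap.adjoint.injective h2)

/-- A vector of `ℓ²(G)` that is invariant under right translation by an element of infinite order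
vanishes. -/
theorem eq_zero_of_rightTranslation_eq {a : G} (ha : ¬IsOfFinOrder a) {f : EllTwo G}
    (hf : rightTranslation a f = f) : f = 0 := by
  refine ellTwo_ext fun h => ?_
  have h1 : ∀ n : ℕ, f (h * a ^ n) = f h := by
    intro n
    induction n with
    | zero => simp
    | succ n ih =>
      rw [pow_succ, ← mul_assoc, ← rightTranslation_apply, hf, ih]
  have hp : 0 < (2 : ENNReal).toReal := by norm_num
  have hs := (memℓp_gen_iff hp).1 (lp.memℓp f)
  have hinj : Function.Injective fun n : ℕ => h * a ^ n := fun m n hmn =>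
    (injective_pow_iff_not_isOfFinOrder.2 ha) (mul_left_cancel hmn)
  have h2 := hs.comp_injective hinj
  simp only [Function.comp_def, h1] at h2
  have h3 := (summable_const_iff _).1 h2
  simpa using h3

theorem eq_zero_of_mul_groupToVN_sub_one {a : G} (ha : ¬IsOfFinOrder a) {T : groupVN G}
    (hT : T * (groupToVN G a - 1) = 0) : T = 0 := by
  rw [mul_sub, mul_one, sub_eq_zero] at hT
  refine vn_ext ?_
  have h1 : (T : EllTwo G →L[ℂ] EllTwo G) (leftRegular G a (delta 1)) =
      (T : EllTwo G →L[ℂ] EllTwo G) (delta 1) :=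
    congrArg (fun S : groupVN G => (S : EllTwo G →L[ℂ] EllTwo G) (delta 1)) hT
  rw [leftRegular_delta, mul_one, vn_apply_delta] at h1
  exact (eq_zero_of_rightTranslation_eq (by rwa [isOfFinOrder_inv_iff]) h1).trans rfl

end VNTrace

/-! ### Matrices of operators -/

section OpMat

variable {H : Type*} [NormedAddCommGroup H] [InnerProductSpace ℂ H]
  {X Y Z : Type*} [Fintype X] [Fintype Y] [Fintype Z]

/-- The operator `Hʸ → Hˣ` given by a matrix of operators on `H`. -/
noncomputable def opMat (A : Matrix X Y (H →L[ℂ] H)) :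
    PiLp 2 (fun _ : Y => H) →L[ℂ] PiLp 2 (fun _ : X => H) :=
  (PiLp.continuousLinearEquiv 2 ℂ (fun _ : X => H)).symm.toContinuousLinearMap ∘L
    ContinuousLinearMap.pi fun i => ∑ j, A i j ∘L PiLp.proj 2 (fun _ : Y => H) j

theorem opMat_apply (A : Matrix X Y (H →L[ℂ] H)) (v : PiLp 2 (fun _ : Y => H)) (i : X) :
    opMat A v i = ∑ j, A i j (v j) := by
  simp [opMat]

theorem opMat_sub (A B : Matrix X Y (H →L[ℂ] H)) : opMat (A - B) = opMat A - opMat B := by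
  refine ContinuousLinearMap.ext fun v => PiLp.ext fun i => ?_
  simp [opMat_apply, Finset.sum_sub_distrib]

theorem opMat_mul (A : Matrix X Y (H →L[ℂ] H)) (B : Matrix Y Z (H →L[ℂ] H)) :
    opMat (A * B) = opMat A ∘L opMat B := by
  refine ContinuousLinearMap.ext fun v => PiLp.ext fun i => ?_
  simp only [opMat_apply, Matrix.mul_apply, mul_apply_eq_comp, sum_apply, map_sum,
    ContinuousLinearMap.comp_apply]
  exact Finset.sum_comm

theorem adjoint_opMat [CompleteSpace H] (A : Matrix X Y (H →L[ℂ] H)) :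
    ContinuousLinearMap.adjoint (opMat A) = opMat A.conjTranspose := by
  rw [eq_comm, ContinuousLinearMap.eq_adjoint_iff]
  intro x y
  simp only [PiLp.inner_apply, opMat_apply, sum_inner, inner_sum, Matrix.conjTranspose_apply,
    ContinuousLinearMap.star_eq_adjoint, ContinuousLinearMap.adjoint_inner_left]
  exact Finset.sum_comm

variable [DecidableEq X] [DecidableEq Y]

theorem opMat_diagonal_apply (s : H →L[ℂ] H) (v : PiLp 2 (fun _ : X => H)) (i : X) :
    opMat (Matrix.diagonal fun _ => s) v i = s (v i) := by
  rw [opMat_apply, Finset.sum_eq_single i]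
  · simp
  · intro j _ hj
    simp [Matrix.diagonal_apply_ne _ (Ne.symm hj)]
  · simp

theorem opMat_one : opMat (1 : Matrix X X (H →L[ℂ] H)) = 1 := by
  refine ContinuousLinearMap.ext fun v => PiLp.ext fun i => ?_
  exact opMat_diagonal_apply 1 v i

theorem opMat_single (A : Matrix X Y (H →L[ℂ] H)) (i : X) (j : Y) (x : H) :
    opMat A (PiLp.single 2 j x) i = A i j x := by
  rw [opMat_apply, Finset.sum_eq_single j]
  · simp
  · intro k _ hk
    rw [PiLp.single_eq_of_ne 2 hk, map_zero]
  · simp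

theorem opMat_injective : Function.Injective (opMat (H := H) (X := X) (Y := Y)) := by
  intro A B h
  ext i j x
  rw [← opMat_single, h, opMat_single]

theorem exists_opMat_eq (T : PiLp 2 (fun _ : X => H) →L[ℂ] PiLp 2 (fun _ : X => H)) :
    ∃ A, opMat A = T := by
  refine ⟨Matrix.of fun i j => PiLp.proj 2 (fun _ : X => H) i ∘L T ∘L
    (PiLp.continuousLinearEquiv 2 ℂ (fun _ : X => H)).symm.toContinuousLinearMap ∘L
    ContinuousLinearMap.single ℂ (fun _ : X => H) j, ?_⟩
  refine ContinuousLinearMap.ext fun v => PiLp.ext fun i => ?_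
  have hv : v = ∑ j, PiLp.single 2 j (v j) := by
    refine PiLp.ext fun i => ?_
    simp only [WithLp.ofLp_sum, Finset.sum_apply, PiLp.ofLp_single]
    simp [Finset.sum_pi_single]
  conv_rhs => rw [hv, map_sum]
  rw [opMat_apply]
  simp only [WithLp.ofLp_sum, Finset.sum_apply]
  rfl

end OpMat

/-- If `a` is a contraction, then so is `1 - a a*`. -/
theorem norm_one_sub_comp_adjoint_le {E F : Type*} [NormedAddCommGroup E]
    [InnerProductSpace ℂ E] [CompleteSpace E] [NormedAddCommGroup F] [InnerProductSpace ℂ F]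
    [CompleteSpace F] (a : F →L[ℂ] E) (ha : ‖a‖ ≤ 1) :
    ‖1 - a ∘L ContinuousLinearMap.adjoint a‖ ≤ 1 := by
  refine ContinuousLinearMap.opNorm_le_bound _ zero_le_one fun v => ?_
  rw [one_mul]
  refine le_of_sq_le_sq ?_ (norm_nonneg _)
  set w := ContinuousLinearMap.adjoint a v with hw
  have h1 : (1 - a ∘L ContinuousLinearMap.adjoint a) v = v - a w := rfl
  have h2 : ‖a w‖ ≤ ‖w‖ := (a.le_opNorm w).trans (by nlinarith [norm_nonneg w])
  have h3 : inner ℂ v (a w) = (‖w‖ : ℂ) ^ 2 := by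
    rw [← ContinuousLinearMap.adjoint_inner_left, ← hw, inner_self_eq_norm_sq_to_K]; rfl
  have h4 : RCLike.re (inner ℂ v (a w)) = ‖w‖ ^ 2 := by
    rw [h3, ← Complex.ofReal_pow]; exact Complex.ofReal_re _
  rw [h1, norm_sub_sq (𝕜 := ℂ), h4]
  nlinarith [norm_nonneg w, norm_nonneg (a w)]

/-! ### Annihilator projections in matrices over the group von Neumann algebra -/

section Annihilator

variable {G : Type} [Group G] {X Y Z : Type*} [Fintype X] [Fintype Y] [Fintype Z]

/-- The operator `ℓ²(G)ʸ → ℓ²(G)ˣ` given by a matrix over the group von Neumann algebra. -/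
noncomputable def opVN (A : Matrix X Y (groupVN G)) :
    PiLp 2 (fun _ : Y => EllTwo G) →L[ℂ] PiLp 2 (fun _ : X => EllTwo G) :=
  opMat (A.map fun T => (T : EllTwo G →L[ℂ] EllTwo G))

theorem opVN_sub (A B : Matrix X Y (groupVN G)) : opVN (A - B) = opVN A - opVN B := by
  rw [opVN, opVN, opVN, ← opMat_sub]; rfl

theorem opVN_mul (A : Matrix X Y (groupVN G)) (B : Matrix Y Z (groupVN G)) :
    opVN (A * B) = opVN A ∘L opVN B := by
  rw [opVN, opVN, opVN, ← opMat_mul]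
  congr 1
  ext1 i j
  simp only [Matrix.map_apply, Matrix.mul_apply]
  exact map_sum (SubringClass.subtype (groupVN G)) _ _

theorem adjoint_opVN (A : Matrix X Y (groupVN G)) :
    ContinuousLinearMap.adjoint (opVN A) = opVN A.conjTranspose := by
  rw [opVN, opVN, adjoint_opMat]; rfl

theorem opVN_one [DecidableEq X] : opVN (1 : Matrix X X (groupVN G)) = 1 := by
  rw [← opMat_one, opVN]
  congr 1
  ext1 i j
  by_cases h : i = j
  · subst h; simp
  · simp [Matrix.one_apply_ne h]

theorem opVN_pow [DecidableEq X] (A : Matrix X X (groupVN G)) (k : ℕ) :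
    opVN (A ^ k) = opVN A ^ k := by
  induction k with
  | zero => rw [pow_zero, pow_zero, opVN_one]
  | succ k ih => rw [pow_succ, pow_succ, opVN_mul, ih]; rfl

theorem opVN_injective [DecidableEq X] [DecidableEq Y] :
    Function.Injective (opVN (G := G) (X := X) (Y := Y)) := by
  intro A B h
  ext1 i j
  exact Subtype.ext (congrFun (congrFun (opMat_injective h) i) j)

theorem vnTrace_sum {Z : Type*} (s : Finset Z) (f : Z → groupVN G) :
    vnTrace G (∑ z ∈ s, f z) = ∑ z ∈ s, vnTrace G (f z) :=
  map_sum (vnTraceHom G) f s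

/-- The unnormalized trace of a matrix over the group von Neumann algebra. -/
noncomputable def matTrace (A : Matrix X X (groupVN G)) : ℂ := ∑ i, vnTrace G (A i i)

theorem matTrace_add (A B : Matrix X X (groupVN G)) :
    matTrace (A + B) = matTrace A + matTrace B := by
  simp only [matTrace, Matrix.add_apply, vnTrace_add, Finset.sum_add_distrib]

theorem matTrace_sub (A B : Matrix X X (groupVN G)) :
    matTrace (A - B) = matTrace A - matTrace B := by
  rw [eq_sub_iff_add_eq, ← matTrace_add, sub_add_cancel]

theorem matTrace_mul_comm (A : Matrix X Y (groupVN G))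
    (B : Matrix Y X (groupVN G)) : matTrace (A * B) = matTrace (B * A) := by
  simp only [matTrace, Matrix.mul_apply, vnTrace_sum]
  rw [Finset.sum_comm]
  exact Finset.sum_congr rfl fun i _ => Finset.sum_congr rfl fun j _ => vnTrace_mul_comm _ _

theorem matTrace_one [DecidableEq X] :
    matTrace (1 : Matrix X X (groupVN G)) = Fintype.card X := by
  classical
  have : vnTrace G 1 = 1 := by
    rw [← map_one (groupToVN G), vnTrace_groupToVN]; simp
  simp [matTrace, this]

theorem matTrace_conjTranspose_mul_self_nonneg (A : Matrix X Y (groupVN G)) :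
    0 ≤ (matTrace (A.conjTranspose * A)).re := by
  simp only [matTrace, Matrix.mul_apply, Matrix.conjTranspose_apply, vnTrace_sum,
    vnTrace_star_mul_self,
    Complex.re_sum, ← Complex.ofReal_pow, Complex.ofReal_re]
  positivity

theorem matTrace_eq_sum_inner [DecidableEq X] (A : Matrix X X (groupVN G)) :
    matTrace A = ∑ i, inner ℂ (PiLp.single 2 i (delta 1) : PiLp 2 fun _ : X => EllTwo G)
      (opVN A (PiLp.single 2 i (delta 1))) := by
  refine Finset.sum_congr rfl fun i _ => ?_
  rw [PiLp.inner_apply, Finset.sum_eq_single i]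
  · rw [opVN, opMat_single, PiLp.single_eq_same]; rfl
  · intro j _ hj
    rw [PiLp.single_eq_of_ne 2 hj, inner_zero_left]
  · simp

/-- By the trace property, `|X| - tr (1 - AB)ᵏ` is symmetric in `A` and `B`. -/
theorem matTrace_pow_one_sub [DecidableEq X] [DecidableEq Y] (A : Matrix X Y (groupVN G))
    (B : Matrix Y X (groupVN G)) (k : ℕ) :
    Fintype.card X - matTrace ((1 - A * B) ^ k) = Fintype.card Y - matTrace ((1 - B * A) ^ k) := by
  have h : ∀ k : ℕ, (1 - A * B) ^ k * A = A * (1 - B * A) ^ k := by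
    intro k
    induction k with
    | zero => simp
    | succ k ih =>
      rw [pow_succ, pow_succ', Matrix.mul_assoc, show (1 - A * B) * A = A * (1 - B * A) by
        rw [Matrix.sub_mul, Matrix.mul_sub, Matrix.one_mul, Matrix.mul_one, Matrix.mul_assoc],
        ← Matrix.mul_assoc, ih, Matrix.mul_assoc, ← pow_succ, pow_succ']
  induction k with
  | zero => simp [matTrace_one]
  | succ k ih =>
    rw [pow_succ, pow_succ, mul_sub, mul_sub, matTrace_sub, matTrace_sub, mul_one, mul_one,
      ← Matrix.mul_assoc, h, Matrix.mul_assoc, matTrace_mul_comm, Matrix.mul_assoc,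
      sub_sub_eq_add_sub,
      sub_sub_eq_add_sub, add_sub_right_comm, ih, add_sub_right_comm]

/-- The scalar operators belong to the group von Neumann algebra. -/
noncomputable def scalarVN (G : Type) [Group G] : ℂ →+* groupVN G where
  toFun c := ⟨c • 1, mem_groupVN_iff.2 fun s _ => by simp⟩
  map_one' := Subtype.ext (one_smul _ _)
  map_mul' c d := Subtype.ext (by
    change (c * d) • (1 : EllTwo G →L[ℂ] EllTwo G) = c • 1 * d • 1
    simp [smul_smul, mul_comm])
  map_zero' := Subtype.ext (zero_smul _ _)
  map_add' c d := Subtype.ext (add_smul _ _ _)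

theorem scalarVN_commute (c : ℂ) (T : groupVN G) : Commute (scalarVN G c) T :=
  Subtype.ext (by
    change c • (1 : EllTwo G →L[ℂ] EllTwo G) * (T : EllTwo G →L[ℂ] EllTwo G) = T * c • 1
    simp)

end Annihilator

/-- The operator on `ℓ²(G)` acting diagonally on `ℓ²(G)ˣ`. -/
noncomputable def diagOp {G : Type} {X : Type*} [Fintype X] [DecidableEq X]
    (s : EllTwo G →L[ℂ] EllTwo G) :
    PiLp 2 (fun _ : X => EllTwo G) →L[ℂ] PiLp 2 (fun _ : X => EllTwo G) :=
  opMat (Matrix.diagonal fun _ => s)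

/-- `K` is the orthogonal projection of the row space `Nˣ` onto the left annihilator of the
matrix `A`, where `N` is the group von Neumann algebra. -/
structure IsAnnihilatorProj {G : Type} [Group G] {X Y : Type*} [Fintype X]
    (A : Matrix X Y (groupVN G)) (K : Matrix X X (groupVN G)) : Prop where
  idem : K * K = K
  conj : K.conjTranspose = K
  mul_eq_zero : K * A = 0
  vecMul_eq_self : ∀ y : X → groupVN G, Matrix.vecMul y A = 0 → Matrix.vecMul y K = y

section AnnihilatorProj

variable {G : Type} [Group G] {X Y Z : Type*} [Fintype X] [Fintype Y] [Fintype Z]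
  [DecidableEq X] [DecidableEq Y]

theorem star_commute_leftRegular {s : EllTwo G →L[ℂ] EllTwo G}
    (hs : ∀ g, leftRegular G g * s = s * leftRegular G g) (g : G) :
    leftRegular G g * star s = star s * leftRegular G g := by
  have h := congrArg star (hs g⁻¹)
  rw [star_mul, star_mul, star_leftRegular, inv_inv] at h
  exact h.symm

theorem opVN_diagOp (A : Matrix X Y (groupVN G)) {s : EllTwo G →L[ℂ] EllTwo G}
    (hs : ∀ g, leftRegular G g * s = s * leftRegular G g) (v) :
    opVN A (diagOp s v) = diagOp s (opVN A v) := by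
  refine PiLp.ext fun i => ?_
  rw [diagOp, diagOp, opMat_diagonal_apply, opVN, opMat_apply, opMat_apply, map_sum]
  refine Finset.sum_congr rfl fun j _ => ?_
  rw [opMat_diagonal_apply]
  exact (congrArg (fun B : EllTwo G →L[ℂ] EllTwo G => B (v j))
    (mem_groupVN_iff.1 (A i j).2 s hs)).symm

/-- An orthogonal projection whose range is invariant under the commutant of the group von
Neumann algebra is given by a matrix over this algebra. -/
theorem exists_opVN_eq_starProjection (L : Submodule ℂ (PiLp 2 fun _ : X => EllTwo G))
    [L.HasOrthogonalProjection]
    (hL : ∀ s : EllTwo G →L[ℂ] EllTwo G, (∀ g, leftRegular G g * s = s * leftRegular G g) →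
      ∀ v ∈ L, diagOp s v ∈ L) :
    ∃ K : Matrix X X (groupVN G), opVN K = L.starProjection := by
  obtain ⟨A, hA⟩ := exists_opMat_eq L.starProjection
  have key : ∀ s : EllTwo G →L[ℂ] EllTwo G, (∀ g, leftRegular G g * s = s * leftRegular G g) →
      L.starProjection * diagOp s = diagOp s * L.starProjection := by
    intro s hs
    have h1 : ∀ s : EllTwo G →L[ℂ] EllTwo G, (∀ g, leftRegular G g * s = s * leftRegular G g) →
        L.starProjection * (diagOp s * L.starProjection) = diagOp s * L.starProjection := by
      intro s hs
      refine ContinuousLinearMap.ext fun v => ?_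
      exact Submodule.starProjection_eq_self_iff.2 (hL s hs _ (L.starProjection_apply_mem v))
    have hP : star L.starProjection = L.starProjection := (isSelfAdjoint_starProjection L).star_eq
    have hD : star (diagOp (X := X) (star s)) = diagOp s := by
      rw [ContinuousLinearMap.star_eq_adjoint, diagOp, adjoint_opMat,
        Matrix.diagonal_conjTranspose, diagOp]
      congr 2
      funext i
      exact star_star s
    have h2 := congrArg star (h1 _ (star_commute_leftRegular hs))
    rw [star_mul, star_mul, hP, hD] at h2
    rw [← h2, mul_assoc, h1 s hs]
  have hmem : ∀ i j, A i j ∈ groupVN G := by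
    intro i j
    refine mem_groupVN_iff.2 fun s hs => ?_
    have h := key s hs
    rw [← hA] at h
    have h' := (opMat_mul _ _).trans (h.trans (opMat_mul _ _).symm)
    have h2 := congrFun (congrFun (opMat_injective h') i) j
    rw [Matrix.mul_diagonal, Matrix.diagonal_mul] at h2
    exact h2.symm
  exact ⟨Matrix.of fun i j => ⟨A i j, hmem i j⟩, hA⟩

open Filter Topology in
/-- The trace of the annihilator projection of a contraction, computed by the mean ergodic theorem
for the contraction `1 - A A*`, whose fixed vectors are the kernel of `A*`. -/
theorem exists_isAnnihilatorProj_of_norm_le (A : Matrix X Y (groupVN G)) (hA : ‖opVN A‖ ≤ 1) :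
    ∃ K, IsAnnihilatorProj A K ∧ Tendsto (fun n : ℕ => (n : ℂ)⁻¹ * ∑ k ∈ Finset.range n,
      matTrace ((1 - A * A.conjTranspose) ^ k)) atTop (𝓝 (matTrace K)) := by
  set f := opVN (1 - A * A.conjTranspose) with hf
  have hf' : f = 1 - opVN A ∘L ContinuousLinearMap.adjoint (opVN A) := by
    rw [hf, opVN_sub, opVN_one, opVN_mul, adjoint_opVN]
  have hfn : ‖f‖ ≤ 1 := hf' ▸ norm_one_sub_comp_adjoint_le _ hA
  set L := LinearMap.eqLocus f.toLinearMap
    (1 : PiLp 2 (fun _ : X => EllTwo G) →L[ℂ] PiLp 2 fun _ : X => EllTwo G).toLinearMap with hLdef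
  have hL : ∀ v, v ∈ L ↔ ContinuousLinearMap.adjoint (opVN A) v = 0 := by
    intro v
    have h1 : f v = v - opVN A (ContinuousLinearMap.adjoint (opVN A) v) := by rw [hf']; rfl
    change f v = v ↔ _
    rw [h1, sub_eq_self]
    constructor
    · intro h
      have h2 := ContinuousLinearMap.adjoint_inner_left (opVN A)
        (ContinuousLinearMap.adjoint (opVN A) v) v
      rw [h, inner_zero_right] at h2
      exact inner_self_eq_zero.1 h2
    · intro h
      rw [h, map_zero]
  obtain ⟨K, hK⟩ := exists_opVN_eq_starProjection L (by
    intro s hs v hv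
    rw [hL, adjoint_opVN] at hv ⊢
    rw [opVN_diagOp _ hs, hv, map_zero])
  have hKmem : ∀ v, ContinuousLinearMap.adjoint (opVN A) (opVN K v) = 0 := fun v => by
    rw [← hL, hK]; exact Submodule.starProjection_apply_mem _ v
  have hconj : K.conjTranspose = K := by
    refine opVN_injective ?_
    rw [← adjoint_opVN, hK]
    exact (isSelfAdjoint_starProjection _).star_eq
  -- `K` is the projection onto the kernel of `A*`
  refine ⟨K, ⟨?_, hconj, ?_, ?_⟩, ?_⟩
  · refine opVN_injective ?_
    rw [opVN_mul, hK]
    refine ContinuousLinearMap.ext fun v => ?_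
    exact Submodule.starProjection_eq_self_iff.2 (Submodule.starProjection_apply_mem _ v)
  · have h : A.conjTranspose * K = 0 := by
      refine opVN_injective ?_
      rw [opVN_mul, ← adjoint_opVN]
      refine ContinuousLinearMap.ext fun v => (hKmem v).trans (PiLp.ext fun i => ?_)
      rw [opVN, opMat_apply]
      simp
    rw [← Matrix.conjTranspose_conjTranspose (K * A), Matrix.conjTranspose_mul, hconj, h,
      Matrix.conjTranspose_zero]
  · intro y hy
    set B := Matrix.replicateRow Unit y
    have hB : B * A = 0 := by
      ext1 i j
      exact congrFun hy j
    have hBK : K * B.conjTranspose = B.conjTranspose := by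
      refine opVN_injective ?_
      rw [opVN_mul, hK]
      refine ContinuousLinearMap.ext fun v => ?_
      refine Submodule.starProjection_eq_self_iff.2 ((hL _).2 ?_)
      rw [adjoint_opVN]
      have h2 : opVN A.conjTranspose ∘L opVN B.conjTranspose = 0 := by
        rw [← opVN_mul, ← Matrix.conjTranspose_mul, hB, Matrix.conjTranspose_zero]
        refine ContinuousLinearMap.ext fun v => PiLp.ext fun i => ?_
        rw [opVN, opMat_apply]
        simp
      exact congrArg (fun T => T v) h2
    have h3 := congrArg Matrix.conjTranspose hBK
    rw [Matrix.conjTranspose_mul, hconj, Matrix.conjTranspose_conjTranspose] at h3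
    funext j
    exact congrFun (congrFun h3 ()) j
  · have key : ∀ (v : PiLp 2 fun _ : X => EllTwo G), Tendsto (fun n : ℕ => (n : ℂ)⁻¹ *
        ∑ k ∈ Finset.range n, inner ℂ v (opVN ((1 - A * A.conjTranspose) ^ k) v)) atTop
        (𝓝 (inner ℂ v (opVN K v))) := by
      intro v
      have h := f.tendsto_birkhoffAverage_orthogonalProjection hfn v
      rw [← Submodule.starProjection_apply, ← hK] at h
      refine (Tendsto.inner tendsto_const_nhds h).congr fun n => ?_
      rw [birkhoffAverage, birkhoffSum, inner_smul_right, inner_sum]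
      congr 1
      refine Finset.sum_congr rfl fun k _ => ?_
      rw [opVN_pow, ← hf]
      congr 1
      exact (congrFun (FunLike.coe_pow_eq_iterate f k) v).symm
    simp only [matTrace_eq_sum_inner]
    refine (tendsto_finsetSum Finset.univ fun i _ => key (PiLp.single 2 i (delta 1))).congr
      fun n => ?_
    rw [← Finset.mul_sum, Finset.sum_comm]

theorem norm_opVN_conjTranspose (A : Matrix X Y (groupVN G)) :
    ‖opVN A.conjTranspose‖ = ‖opVN A‖ := by
  rw [← adjoint_opVN]
  exact ContinuousLinearMap.adjoint.norm_map _

theorem star_scalarVN (c : ℂ) : star (scalarVN G c) = scalarVN G (star c) := by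
  refine Subtype.ext ?_
  change star (c • (1 : EllTwo G →L[ℂ] EllTwo G)) = star c • 1
  rw [star_smul, star_one]

theorem opVN_diagonal_scalarVN (c : ℂ) :
    opVN (Matrix.diagonal fun _ : Y => scalarVN G c) = c • 1 := by
  refine ContinuousLinearMap.ext fun v => PiLp.ext fun i => ?_
  rw [opVN, Matrix.diagonal_map (by rfl)]
  exact opMat_diagonal_apply (c • 1) v i

theorem diagonal_scalarVN_mul_inv {c : ℂ} (hc : c ≠ 0) :
    (Matrix.diagonal fun _ : X => scalarVN G c) * (Matrix.diagonal fun _ : X => scalarVN G c⁻¹) =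
      1 := by
  rw [Matrix.diagonal_mul_diagonal, ← Matrix.diagonal_one]
  congr 1
  funext i
  rw [← map_mul, mul_inv_cancel₀ hc, map_one]

theorem IsAnnihilatorProj.of_mul_right {A : Matrix X Y (groupVN G)} {D D' : Matrix Y Y (groupVN G)}
    (hD : D * D' = 1) {K : Matrix X X (groupVN G)} (h : IsAnnihilatorProj (A * D) K) :
    IsAnnihilatorProj A K where
  idem := h.idem
  conj := h.conj
  mul_eq_zero := by
    rw [← Matrix.mul_one A, ← hD, ← Matrix.mul_assoc A, ← Matrix.mul_assoc, h.mul_eq_zero,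
      Matrix.zero_mul]
  vecMul_eq_self y hy := h.vecMul_eq_self y (by
    rw [← Matrix.vecMul_vecMul, hy, Matrix.zero_vecMul])

open Filter Topology in
/-- The rank of a matrix over the group von Neumann algebra equals the rank of its adjoint: both are
limits of the same ergodic averages. -/
theorem exists_isAnnihilatorProj (A : Matrix X Y (groupVN G)) :
    ∃ K K', IsAnnihilatorProj A K ∧ IsAnnihilatorProj A.conjTranspose K' ∧
      Fintype.card X - matTrace K = Fintype.card Y - matTrace K' := by
  -- rescale `A` to a contraction
  set c : ℂ := ((‖opVN A‖ + 1 : ℝ) : ℂ)⁻¹ with hc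
  have hpos : 0 < ‖opVN A‖ + 1 := by positivity
  have hc0 : c ≠ 0 := inv_ne_zero (by exact_mod_cast hpos.ne')
  have hcs : star c = c := by rw [hc, ← Complex.ofReal_inv]; exact Complex.conj_ofReal _
  set B := A * Matrix.diagonal fun _ : Y => scalarVN G c with hB
  have hBn : ‖opVN B‖ ≤ 1 := by
    rw [hB, opVN_mul, opVN_diagonal_scalarVN]
    have h1 : opVN A ∘L (c • 1 : PiLp 2 (fun _ : Y => EllTwo G) →L[ℂ] _) = c • opVN A :=
      ContinuousLinearMap.ext fun v => map_smul (opVN A) c v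
    rw [h1, norm_smul, hc, norm_inv, Complex.norm_real, Real.norm_of_nonneg hpos.le,
      inv_mul_le_iff₀ hpos]
    linarith
  have hBt : B.conjTranspose = A.conjTranspose * Matrix.diagonal fun _ : X => scalarVN G c := by
    ext1 i j
    rw [hB, Matrix.conjTranspose_apply, Matrix.mul_diagonal, Matrix.mul_diagonal, star_mul,
      star_scalarVN, hcs, (scalarVN_commute c _).eq, Matrix.conjTranspose_apply]
  obtain ⟨K, hK, hKt⟩ := exists_isAnnihilatorProj_of_norm_le B hBn
  obtain ⟨K', hK', hKt'⟩ := exists_isAnnihilatorProj_of_norm_le B.conjTranspose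
    ((norm_opVN_conjTranspose B).trans_le hBn)
  refine ⟨K, K', hK.of_mul_right (diagonal_scalarVN_mul_inv hc0), ?_, ?_⟩
  · rw [hBt] at hK'
    exact hK'.of_mul_right (diagonal_scalarVN_mul_inv hc0)
  · rw [Matrix.conjTranspose_conjTranspose] at hKt'
    refine tendsto_nhds_unique (tendsto_const_nhds.sub hKt)
      ((tendsto_const_nhds.sub hKt').congr' ?_)
    filter_upwards [eventually_ne_atTop 0] with n hn
    have h : ∀ d e : ℂ, d - (n : ℂ)⁻¹ * e = (n : ℂ)⁻¹ * (n * d - e) := by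
      intro d e
      have : (n : ℂ) ≠ 0 := by exact_mod_cast hn
      field_simp
    have h' : ∀ (d : ℂ) (F : ℕ → ℂ), n * d - ∑ k ∈ Finset.range n, F k =
        ∑ k ∈ Finset.range n, (d - F k) := by
      intro d F
      rw [Finset.sum_sub_distrib, Finset.sum_const, Finset.card_range, nsmul_eq_mul]
    rw [h, h, h', h']
    congr 1
    exact Finset.sum_congr rfl fun k _ => (matTrace_pow_one_sub _ _ k).symm

end AnnihilatorProj

/-! ### Traces of annihilator projections -/

section ProjTrace

variable {G : Type} [Group G] {X Y Z : Type*} [Fintype X] [Fintype Y] [Fintype Z]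

theorem matTrace_eq_of_mul_eq {A B : Matrix X X (groupVN G)} (h : A * B = A) (h' : B * A = B) :
    matTrace A = matTrace B := by
  rw [← h, matTrace_mul_comm, h']

theorem re_matTrace_le_of_mul_eq {P Q : Matrix X X (groupVN G)} (hP : P * P = P)
    (hP' : P.conjTranspose = P) (hQ : Q * Q = Q) (hQ' : Q.conjTranspose = Q) (h : P * Q = P) :
    (matTrace P).re ≤ (matTrace Q).re := by
  have h' : Q * P = P := by
    have := congrArg Matrix.conjTranspose h
    rwa [Matrix.conjTranspose_mul, hP', hQ'] at this
  have h2 := matTrace_conjTranspose_mul_self_nonneg (Q - P)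
  rw [Matrix.conjTranspose_sub, hP', hQ', Matrix.sub_mul, Matrix.mul_sub, Matrix.mul_sub, hP, hQ,
    h, h', sub_self, sub_zero, matTrace_sub, Complex.sub_re] at h2
  linarith

theorem IsAnnihilatorProj.mul_eq_self {A : Matrix X Y (groupVN G)} {K : Matrix X X (groupVN G)}
    (h : IsAnnihilatorProj A K) {B : Matrix Z X (groupVN G)} (hB : B * A = 0) : B * K = B := by
  ext1 i j
  exact congrFun (h.vecMul_eq_self (B i) (funext fun j => congrFun (congrFun hB i) j)) j

theorem IsAnnihilatorProj.vecMul_eq_iff {A : Matrix X Y (groupVN G)} {K : Matrix X X (groupVN G)}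
    (h : IsAnnihilatorProj A K) (y : X → groupVN G) :
    Matrix.vecMul y K = y ↔ Matrix.vecMul y A = 0 := by
  refine ⟨fun hy => ?_, h.vecMul_eq_self y⟩
  rw [← hy, Matrix.vecMul_vecMul, h.mul_eq_zero, Matrix.vecMul_zero]

variable [DecidableEq X] [DecidableEq Y]

/-- The trace of the annihilator projection is determined by any idempotent with the same
left annihilator. -/
theorem IsAnnihilatorProj.matTrace_eq {A : Matrix X Y (groupVN G)} {K : Matrix X X (groupVN G)}
    (h : IsAnnihilatorProj A K) {E : Matrix X X (groupVN G)} (hE : E * E = E)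
    (hEA : ∀ y, Matrix.vecMul y A = 0 ↔ Matrix.vecMul y E = 0) :
    matTrace K = Fintype.card X - matTrace E := by
  have h1 : K * E = 0 := by
    ext1 i j
    exact congrFun ((hEA (K i)).1 (funext fun j => congrFun (congrFun h.mul_eq_zero i) j)) j
  have h2 : (1 - E) * A = 0 := by
    ext1 i j
    refine congrFun ((hEA ((1 - E) i)).2 (funext fun j => ?_)) j
    have h3 : (1 - E) * E = 0 := by rw [Matrix.sub_mul, hE, Matrix.one_mul, sub_self]
    exact congrFun (congrFun h3 i) j
  rw [← matTrace_one (G := G), ← matTrace_sub]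
  exact matTrace_eq_of_mul_eq (by rw [Matrix.mul_sub, Matrix.mul_one, h1, sub_zero])
    (h.mul_eq_self h2)

/-- The dimension does not increase under passage to a submodule: if the image of an idempotent
`A` embeds into the image of a projection `P`, then the trace of `A` is at most that of `P`. -/
theorem re_matTrace_le_of_injective {A : Matrix X X (groupVN G)} (hA : A * A = A)
    {P : Matrix Y Y (groupVN G)} (hP : P * P = P) (hP' : P.conjTranspose = P)
    (θ : LinearMap.range A.vecMulLinear →ₗ[groupVN G] (Y → groupVN G))
    (hθ : Function.Injective θ) (hθP : ∀ y, Matrix.vecMul (θ y) P = θ y) :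
    (matTrace A).re ≤ (matTrace P).re := by
  set f : (X → groupVN G) →ₗ[groupVN G] (Y → groupVN G) := θ ∘ₗ A.vecMulLinear.rangeRestrict
  have hf : ∀ y, f y = 0 ↔ Matrix.vecMul y A = 0 := by
    intro y
    change θ _ = 0 ↔ _
    rw [map_eq_zero_iff θ hθ, Subtype.ext_iff]
    rfl
  -- the matrix of the composition of `θ` with the projection of the row space onto the image of `A`
  set T : Matrix X Y (groupVN G) := Matrix.of fun i => f (Pi.single i 1)
  have hT : ∀ y, Matrix.vecMul y T = f y := by
    intro y
    have hy : y = ∑ i, y i • (Pi.single i 1 : X → groupVN G) := by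
      funext j
      simp [Finset.sum_apply, Pi.single_apply]
    conv_rhs => rw [hy, map_sum]
    funext j
    rw [Finset.sum_apply]
    refine Finset.sum_congr rfl fun i _ => ?_
    rw [map_smul]
    rfl
  obtain ⟨K, K', hK, hK', htr⟩ := exists_isAnnihilatorProj T
  have h1 := hK.matTrace_eq hA fun y => by rw [hT, hf]
  have hTP : T * P = T := by
    ext1 i j
    exact congrFun (hθP _) j
  have h2 : (1 - P) * T.conjTranspose = 0 := by
    have := congrArg Matrix.conjTranspose hTP
    rw [Matrix.conjTranspose_mul, hP'] at this
    rw [Matrix.sub_mul, this, Matrix.one_mul, sub_self]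
  have h3 := re_matTrace_le_of_mul_eq (P := 1 - P)
    (by simp [Matrix.sub_mul, Matrix.mul_sub, hP])
    (by rw [Matrix.conjTranspose_sub, hP', Matrix.conjTranspose_one]) hK'.idem hK'.conj
    (hK'.mul_eq_self h2)
  rw [h1, sub_sub_cancel] at htr
  rw [htr, Complex.sub_re]
  rw [matTrace_sub, matTrace_one, Complex.sub_re] at h3
  linarith

end ProjTrace

section Step

variable {G : Type} [Group G] {X Y : Type*} [Fintype X] [Fintype Y] [DecidableEq X] [DecidableEq Y]

theorem matTrace_blockDiagonal (q : Matrix Y Y (groupVN G)) :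
    matTrace (Matrix.blockDiagonal fun _ : X => q) = Fintype.card X * matTrace q := by
  rw [matTrace, Fintype.sum_prod_type_right]
  simp [Matrix.blockDiagonal_apply, matTrace]

/-- The kernel of `(y_j)_j ↦ ∑_j y_j (u_j - 1)` on `M^X`, where `M` is the image of a projection
`q` commuting with the elements `u_j`, is the image of a projection of trace `(|X| - 1) τ(q)` if
right multiplication by the adjoints of the elements `u_j - 1` is injective. -/
theorem exists_proj_kernel [Nonempty X] {q : Matrix Y Y (groupVN G)} (hq : q * q = q)
    (hq' : q.conjTranspose = q) (u : X → groupVN G) (hu : ∀ j k l, Commute (u j) (q k l))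
    (hinj : ∀ j T, T * star (u j - 1) = 0 → T = 0) :
    ∃ P : Matrix (Y × X) (Y × X) (groupVN G), P * P = P ∧ P.conjTranspose = P ∧
      (∀ y : Y × X → groupVN G, Matrix.vecMul y P = y ↔
        (∀ j, Matrix.vecMul (fun k => y (k, j)) q = fun k => y (k, j)) ∧
          ∀ k, ∑ j, y (k, j) * (u j - 1) = 0) ∧
      matTrace P = (Fintype.card X - 1) * matTrace q ∧
      ∀ v, (∀ j, Commute v (u j)) → (∀ j, Commute (star v) (u j)) →
        (∀ k l, Commute v (q k l)) → (∀ k l, Commute (star v) (q k l)) →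
          ∀ a b, Commute v (P a b) := by
  have hu' : ∀ j k l, Commute (u j - 1) (q k l) := fun j k l => (hu j k l).sub_left (.one_left _)
  -- `T` is the matrix of `(y_j)_j ↦ ∑_j y_j q (u_j - 1)`, and `Q` projects onto `M^X`. The image of
  -- `1 - Q` is contained in the kernel of `T`. Hence the projection `K` onto this kernel commutes
  -- with `Q`, and `K * Q` is the required projection. Its trace is computed from the adjoint of
  -- `T`, whose left annihilator is that of `q`.
  set T : Matrix (Y × X) Y (groupVN G) := Matrix.of fun a l => (u a.2 - 1) * q a.1 l with hT
  set Q : Matrix (Y × X) (Y × X) (groupVN G) := Matrix.blockDiagonal fun _ => q with hQ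
  have hQy : ∀ (y : Y × X → groupVN G) k j, Matrix.vecMul y Q (k, j) =
      Matrix.vecMul (fun k => y (k, j)) q k := by
    intro y k j
    simp only [Matrix.vecMul, dotProduct]
    rw [Fintype.sum_prod_type_right, Finset.sum_eq_single j]
    · simp [hQ]
    · intro j' _ hj'
      refine Finset.sum_eq_zero fun k' _ => ?_
      rw [hQ, Matrix.blockDiagonal_apply_ne _ _ _ hj', mul_zero]
    · simp
  have hQQ : Q * Q = Q := by
    rw [hQ, ← Matrix.blockDiagonal_mul]
    simp [hq]
  have hQ' : Q.conjTranspose = Q := by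
    rw [hQ, Matrix.blockDiagonal_conjTranspose]
    simp [hq']
  have hTy : ∀ (y : Y × X → groupVN G) l, Matrix.vecMul y T l =
      ∑ j, Matrix.vecMul (fun k => y (k, j)) q l * (u j - 1) := by
    intro y l
    simp only [Matrix.vecMul, dotProduct]
    rw [Fintype.sum_prod_type_right]
    refine Finset.sum_congr rfl fun j _ => ?_
    rw [Finset.sum_mul]
    refine Finset.sum_congr rfl fun k _ => ?_
    rw [mul_assoc, ← (hu' j k l).eq]
    rfl
  have hQT : Q * T = T := by
    ext1 a l
    obtain ⟨k, j⟩ := a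
    rw [Matrix.mul_apply, Fintype.sum_prod_type_right, Finset.sum_eq_single j]
    · have h1 : ∀ k', Q (k, j) (k', j) * T (k', j) l = (u j - 1) * (q k k' * q k' l) := by
        intro k'
        rw [hQ, Matrix.blockDiagonal_apply_eq, ← mul_assoc, (hu' j k k').eq, mul_assoc]
        rfl
      simp only [h1, ← Finset.mul_sum]
      rw [← Matrix.mul_apply, hq]
      rfl
    · intro j' _ hj'
      refine Finset.sum_eq_zero fun k' _ => ?_
      rw [hQ, Matrix.blockDiagonal_apply_ne _ _ _ (Ne.symm hj'), zero_mul]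
    · simp
  obtain ⟨K, K', hK, hK', htr⟩ := exists_isAnnihilatorProj T
  have hK't : matTrace K' = Fintype.card Y - matTrace q := by
    refine hK'.matTrace_eq hq fun y => ?_
    have hyT : ∀ k j, Matrix.vecMul y T.conjTranspose (k, j) =
        Matrix.vecMul y q k * star (u j - 1) := by
      intro k j
      simp only [Matrix.vecMul, dotProduct]
      rw [Finset.sum_mul]
      refine Finset.sum_congr rfl fun l _ => ?_
      rw [Matrix.conjTranspose_apply, hT, Matrix.of_apply, star_mul, mul_assoc,
        ← Matrix.conjTranspose_apply, hq']
    constructor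
    · intro h
      funext k
      obtain ⟨j⟩ := ‹Nonempty X›
      exact hinj j _ ((hyT k j).symm.trans (congrFun h (k, j)))
    · intro h
      funext ⟨k, j⟩
      rw [hyT, h, Pi.zero_apply, zero_mul, Pi.zero_apply]
  have hQK : K - Q * K = 1 - Q := by
    have := hK.mul_eq_self (B := 1 - Q) (by rw [Matrix.sub_mul, hQT, Matrix.one_mul, sub_self])
    rwa [Matrix.sub_mul, Matrix.one_mul] at this
  have hQK' : Q * K = K - (1 - Q) := by rw [← hQK, sub_sub_cancel]
  have hKQ : K * Q = Q * K := by
    have := congrArg Matrix.conjTranspose hQK'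
    rwa [Matrix.conjTranspose_mul, hK.conj, hQ', Matrix.conjTranspose_sub, Matrix.conjTranspose_sub,
      hK.conj, hQ', Matrix.conjTranspose_one, ← hQK'] at this
  refine ⟨K * Q, ?_, ?_, ?_, ?_, ?_⟩
  · rw [Matrix.mul_assoc, ← Matrix.mul_assoc Q, ← hKQ, Matrix.mul_assoc K, hQQ, ← Matrix.mul_assoc,
      hK.idem]
  · rw [Matrix.conjTranspose_mul, hK.conj, hQ', hKQ]
  · intro y
    have h1 : Matrix.vecMul y (K * Q) = y ↔ Matrix.vecMul y Q = y ∧ Matrix.vecMul y T = 0 := by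
      rw [← hK.vecMul_eq_iff]
      constructor
      · intro h
        constructor
        · rw [← h, Matrix.vecMul_vecMul, Matrix.mul_assoc, hQQ]
        · rw [← h, Matrix.vecMul_vecMul, hKQ, Matrix.mul_assoc, hK.idem]
      · rintro ⟨h, h'⟩
        rw [← Matrix.vecMul_vecMul, h', h]
    have h2 : Matrix.vecMul y Q = y ↔
        ∀ j, Matrix.vecMul (fun k => y (k, j)) q = fun k => y (k, j) := by
      constructor
      · intro h j
        funext k
        rw [← hQy, h]
      · intro h
        funext ⟨k, j⟩
        rw [hQy, h]
    rw [h1, h2]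
    refine and_congr_right fun h => ?_
    rw [funext_iff]
    refine forall_congr' fun l => ?_
    rw [hTy]
    simp only [h]
    rfl
  · rw [hKQ, hQK', matTrace_sub, matTrace_sub, matTrace_one, hQ, matTrace_blockDiagonal]
    rw [hK't, sub_sub_cancel] at htr
    have := Fintype.card_prod Y X
    linear_combination -htr
  · intro v hv hv' hvq hvq' a b
    have hcomm : ∀ v : groupVN G, (∀ j, Commute v (u j)) → (∀ k l, Commute v (q k l)) →
        K * (Matrix.diagonal fun _ => v) * K = K * Matrix.diagonal fun _ => v := by
      intro v hv hvq
      refine hK.mul_eq_self ?_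
      have h : (Matrix.diagonal fun _ : Y × X => v) * T = T * Matrix.diagonal fun _ : Y => v := by
        ext1 a l
        rw [Matrix.diagonal_mul, Matrix.mul_diagonal]
        exact (((hv a.2).sub_right (.one_right v)).mul_right (hvq a.1 l)).eq
      rw [Matrix.mul_assoc, h, ← Matrix.mul_assoc, hK.mul_eq_zero, Matrix.zero_mul]
    have h1 := hcomm v hv hvq
    have h2 := congrArg Matrix.conjTranspose (hcomm (star v) hv' hvq')
    rw [Matrix.conjTranspose_mul, Matrix.conjTranspose_mul, hK.conj,
      Matrix.diagonal_conjTranspose, ← Matrix.mul_assoc] at h2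
    have h3 : (star fun _ : Y × X => star v) = fun _ => v := funext fun _ => star_star v
    rw [h3, h1] at h2
    have hKv : ∀ a b, Commute v (K a b) := by
      intro a b
      have := congrFun (congrFun h2 a) b
      rw [Matrix.diagonal_mul, Matrix.mul_diagonal] at this
      exact this.symm
    rw [Matrix.mul_apply]
    refine Commute.sum_right _ _ _ fun c _ => (hKv a c).mul_right ?_
    rw [hQ, Matrix.blockDiagonal_apply]
    split_ifs
    · exact hvq _ _
    · exact Commute.zero_right v

end Step

/-! ### Computing the dimension function -/

section LuckDim

theorem luckDim_le_of_injective {N : Type} [Ring N] (τ : N → ℂ) {M M' : Type} [AddCommGroup M]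
    [Module N M] [AddCommGroup M'] [Module N M'] (f : M →ₗ[N] M') (hf : Function.Injective f) :
    luckDim τ M ≤ luckDim τ M' := by
  refine iSup_mono fun n => iSup_mono fun A => iSup_mono fun hA => iSup_le fun P => ?_
  refine iSup_le fun ⟨e⟩ => ?_
  exact le_iSup₂_of_le (P.map f) ⟨e.trans (Submodule.equivMapOfInjective f hf P)⟩ le_rfl

theorem luckDim_congr {N : Type} [Ring N] (τ : N → ℂ) {M M' : Type} [AddCommGroup M]
    [Module N M] [AddCommGroup M'] [Module N M'] (f : M ≃ₗ[N] M') :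
    luckDim τ M = luckDim τ M' :=
  le_antisymm (luckDim_le_of_injective τ f.toLinearMap f.injective)
    (luckDim_le_of_injective τ f.symm.toLinearMap f.symm.injective)

theorem luckDim_eq_zero_of_subsingleton {N : Type} [Ring N] (τ : N → ℂ) (hτ : τ 0 = 0) (M : Type)
    [AddCommGroup M] [Module N M] [Subsingleton M] : luckDim τ M = 0 := by
  refine le_antisymm ?_ bot_le
  refine iSup_le fun n => iSup_le fun A => iSup_le fun hA => iSup₂_le fun P ⟨e⟩ => ?_
  have hA0 : ∀ i, A i i = 0 := by
    intro i
    have h : (⟨A.vecMulLinear (Pi.single i 1), ⟨_, rfl⟩⟩ : LinearMap.range A.vecMulLinear) = 0 :=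
      e.injective (Subsingleton.elim _ _)
    have h' := congrFun (congrArg Subtype.val h) i
    simpa using h'
  simp [hA0, hτ]

variable {G : Type} [Group G]

/-- The dimension of a module is bounded below by the trace of an idempotent whose image embeds. -/
theorem ofReal_matTrace_le_luckDim {Y : Type} [Fintype Y] {A : Matrix Y Y (groupVN G)}
    (hA : A * A = A) {M : Type} [AddCommGroup M] [Module (groupVN G) M]
    (f : LinearMap.range A.vecMulLinear →ₗ[groupVN G] M) (hf : Function.Injective f) :
    ENNReal.ofReal (matTrace A).re ≤ luckDim (vnTrace G) M := by
  set e := Fintype.equivFin Y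
  set B := A.submatrix e.symm e.symm
  have hB : IsIdempotentElem B := by
    change A.submatrix e.symm e.symm * A.submatrix e.symm e.symm = A.submatrix e.symm e.symm
    rw [Matrix.submatrix_mul_equiv, hA]
  have hAB : ∀ y, Matrix.vecMul y B ∘ e = Matrix.vecMul (y ∘ e) A := by
    intro y
    funext j
    simp only [Matrix.vecMul, dotProduct, Function.comp_apply]
    rw [← e.sum_comp]
    simp [B]
  set ψ : LinearMap.range B.vecMulLinear →ₗ[groupVN G] LinearMap.range A.vecMulLinear :=
    (LinearMap.funLeft (groupVN G) (groupVN G) e).restrict (by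
      rintro _ ⟨y, rfl⟩
      exact ⟨y ∘ e, (hAB y).symm⟩)
  have hψ : Function.Injective ψ := by
    intro y y' h
    refine Subtype.ext (funext fun i => ?_)
    have := congrFun (congrArg Subtype.val h) (e.symm i)
    change (y : Fin _ → groupVN G) (e (e.symm i)) = (y' : Fin _ → groupVN G) (e (e.symm i)) at this
    rwa [e.apply_symm_apply] at this
  have htr : matTrace A = ∑ i, vnTrace G (B i i) :=
    (e.symm.sum_comp fun y => vnTrace G (A y y)).symm
  rw [htr]
  exact le_iSup₂_of_le _ B (le_iSup₂_of_le hB (LinearMap.range (f ∘ₗ ψ))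
    (le_iSup_of_le ⟨LinearEquiv.ofInjective (f ∘ₗ ψ) (hf.comp hψ)⟩ le_rfl))

variable {I : Type} {Y : I → Type} [∀ i, Fintype (Y i)] [∀ i, DecidableEq (Y i)]

/-- The direct sum of the images of the matrices `P i`, acting from the right on row vectors whose
entries fixed by `P i` form the `i`-th summand. -/
def fixedRows (P : ∀ i, Matrix (Y i) (Y i) (groupVN G)) :
    Submodule (groupVN G) ((Σ i, Y i) →₀ groupVN G) where
  carrier := {y | ∀ i, Matrix.vecMul (fun k => y ⟨i, k⟩) (P i) = fun k => y ⟨i, k⟩}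
  zero_mem' i := Matrix.zero_vecMul (P i)
  add_mem' {y y'} h h' i := by
    refine (Matrix.add_vecMul (P i) (fun k => y ⟨i, k⟩) fun k => y' ⟨i, k⟩).trans ?_
    rw [h i, h' i]; rfl
  smul_mem' c y h i := by
    refine ((P i).vecMulLinear.map_smul c fun k => y ⟨i, k⟩).trans ?_
    rw [Matrix.vecMulLinear_apply, h i]; rfl

theorem vecMul_blockDiagonal' {s : Finset I} [DecidableEq I]
    (P : ∀ i, Matrix (Y i) (Y i) (groupVN G)) (y : (Σ i : s, Y i) → groupVN G) (i : s) (k : Y i) :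
    Matrix.vecMul y (Matrix.blockDiagonal' fun i : s => P i) ⟨i, k⟩ =
      Matrix.vecMul (fun k => y ⟨i, k⟩) (P i) k := by
  simp only [Matrix.vecMul, dotProduct]
  rw [Fintype.sum_sigma, Finset.sum_eq_single i]
  · simp
  · intro j _ hj
    refine Finset.sum_eq_zero fun l _ => ?_
    rw [Matrix.blockDiagonal'_apply_ne _ _ _ hj, mul_zero]
  · simp

theorem matTrace_blockDiagonal' {s : Finset I} [DecidableEq I]
    (P : ∀ i, Matrix (Y i) (Y i) (groupVN G)) :
    matTrace (Matrix.blockDiagonal' fun i : s => P i) = ∑ i ∈ s, matTrace (P i) := by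
  rw [matTrace, Fintype.sum_sigma, ← Finset.sum_coe_sort s fun i => matTrace (P i)]
  simp [matTrace]

theorem re_matTrace_nonneg {Y : Type*} [Fintype Y] {P : Matrix Y Y (groupVN G)} (hP : P * P = P)
    (hP' : P.conjTranspose = P) : 0 ≤ (matTrace P).re := by
  have := matTrace_conjTranspose_mul_self_nonneg P
  rwa [hP', hP] at this

theorem ofReal_matTrace_blockDiagonal' [DecidableEq I]
    (P : ∀ i, Matrix (Y i) (Y i) (groupVN G)) (hP : ∀ i, P i * P i = P i)
    (hP' : ∀ i, (P i).conjTranspose = P i) (s : Finset I) :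
    ENNReal.ofReal (matTrace (Matrix.blockDiagonal' fun i : s => P i)).re =
      ∑ i ∈ s, ENNReal.ofReal (matTrace (P i)).re := by
  rw [matTrace_blockDiagonal', Complex.re_sum,
    ENNReal.ofReal_sum_of_nonneg fun i _ => re_matTrace_nonneg (hP i) (hP' i)]

theorem blockDiagonal'_mul_self [DecidableEq I] {P : ∀ i, Matrix (Y i) (Y i) (groupVN G)}
    (hP : ∀ i, P i * P i = P i) (s : Finset I) : (Matrix.blockDiagonal' fun i : s => P i) *
      (Matrix.blockDiagonal' fun i : s => P i) = Matrix.blockDiagonal' fun i : s => P i := by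
  rw [← Matrix.blockDiagonal'_mul]
  simp [hP]

theorem blockDiagonal'_conjTranspose_eq [DecidableEq I]
    {P : ∀ i, Matrix (Y i) (Y i) (groupVN G)} (hP' : ∀ i, (P i).conjTranspose = P i)
    (s : Finset I) : (Matrix.blockDiagonal' fun i : s => P i).conjTranspose =
      Matrix.blockDiagonal' fun i : s => P i := by
  rw [Matrix.blockDiagonal'_conjTranspose]
  simp [hP']

/-- A finitely generated submodule of a direct sum is contained in a finite partial sum. -/
theorem exists_finset_of_range_vecMulLinear {X : Type} [Fintype X] [DecidableEq X]
    (A : Matrix X X (groupVN G))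
    (φ : LinearMap.range A.vecMulLinear →ₗ[groupVN G] ((Σ i, Y i) →₀ groupVN G)) :
    ∃ s : Finset I, ∀ y i, i ∉ s → ∀ k, φ y ⟨i, k⟩ = 0 := by
  classical
  refine ⟨Finset.univ.biUnion fun j : X =>
    (φ (A.vecMulLinear.rangeRestrict (Pi.single j 1))).support.image Sigma.fst, ?_⟩
  rintro ⟨_, y, rfl⟩ i hi k
  have hy : y = ∑ j, y j • (Pi.single j 1 : X → groupVN G) := by
    funext j
    simp [Finset.sum_apply, Pi.single_apply]
  have h1 : φ (A.vecMulLinear.rangeRestrict y) =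
      ∑ j, y j • φ (A.vecMulLinear.rangeRestrict (Pi.single j 1)) := by
    conv_lhs => rw [hy, map_sum, map_sum]
    simp only [map_smul]
  refine (congrArg (fun z : (Σ i, Y i) →₀ groupVN G => z ⟨i, k⟩) h1).trans ?_
  simp only [Finsupp.coe_finsetSum, Finset.sum_apply, Finsupp.smul_apply]
  refine Finset.sum_eq_zero fun j _ => ?_
  have : φ (A.vecMulLinear.rangeRestrict (Pi.single j 1)) ⟨i, k⟩ = 0 := by
    by_contra h
    exact hi (Finset.mem_biUnion.2 ⟨j, Finset.mem_univ _,
      Finset.mem_image.2 ⟨⟨i, k⟩, Finsupp.mem_support_iff.2 h, rfl⟩⟩)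
  rw [this, smul_zero]

/-- The trace of an idempotent whose image embeds into a direct sum of images of projections is at
most the sum of the traces of finitely many of these projections. -/
theorem ofReal_matTrace_le_tsum (P : ∀ i, Matrix (Y i) (Y i) (groupVN G))
    (hP : ∀ i, P i * P i = P i) (hP' : ∀ i, (P i).conjTranspose = P i) {X : Type} [Fintype X]
    [DecidableEq X] {A : Matrix X X (groupVN G)} (hA : A * A = A)
    (φ : LinearMap.range A.vecMulLinear →ₗ[groupVN G] ((Σ i, Y i) →₀ groupVN G))
    (hφ : Function.Injective φ) (hφP : ∀ y, φ y ∈ fixedRows P) :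
    ENNReal.ofReal (matTrace A).re ≤ ∑' i, ENNReal.ofReal (matTrace (P i)).re := by
  classical
  obtain ⟨s, hs⟩ := exists_finset_of_range_vecMulLinear A φ
  let θ : LinearMap.range A.vecMulLinear →ₗ[groupVN G] ((Σ i : s, Y i) → groupVN G) :=
    LinearMap.pi fun a => Finsupp.lapply ⟨(a.1 : I), a.2⟩ ∘ₗ φ
  have hθ : Function.Injective θ := by
    intro y y' h
    refine hφ (Finsupp.ext fun ⟨i, k⟩ => ?_)
    by_cases hi : i ∈ s
    · exact congrFun h ⟨⟨i, hi⟩, k⟩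
    · rw [hs _ _ hi, hs _ _ hi]
  have hle := re_matTrace_le_of_injective hA (blockDiagonal'_mul_self hP s)
    (blockDiagonal'_conjTranspose_eq hP' s) θ hθ (by
      intro y
      funext ⟨i, k⟩
      rw [vecMul_blockDiagonal']
      exact congrFun (hφP y i) k)
  refine (ENNReal.ofReal_le_ofReal hle).trans ?_
  rw [ofReal_matTrace_blockDiagonal' P hP hP']
  exact ENNReal.sum_le_tsum s

theorem luckDim_fixedRows_le (P : ∀ i, Matrix (Y i) (Y i) (groupVN G)) (hP : ∀ i, P i * P i = P i)
    (hP' : ∀ i, (P i).conjTranspose = P i) :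
    luckDim (vnTrace G) (fixedRows P) ≤ ∑' i, ENNReal.ofReal (matTrace (P i)).re := by
  refine iSup_le fun n => iSup_le fun A => iSup_le fun hA => iSup₂_le fun W ⟨e⟩ => ?_
  exact ofReal_matTrace_le_tsum P hP hP' hA
    ((fixedRows P).subtype ∘ₗ W.subtype ∘ₗ e.toLinearMap)
    (Subtype.val_injective.comp (Subtype.val_injective.comp e.injective))
    fun y => (W.subtype (e y)).2

theorem le_luckDim_fixedRows (P : ∀ i, Matrix (Y i) (Y i) (groupVN G)) (hP : ∀ i, P i * P i = P i)
    (hP' : ∀ i, (P i).conjTranspose = P i) :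
    ∑' i, ENNReal.ofReal (matTrace (P i)).re ≤ luckDim (vnTrace G) (fixedRows P) := by
  classical
  rw [ENNReal.tsum_eq_iSup_sum]
  refine iSup_le fun s => ?_
  rw [← ofReal_matTrace_blockDiagonal' P hP hP']
  set c : (Σ i : s, Y i) → Σ i, Y i := fun a => ⟨a.1, a.2⟩
  have hc : Function.Injective c := by
    rintro ⟨⟨i, hi⟩, k⟩ ⟨⟨i', hi'⟩, k'⟩ h
    obtain rfl : i = i' := congrArg Sigma.fst h
    obtain rfl : k = k' := eq_of_heq (Sigma.mk.inj h).2
    rfl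
  set f : ((Σ i : s, Y i) → groupVN G) →ₗ[groupVN G] ((Σ i, Y i) →₀ groupVN G) :=
    Finsupp.lmapDomain (groupVN G) (groupVN G) c ∘ₗ
      (Finsupp.linearEquivFunOnFinite (groupVN G) (groupVN G) _).symm.toLinearMap
  have hfi : Function.Injective f :=
    (Finsupp.mapDomain_injective hc).comp (LinearEquiv.injective _)
  have hf : ∀ y (i : s) k, f y ⟨i, k⟩ = y ⟨i, k⟩ := fun y i k =>
    Finsupp.mapDomain_apply hc _ (⟨i, k⟩ : Σ i : s, Y i)
  have hf' : ∀ y i, i ∉ s → ∀ k, f y ⟨i, k⟩ = 0 := fun y i hi k =>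
    Finsupp.mapDomain_of_notMem_range _ _ fun ⟨⟨i', k'⟩, h⟩ => hi (by
      obtain rfl : (i' : I) = i := congrArg Sigma.fst h
      exact i'.2)
  refine ofReal_matTrace_le_luckDim (blockDiagonal'_mul_self hP s)
    (LinearMap.codRestrict (fixedRows P)
    (f ∘ₗ (LinearMap.range _).subtype) ?_) ?_
  · rintro ⟨_, y, rfl⟩ i
    by_cases hi : i ∈ s
    · have h1 : ∀ k, f (Matrix.vecMul y (Matrix.blockDiagonal' fun i : s => P i)) ⟨i, k⟩ =
          Matrix.vecMul (fun k => y ⟨⟨i, hi⟩, k⟩) (P i) k := fun k =>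
        (hf _ ⟨i, hi⟩ k).trans (vecMul_blockDiagonal' P y ⟨i, hi⟩ k)
      change Matrix.vecMul (fun k => f (Matrix.vecMul y _) ⟨i, k⟩) (P i) = fun k =>
        f (Matrix.vecMul y _) ⟨i, k⟩
      simp only [h1]
      rw [Matrix.vecMul_vecMul, hP]
    · change Matrix.vecMul (fun k => f (Matrix.vecMul y _) ⟨i, k⟩) (P i) = fun k =>
        f (Matrix.vecMul y _) ⟨i, k⟩
      simp only [hf' _ i hi]
      exact Matrix.zero_vecMul (P i)
  · exact fun y y' h => Subtype.ext (hfi (congrArg Subtype.val h))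

/-- The dimension of a direct sum of images of projections is the sum of their traces. -/
theorem luckDim_fixedRows (P : ∀ i, Matrix (Y i) (Y i) (groupVN G)) (hP : ∀ i, P i * P i = P i)
    (hP' : ∀ i, (P i).conjTranspose = P i) :
    luckDim (vnTrace G) (fixedRows P) = ∑' i, ENNReal.ofReal (matTrace (P i)).re :=
  le_antisymm (luckDim_fixedRows_le P hP hP') (le_luckDim_fixedRows P hP hP')

end LuckDim

/-! ### Projections cut out by group elements of infinite order -/

section ProjConcrete

variable {G : Type} [Group G]

theorem eq_zero_of_mul_star_groupToVN_sub_one {a : G} (ha : ¬IsOfFinOrder a) (T : groupVN G)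
    (hT : T * star (groupToVN G a - 1) = 0) : T = 0 := by
  rw [star_sub, star_one, star_groupToVN] at hT
  exact eq_zero_of_mul_groupToVN_sub_one (by rwa [isOfFinOrder_inv_iff]) hT

theorem commute_star_groupToVN {a : G} {T : groupVN G} (h : Commute (groupToVN G a) T) :
    Commute (star (groupToVN G a)) T := by
  rw [star_groupToVN]
  have h1 : groupToVN G a⁻¹ * groupToVN G a = 1 := by rw [← map_mul, inv_mul_cancel, map_one]
  have h2 : groupToVN G a * groupToVN G a⁻¹ = 1 := by rw [← map_mul, mul_inv_cancel, map_one]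
  have h3 := congrArg (fun S => groupToVN G a⁻¹ * S * groupToVN G a⁻¹) h.eq
  simp only [mul_assoc, h2, mul_one] at h3
  rw [← mul_assoc, h1, one_mul] at h3
  exact h3.symm

variable {J : Type} [Fintype J] [DecidableEq J] [Nonempty J]

/-- For a projection `e`, the rows `y` with entries in `N e` killed by right multiplication by
`u_j - 1`, `j ∈ J`, are the image of a projection of trace `(|J| - 1) τ(e)`. -/
theorem exists_proj_rows {e : groupVN G} (he : e * e = e) (he' : star e = e) (b : J → G)
    (hb : ∀ j, ¬IsOfFinOrder (b j)) (hbe : ∀ j, Commute (groupToVN G (b j)) e) :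
    ∃ P : Matrix (Unit × J) (Unit × J) (groupVN G), P * P = P ∧ P.conjTranspose = P ∧
      (∀ y : Unit × J → groupVN G, Matrix.vecMul y P = y ↔
        (∀ j, y ((), j) * e = y ((), j)) ∧ ∑ j, y ((), j) * (groupToVN G (b j) - 1) = 0) ∧
      matTrace P = (Fintype.card J - 1) * vnTrace G e ∧
      ∀ g, (∀ j, Commute g (b j)) → Commute (groupToVN G g) e →
        ∀ k l, Commute (groupToVN G g) (P k l) := by
  obtain ⟨P, h1, h2, h3, h4, h5⟩ := exists_proj_kernel (X := J) (Y := Unit)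
    (q := Matrix.of fun _ _ => e) (by ext1; simpa [Matrix.mul_apply] using he)
    (by ext1; simpa [Matrix.conjTranspose_apply] using he') (fun j => groupToVN G (b j))
    (fun j _ _ => hbe j) fun j => eq_zero_of_mul_star_groupToVN_sub_one (hb j)
  refine ⟨P, h1, h2, fun y => (h3 y).trans ?_, ?_, fun g hg hge => h5 _ ?_ ?_ ?_ ?_⟩
  · simp only [funext_iff, Matrix.vecMul, dotProduct, Matrix.of_apply, Finset.univ_unique,
      Finset.sum_singleton]
    exact ⟨fun h => ⟨fun j => h.1 j (), h.2 ()⟩, fun h => ⟨fun j _ => h.1 j, fun _ => h.2⟩⟩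
  · simpa [matTrace] using h4
  · exact fun j => (hg j).map (groupToVN G)
  · exact fun j => commute_star_groupToVN ((hg j).map (groupToVN G))
  · exact fun _ _ => hge
  · exact fun _ _ => commute_star_groupToVN hge

/-- For a projection `e`, the square arrays `y` with entries in `N e` whose columns are killed by
right multiplication by the `a_j - 1`, and whose rows by the `b_k - 1`, are the image of a
projection of trace `(|J| - 1)² τ(e)`. The two conditions are imposed one after the other; this is
possible since the `a_j` commute with the projection obtained from the `b_k`. -/
theorem exists_proj_grid {e : groupVN G} (he : e * e = e) (he' : star e = e) (a b : J → G)
    (ha : ∀ j, ¬IsOfFinOrder (a j)) (hb : ∀ j, ¬IsOfFinOrder (b j))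
    (hab : ∀ j k, Commute (a j) (b k))
    (hae : ∀ j, Commute (groupToVN G (a j)) e) (hbe : ∀ j, Commute (groupToVN G (b j)) e) :
    ∃ P : Matrix (J × J) (J × J) (groupVN G), P * P = P ∧ P.conjTranspose = P ∧
      (∀ y : J × J → groupVN G, Matrix.vecMul y P = y ↔
        (∀ t, y t * e = y t) ∧ (∀ k, ∑ j, y (j, k) * (groupToVN G (a j) - 1) = 0) ∧
          ∀ j, ∑ k, y (j, k) * (groupToVN G (b k) - 1) = 0) ∧
      matTrace P = (Fintype.card J - 1) ^ 2 * vnTrace G e := by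
  obtain ⟨Q, hQ, hQ', hQy, hQt, hQc⟩ := exists_proj_rows he he' b hb hbe
  obtain ⟨P, hP, hP', hPy, hPt, -⟩ := exists_proj_kernel hQ hQ' (fun j => groupToVN G (a j))
    (fun j => hQc _ (hab j) (hae j)) fun j => eq_zero_of_mul_star_groupToVN_sub_one (ha j)
  let f : J × J ≃ (Unit × J) × J :=
    (Equiv.prodComm J J).trans ((Equiv.punitProd J).symm.prodCongr (Equiv.refl J))
  refine ⟨P.submatrix f f, ?_, ?_, fun y => ?_, ?_⟩
  · rw [Matrix.submatrix_mul_equiv, hP]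
  · rw [Matrix.conjTranspose_submatrix, hP']
  · have h1 : Matrix.vecMul y (P.submatrix f f) = Matrix.vecMul (y ∘ f.symm) P ∘ f := by
      funext t
      simp only [Matrix.vecMul, dotProduct, Function.comp_apply]
      rw [← f.sum_comp]
      simp
    have h2 : Matrix.vecMul y (P.submatrix f f) = y ↔
        Matrix.vecMul (y ∘ f.symm) P = y ∘ f.symm := by
      rw [h1]
      constructor
      · intro h
        conv_rhs => rw [← h]
        funext t
        simp
      · intro h
        rw [h]
        funext t
        simp
    rw [h2, hPy]
    simp only [hQy]
    constructor
    · rintro ⟨h, h'⟩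
      exact ⟨fun t => (h t.1).1 t.2, fun k => h' ((), k), fun j => (h j).2⟩
    · rintro ⟨h, h', h''⟩
      exact ⟨fun j => ⟨fun k => h (j, k), h'' j⟩, fun k => h' k.2⟩
  · rw [pow_two, mul_assoc, ← hQt, ← hPt]
    exact f.sum_comp fun t => vnTrace G (P t t)

end ProjConcrete

/-! ### Projective resolutions from elementwise exactness -/

section Resolution

variable {S : Type} [Ring S]

theorem exactAt_succ_of_forall (X : ℕ → ModuleCat.{0} S) (d : ∀ n, X (n + 1) ⟶ X n)
    (hd : ∀ n, d (n + 1) ≫ d n = 0) (n : ℕ)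
    (ex : ∀ y, (d n).hom y = 0 → ∃ z, (d (n + 1)).hom z = y) :
    (ChainComplex.of X d hd).ExactAt (n + 1) := by
  rw [HomologicalComplex.exactAt_iff' _ (n + 1 + 1) (n + 1) n (by simp) (by simp)]
  rw [ShortComplex.moduleCat_exact_iff]
  intro y hy
  have h1 : (ChainComplex.of X d hd).d (n + 1) n = d n := ChainComplex.of_d _ _ _
  have h2 : (ChainComplex.of X d hd).d (n + 1 + 1) (n + 1) = d (n + 1) := ChainComplex.of_d _ _ _
  obtain ⟨z, hz⟩ := ex y ((congrArg (fun f => f.hom y) h1).symm.trans hy)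
  exact ⟨z, (congrArg (fun f => f.hom z) h2).trans hz⟩

/-- A chain complex of projective modules that is exact in positive degrees, with an augmentation
exact in degree zero, as a projective resolution. -/
noncomputable def resolutionOf (X : ℕ → ModuleCat.{0} S) (d : ∀ n, X (n + 1) ⟶ X n)
    (hd : ∀ n, d (n + 1) ≫ d n = 0) (hX : ∀ n, Projective (X n)) {Z : ModuleCat.{0} S}
    (ε : X 0 ⟶ Z) (hε : d 0 ≫ ε = 0) (hs : Function.Surjective ε.hom)
    (ex0 : ∀ y, ε.hom y = 0 → ∃ z, (d 0).hom z = y)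
    (ex : ∀ n y, (d n).hom y = 0 → ∃ z, (d (n + 1)).hom z = y) : ProjectiveResolution Z where
  complex := ChainComplex.of X d hd
  projective := hX
  π := (ChainComplex.toSingle₀Equiv _ _).symm ⟨ε, by
    have h : (ChainComplex.of X d hd).d 1 0 = d 0 := ChainComplex.of_d X d 0
    rw [h]; exact hε⟩
  quasiIso := ⟨fun n => by
    cases n with
    | zero =>
      rw [ChainComplex.quasiIsoAt₀_iff, ShortComplex.quasiIso_iff_of_zeros']
      · constructor
        · rw [ShortComplex.moduleCat_exact_iff]
          intro y hy
          have h : (ChainComplex.of X d hd).d 1 0 = d 0 := ChainComplex.of_d X d 0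
          have hy' : ε.hom y = 0 := hy
          obtain ⟨z, hz⟩ := ex0 y hy'
          exact ⟨z, (congrArg (fun f => f.hom z) h).trans hz⟩
        · exact (ModuleCat.epi_iff_surjective ε).2 hs
      all_goals rfl
    | succ n =>
      rw [quasiIsoAt_iff_exactAt']
      · exact exactAt_succ_of_forall X d hd n (ex n)
      · apply ChainComplex.exactAt_succ_single_obj⟩

end Resolution

/-! ### Extension of scalars along a homomorphism of noncommutative rings -/

section BaseChange

variable {S N : Type} [Ring S] [Ring N] (ψ : S →+* N)

/-- The relations defining the extension of scalars, among the formal `N`-linear combinations of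
elements of the `S`-module `M`. -/
noncomputable def baseChangeRel (M : Type) [AddCommMonoid M] [Module S M] : Submodule N (M →₀ N) :=
  Submodule.span N
    ({z | ∃ m m' : M, z = Finsupp.single (m + m') 1 - Finsupp.single m 1 - Finsupp.single m' 1} ∪
      {z | ∃ (s : S) (m : M), z = Finsupp.single (s • m) 1 - Finsupp.single m (ψ s)})

/-- The extension of scalars `N ⊗_S M` of a left module along a ring homomorphism `S → N`, as the
left `N`-module on the symbols `1 ⊗ m` subject to additivity and `1 ⊗ s m = ψ(s) ⊗ m`. -/
abbrev BaseChange (M : Type) [AddCommMonoid M] [Module S M] : Type := (M →₀ N) ⧸ baseChangeRel ψ M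

variable {M M' : Type} [AddCommMonoid M] [Module S M] [AddCommGroup M'] [Module N M']

/-- The universal semilinear map `m ↦ 1 ⊗ m`. -/
noncomputable def BaseChange.mk (M : Type) [AddCommMonoid M] [Module S M] :
    M →ₛₗ[ψ] BaseChange ψ M where
  toFun m := Submodule.Quotient.mk (Finsupp.single m 1)
  map_add' m m' := by
    refine Eq.trans ?_ (Submodule.Quotient.mk_add _)
    rw [Submodule.Quotient.eq, ← sub_sub]
    exact Submodule.subset_span (Or.inl ⟨m, m', rfl⟩)
  map_smul' s m := by
    refine Eq.trans ?_ (Submodule.Quotient.mk_smul _ _ _)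
    rw [Submodule.Quotient.eq, Finsupp.smul_single, smul_eq_mul,
      mul_one]
    exact Submodule.subset_span (Or.inr ⟨s, m, rfl⟩)

/-- The linear map on the extension of scalars induced by a semilinear map. -/
noncomputable def BaseChange.lift (f : M →ₛₗ[ψ] M') : BaseChange ψ M →ₗ[N] M' :=
  (baseChangeRel ψ M).liftQ (Finsupp.lsum ℕ fun m => LinearMap.toSpanSingleton N M' (f m)) (by
    refine Submodule.span_le.2 ?_
    rintro _ (⟨m, m', rfl⟩ | ⟨s, m, rfl⟩)
    · rw [SetLike.mem_coe, LinearMap.mem_ker, map_sub, map_sub]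
      simp
    · rw [SetLike.mem_coe, LinearMap.mem_ker, map_sub]
      simp)

theorem BaseChange.lift_mk (f : M →ₛₗ[ψ] M') (m : M) :
    BaseChange.lift ψ f (BaseChange.mk ψ M m) = f m := by
  refine (Submodule.liftQ_apply _ _ _).trans ?_
  simp

variable {ψ}

theorem BaseChange.hom_ext {f g : BaseChange ψ M →ₗ[N] M'}
    (h : ∀ m, f (BaseChange.mk ψ M m) = g (BaseChange.mk ψ M m)) : f = g := by
  refine Submodule.linearMap_qext _ (Finsupp.lhom_ext fun m n => ?_)
  have h1 : (Finsupp.single m n : M →₀ N) = n • Finsupp.single m 1 := by simp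
  rw [h1, map_smul, map_smul]
  exact congrArg (n • ·) (h m)

variable (ψ)

/-- Extension of scalars, as a functor. -/
noncomputable def baseChange : ModuleCat.{0} S ⥤ ModuleCat.{0} N where
  obj M := ModuleCat.of N (BaseChange ψ M)
  map {M M'} f := ModuleCat.ofHom (BaseChange.lift ψ ((BaseChange.mk ψ M').comp f.hom))
  map_id M := ModuleCat.hom_ext (BaseChange.hom_ext fun m => BaseChange.lift_mk ψ _ m)
  map_comp f g := ModuleCat.hom_ext (BaseChange.hom_ext fun m => by
    rw [ModuleCat.hom_comp]
    refine (BaseChange.lift_mk ψ _ m).trans ?_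
    refine Eq.symm ((congrArg (BaseChange.lift ψ _) (BaseChange.lift_mk ψ _ m)).trans ?_)
    exact BaseChange.lift_mk ψ _ _)

theorem baseChange_map_mk {M M' : ModuleCat.{0} S} (f : M ⟶ M') (m : M) :
    ((baseChange ψ).map f).hom (BaseChange.mk ψ M m) = BaseChange.mk ψ M' (f.hom m) :=
  BaseChange.lift_mk ψ _ m

instance : (baseChange ψ).Additive where
  map_add {M M' f g} := ModuleCat.hom_ext (BaseChange.hom_ext fun m => by
    refine (baseChange_map_mk ψ (f + g) m).trans (Eq.symm ((congrArg₂ (· + ·)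
      (baseChange_map_mk ψ f m) (baseChange_map_mk ψ g m)).trans ?_))
    exact (map_add (BaseChange.mk ψ M') _ _).symm)

instance [Subsingleton M] : Subsingleton (BaseChange ψ M) := by
  have h : (LinearMap.id : BaseChange ψ M →ₗ[N] _) = 0 := BaseChange.hom_ext fun m => by
    rw [Subsingleton.elim m 0, map_zero, map_zero, map_zero]
  exact subsingleton_of_forall_eq 0 fun x => LinearMap.congr_fun h x

/-- The coefficientwise image of a finitely supported function. -/
noncomputable def mapCoeff (T : Type) : (T →₀ S) →ₛₗ[ψ] (T →₀ N) where
  toFun y := y.mapRange ψ (map_zero ψ)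
  map_add' y y' := Finsupp.mapRange_add (map_add ψ) y y'
  map_smul' s y := Finsupp.mapRange_smul' s (ψ s) y fun x => map_mul ψ s x

theorem mapCoeff_apply {T : Type} (y : T →₀ S) (t : T) : mapCoeff ψ T y t = ψ (y t) := rfl

theorem mapCoeff_single {T : Type} (t : T) (s : S) :
    mapCoeff ψ T (Finsupp.single t s) = Finsupp.single t (ψ s) :=
  Finsupp.mapRange_single (hf := map_zero ψ)

/-- The coefficientwise image, on a weighted free module. -/
noncomputable def weightedCoeff {T : Type} (w : T → S) :
    weightedFree w →ₛₗ[ψ] weightedFree fun t => ψ (w t) where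
  toFun y := ⟨mapCoeff ψ T y, (mem_weightedFree' _).2 fun t => by
    rw [mapCoeff_apply, ← map_mul, (mem_weightedFree' _).1 y.2]⟩
  map_add' y y' := Subtype.ext (map_add (mapCoeff ψ T) _ _)
  map_smul' s y := Subtype.ext (map_smulₛₗ (mapCoeff ψ T) s _)

/-- The linear map on the extension of scalars induced by `weightedCoeff`. -/
noncomputable def weightedLift {T : Type} (w : T → S) :
    BaseChange ψ (weightedFree w) →ₗ[N] weightedFree fun t => ψ (w t) :=
  BaseChange.lift (M' := weightedFree fun t => ψ (w t)) ψ (weightedCoeff ψ w)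

theorem weightedLift_mk {T : Type} (w : T → S) (y : weightedFree w) :
    weightedLift ψ w (BaseChange.mk ψ (weightedFree w) y) = weightedCoeff ψ w y := by
  unfold weightedLift; rw [BaseChange.lift_mk]

/-- Extension of scalars of a weighted free module. -/
noncomputable def baseChangeWeighted {T : Type} {w : T → S} (hw : ∀ t, IsIdempotentElem (w t)) :
    BaseChange ψ (weightedFree w) ≃ₗ[N] weightedFree fun t => ψ (w t) :=
  LinearEquiv.ofLinearMap (weightedLift ψ w)
    (Finsupp.linearCombination N (fun t => BaseChange.mk ψ (weightedFree w)
      (weightProj hw (Finsupp.single t 1))) ∘ₗ Submodule.subtype _)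
    (by
      refine LinearMap.ext fun z => Subtype.ext ?_
      have h : Submodule.subtype _ ∘ₗ weightedLift ψ w ∘ₗ
          Finsupp.linearCombination N (fun t => BaseChange.mk ψ (weightedFree w)
            (weightProj hw (Finsupp.single t 1))) = weightMap fun t => ψ (w t) := by
        refine Finsupp.lhom_ext' fun t => LinearMap.ext_ring ?_
        simp only [LinearMap.comp_apply, Finsupp.lsingle_apply, Finsupp.linearCombination_single,
          one_smul, weightedLift_mk, weightMap_single, one_mul, Submodule.subtype_apply]
        change mapCoeff ψ T (weightMap w (Finsupp.single t 1)) = _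
        rw [weightMap_single, one_mul, mapCoeff_single]
      exact (LinearMap.congr_fun h z).trans z.2)
    (BaseChange.hom_ext fun y => by
      have h : ∀ y : T →₀ S, Finsupp.linearCombination N (fun t => BaseChange.mk ψ (weightedFree w)
            (weightProj hw (Finsupp.single t 1))) (mapCoeff ψ T y) =
          BaseChange.mk ψ (weightedFree w) (weightProj hw y) := by
        intro y
        induction y using Finsupp.induction_linear with
        | zero => simp only [map_zero]
        | add x y hx hy => simp only [map_add, hx, hy]
        | single t s =>
          rw [mapCoeff_single, Finsupp.linearCombination_single, ← map_smulₛₗ, ← map_smul,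
            Finsupp.smul_single, smul_eq_mul, mul_one]
      rw [LinearMap.comp_apply, weightedLift_mk, LinearMap.comp_apply]
      refine (h y).trans (congrArg _ (Subtype.ext y.2)))

theorem baseChangeWeighted_mk {T : Type} {w : T → S} (hw : ∀ t, IsIdempotentElem (w t))
    (y : weightedFree w) :
    (baseChangeWeighted ψ hw (BaseChange.mk ψ _ y) : T →₀ N) = mapCoeff ψ T y :=
  congrArg Subtype.val (weightedLift_mk ψ w y)

/-- Extension of scalars of a free module. -/
noncomputable def baseChangeFree (T : Type) : BaseChange ψ (T →₀ S) ≃ₗ[N] (T →₀ N) :=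
  LinearEquiv.ofLinearMap (BaseChange.lift ψ (mapCoeff ψ T))
    (Finsupp.linearCombination N fun t => BaseChange.mk ψ (T →₀ S) (Finsupp.single t 1))
    (Finsupp.lhom_ext' fun t => LinearMap.ext_ring (by
      simp only [LinearMap.comp_apply, Finsupp.lsingle_apply, Finsupp.linearCombination_single,
        one_smul, BaseChange.lift_mk, mapCoeff_single, map_one, LinearMap.id_apply]))
    (BaseChange.hom_ext fun y => by
      rw [LinearMap.comp_apply, BaseChange.lift_mk, LinearMap.id_apply]
      induction y using Finsupp.induction_linear with
      | zero => simp only [map_zero]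
      | add x y hx hy => simp only [map_add, hx, hy]
      | single t s =>
        rw [mapCoeff_single, Finsupp.linearCombination_single, ← map_smulₛₗ,
          Finsupp.smul_single, smul_eq_mul, mul_one])

theorem baseChangeFree_mk (T : Type) (y : T →₀ S) :
    baseChangeFree ψ T (BaseChange.mk ψ _ y) = mapCoeff ψ T y :=
  BaseChange.lift_mk ψ (mapCoeff ψ T) y

end BaseChange

/-! ### The bar resolution -/

section BarResolution

variable (R : Type) [Ring R] (G : Type) [Group G]

/-- The contracting homotopy `g [g₁|…|gₙ] ↦ [g|g₁|…|gₙ]` of the bar resolution. -/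
noncomputable def barHomotopy (n : ℕ) :
    ((Fin n → G) →₀ MonoidAlgebra R G) →+ ((Fin (n + 1) → G) →₀ MonoidAlgebra R G) :=
  Finsupp.liftAddHom fun t => groupRingLift fun g => Finsupp.single (Fin.cons g t) 1

variable {R G}

theorem barHomotopy_single {n : ℕ} (t : Fin n → G) (g : G) (r : R) :
    barHomotopy R G n (Finsupp.single t (MonoidAlgebra.single g r)) =
      Finsupp.single (Fin.cons g t) (MonoidAlgebra.single 1 r) := by
  rw [barHomotopy, Finsupp.liftAddHom_apply_single, groupRingLift_single, Finsupp.smul_single,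
    smul_eq_mul, mul_one]

theorem contractNth_zero_cons {n : ℕ} (g : G) (t : Fin (n + 1) → G) :
    Fin.contractNth 0 (· * ·) (Fin.cons g t : Fin (n + 2) → G) =
      Fin.cons (g * t 0) fun i => t i.succ := by
  funext i
  refine Fin.cases ?_ (fun i => ?_) i
  · rw [Fin.contractNth_apply_of_eq _ _ _ _ rfl]
    rfl
  · rw [Fin.contractNth_apply_of_gt _ _ _ _ (by simp)]
    rfl

theorem contractNth_succ_cons {n : ℕ} (j : Fin (n + 1)) (g : G) (t : Fin (n + 1) → G) :
    Fin.contractNth j.succ (· * ·) (Fin.cons g t : Fin (n + 2) → G) =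
      Fin.cons g (Fin.contractNth j (· * ·) t) := by
  funext i
  refine Fin.cases ?_ (fun i => ?_) i
  · rw [Fin.contractNth_apply_of_lt _ _ _ _ (by simp)]
    rfl
  · rw [Fin.cons_succ]
    rcases lt_trichotomy (i : ℕ) j with h | h | h
    · rw [Fin.contractNth_apply_of_lt _ _ _ _ h, Fin.contractNth_apply_of_lt _ _ _ _ (by simpa)]
      rfl
    · rw [Fin.contractNth_apply_of_eq _ _ _ _ h, Fin.contractNth_apply_of_eq _ _ _ _ (by simpa)]
      rfl
    · rw [Fin.contractNth_apply_of_gt _ _ _ _ h, Fin.contractNth_apply_of_gt _ _ _ _ (by simpa)]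
      rfl

theorem groupRing_induction {n : ℕ} {p : ((Fin n → G) →₀ MonoidAlgebra R G) → Prop}
    (h0 : p 0) (hadd : ∀ x y, p x → p y → p (x + y))
    (hs : ∀ t g r, p (Finsupp.single t (MonoidAlgebra.single g r))) (y) : p y := by
  induction y using Finsupp.induction_linear with
  | zero => exact h0
  | add x y hx hy => exact hadd x y hx hy
  | single t s =>
    induction s using MonoidAlgebra.induction_linear with
    | zero => rw [Finsupp.single_zero]; exact h0
    | add x y hx hy => rw [Finsupp.single_add]; exact hadd _ _ hx hy
    | single g r => exact hs t g r

theorem barD_barHomotopy (n : ℕ) (y : (Fin (n + 1) → G) →₀ MonoidAlgebra R G) :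
    barD (MonoidAlgebra.of R G) (n + 1) (barHomotopy R G (n + 1) y) +
      barHomotopy R G n (barD (MonoidAlgebra.of R G) n y) = y := by
  induction y using groupRing_induction with
  | h0 => simp only [map_zero, add_zero]
  | hadd x y hx hy =>
    conv_rhs => rw [← hx, ← hy]
    simp only [map_add]
    abel
  | hs t g r =>
    rw [barHomotopy_single, barD_single, barD_single, map_add, map_sum, Fin.sum_univ_succ]
    simp only [map_zsmul, barHomotopy_single, contractNth_zero_cons, contractNth_succ_cons,
      Fin.cons_zero, Fin.cons_succ, MonoidAlgebra.of_apply, MonoidAlgebra.single_mul_single,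
      one_mul, mul_one, Fin.val_zero, zero_add, pow_one, Fin.val_succ]
    have h : ∀ j : Fin (n + 1), (-1 : ℤ) ^ ((j : ℕ) + 1 + 1) •
        (Finsupp.single (Fin.cons g (Fin.contractNth j (· * ·) t)) (MonoidAlgebra.single 1 r) :
          (Fin (n + 1) → G) →₀ MonoidAlgebra R G) = -((-1 : ℤ) ^ ((j : ℕ) + 1) •
        Finsupp.single (Fin.cons g (Fin.contractNth j (· * ·) t)) (MonoidAlgebra.single 1 r)) := by
      intro j
      rw [pow_succ _ ((j : ℕ) + 1), mul_neg_one, neg_smul]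
    simp only [h, Finset.sum_neg_distrib, neg_smul, one_smul]
    abel

theorem barD_zero_single {N : Type} [Ring N] (φ : G →* N) (g : Fin 1 → G) (a : N) :
    barD φ 0 (Finsupp.single g a) =
      Finsupp.single default (a * φ (g 0)) - Finsupp.single default a := by
  have h : ∀ F : Fin 1 → ((Fin 0 → G) →₀ N), ∑ j, F j = F 0 := Fin.sum_univ_one
  rw [barD_single, h]
  change _ + (-1 : ℤ) ^ 1 • Finsupp.single _ a = _
  rw [pow_one, neg_smul, one_smul, ← sub_eq_add_neg]
  congr 1 <;> exact congrArg (fun t => Finsupp.single t _) (Subsingleton.elim _ _)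

/-- The augmentation of the bar resolution. -/
noncomputable def barAug :
    ((Fin 0 → G) →₀ MonoidAlgebra R G) →ₗ[MonoidAlgebra R G] trivMod R G :=
  augLinear R G ∘ₗ Finsupp.lapply default

theorem barAug_single (t : Fin 0 → G) (s : MonoidAlgebra R G) :
    barAug (Finsupp.single t s) = augLinear R G s := by
  rw [Subsingleton.elim t default]
  exact congrArg (augLinear R G) Finsupp.single_eq_same

theorem barAug_barD (y : (Fin 1 → G) →₀ MonoidAlgebra R G) :
    barAug (barD (MonoidAlgebra.of R G) 0 y) = 0 := by
  induction y using groupRing_induction with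
  | h0 => simp only [map_zero]
  | hadd x y hx hy => rw [map_add, map_add, hx, hy, add_zero]
  | hs t g r =>
    rw [barD_zero_single, map_sub, barAug_single, barAug_single, sub_eq_zero]
    change augmentation R G _ = augmentation R G _
    rw [map_mul, augmentation_of, mul_one]

theorem barD_barHomotopy_zero (y : (Fin 0 → G) →₀ MonoidAlgebra R G) :
    barD (MonoidAlgebra.of R G) 0 (barHomotopy R G 0 y) +
      Finsupp.single default (MonoidAlgebra.single 1 (show R from barAug y)) = y := by
  induction y using groupRing_induction with
  | h0 =>
    rw [map_zero, map_zero, map_zero]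
    change (0 : (Fin 0 → G) →₀ MonoidAlgebra R G) + Finsupp.single default
      (MonoidAlgebra.single 1 (0 : R)) = 0
    rw [MonoidAlgebra.single_zero, Finsupp.single_zero, add_zero]
  | hadd x y hx hy =>
    conv_rhs => rw [← hx, ← hy]
    have h : (MonoidAlgebra.single 1 (show R from barAug (x + y)) : MonoidAlgebra R G) =
        MonoidAlgebra.single 1 (show R from barAug x) +
          MonoidAlgebra.single 1 (show R from barAug y) := by
      rw [← MonoidAlgebra.single_add, map_add]; rfl
    rw [h, map_add, map_add, Finsupp.single_add]
    abel
  | hs t g r =>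
    have h : (show R from barAug (Finsupp.single t (MonoidAlgebra.single g r))) = r := by
      rw [barAug_single]
      exact augmentation_single g r
    rw [h, barHomotopy_single, barD_zero_single]
    rw [Fin.cons_zero, MonoidAlgebra.of_apply, MonoidAlgebra.single_mul_single, one_mul, mul_one,
      Subsingleton.elim t default, sub_add_cancel]

/-- The bar resolution of the trivial module. -/
noncomputable def barResolution (R : Type) [Ring R] (G : Type) [Group G] :
    ProjectiveResolution (trivMod R G) :=
  resolutionOf (fun n => ModuleCat.of (MonoidAlgebra R G) ((Fin n → G) →₀ MonoidAlgebra R G))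
    (fun n => ModuleCat.ofHom (barD (MonoidAlgebra.of R G) n))
    (fun n => by rw [← ModuleCat.ofHom_comp, barD_comp_barD]; rfl)
    (fun n => ModuleCat.projective_of_free (Finsupp.basisSingleOne))
    (show ModuleCat.of _ ((Fin 0 → G) →₀ MonoidAlgebra R G) ⟶ trivMod R G from
      ModuleCat.ofHom (Y := trivMod R G) barAug)
    (ModuleCat.hom_ext (LinearMap.ext barAug_barD))
    (fun r => by
      obtain ⟨s, hs⟩ := augLinear_surjective R G r
      exact ⟨Finsupp.single default s, (barAug_single _ s).trans hs⟩)
    (fun y hy => ⟨barHomotopy R G 0 y, by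
      have h := barD_barHomotopy_zero y
      have hy' : (show R from barAug y) = 0 := hy
      rw [hy', MonoidAlgebra.single_zero, Finsupp.single_zero, add_zero] at h
      exact h⟩)
    (fun n y hy => ⟨barHomotopy R G (n + 1) y, by
      have h := barD_barHomotopy n y
      have hy' : barD (MonoidAlgebra.of R G) n y = 0 := hy
      rw [hy', map_zero, add_zero] at h
      exact h⟩)

variable {N : Type} [Ring N]

theorem barComplexOver_d (φ : G →* N) (n : ℕ) :
    (barComplexOver φ).d (n + 1) n = ModuleCat.ofHom (barD φ n) :=
  ChainComplex.of_d (fun n => ModuleCat.of N ((Fin n → G) →₀ N))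
    (fun n => ModuleCat.ofHom (barD φ n)) n

theorem mapCoeff_barD (ψ : MonoidAlgebra R G →+* N) (φ : G →* N)
    (h : ∀ g, ψ (MonoidAlgebra.of R G g) = φ g) (n : ℕ)
    (y : (Fin (n + 1) → G) →₀ MonoidAlgebra R G) :
    mapCoeff ψ _ (barD (MonoidAlgebra.of R G) n y) = barD φ n (mapCoeff ψ _ y) := by
  induction y using Finsupp.induction_linear with
  | zero => simp only [map_zero]
  | add x y hx hy => simp only [map_add, hx, hy]
  | single t s =>
    rw [mapCoeff_single, barD_single, barD_single, map_add, map_sum, mapCoeff_single, map_mul, h]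
    congr 1
    refine Finset.sum_congr rfl fun j _ => ?_
    rw [map_zsmul, mapCoeff_single]

/-- Extension of scalars turns the bar resolution into the bar complex with coefficients. -/
noncomputable def baseChangeBar (ψ : MonoidAlgebra R G →+* N) (φ : G →* N)
    (h : ∀ g, ψ (MonoidAlgebra.of R G g) = φ g) :
    ((baseChange ψ).mapHomologicalComplex _).obj (barComplexOver (MonoidAlgebra.of R G)) ≅
      barComplexOver φ :=
  HomologicalComplex.Hom.isoOfComponents
    (fun n => (baseChangeFree ψ (Fin n → G)).toModuleIso) (by
      rintro i j (rfl : j + 1 = i)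
      rw [Functor.mapHomologicalComplex_obj_d, barComplexOver_d, barComplexOver_d]
      refine ModuleCat.hom_ext (BaseChange.hom_ext fun y => ?_)
      refine (congrArg (barD φ j) (baseChangeFree_mk ψ _ y)).trans ?_
      refine (mapCoeff_barD ψ φ h j y).symm.trans (Eq.symm ?_)
      refine (congrArg (baseChangeFree ψ _) (baseChange_map_mk ψ _ y)).trans ?_
      exact baseChangeFree_mk ψ _ _)

end BarResolution

/-! ### The resolution of the free product and its extension of scalars -/

section FreeProdHomology

variable {ι : Type} {P : ι → Type} [∀ i, Group (P i)] {X : ι → Type} [∀ i, Fintype (P i)]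

/-- The homomorphism from the complex group ring to the group von Neumann algebra. -/
noncomputable def groupRingToVN (G : Type) [Group G] : MonoidAlgebra ℂ G →+* groupVN G :=
  MonoidAlgebra.liftNCRingHom (scalarVN G) (groupToVN G) fun c _ => scalarVN_commute c _

theorem groupRingToVN_single {G : Type} [Group G] (g : G) (c : ℂ) :
    groupRingToVN G (MonoidAlgebra.single g c) = scalarVN G c * groupToVN G g :=
  MonoidAlgebra.liftNCRingHom_single _ _ _ _ _

theorem groupRingToVN_of {G : Type} [Group G] (g : G) :
    groupRingToVN G (MonoidAlgebra.of ℂ G g) = groupToVN G g := by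
  rw [MonoidAlgebra.of_apply, groupRingToVN_single, map_one, one_mul]

theorem vnTrace_scalarVN_mul {G : Type} [Group G] (c : ℂ) (T : groupVN G) :
    vnTrace G (scalarVN G c * T) = c * vnTrace G T := by
  rw [vnTrace_eq, vnTrace_eq]
  rfl

theorem inP_injective (i : ι) : Function.Injective (inP i : P i →* FreeProd P X) := by
  intro x y h
  have h1 := congrArg (retr i) h
  simp only [inP, MonoidHom.comp_apply, retr_of] at h1
  exact congrArg Prod.fst h1

theorem not_isOfFinOrder_freeGroup_of {J : Type} (j : J) : ¬IsOfFinOrder (FreeGroup.of j) := by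
  intro h
  have h1 := (FreeGroup.lift fun _ : J => Multiplicative.ofAdd (1 : ℤ)).isOfFinOrder h
  rw [FreeGroup.lift_apply_of, isOfFinOrder_ofAdd_iff, isOfFinAddOrder_iff_nsmul_eq_zero] at h1
  obtain ⟨n, hn, h⟩ := h1
  rw [nsmul_one] at h
  exact hn.ne' (by exact_mod_cast h)

theorem not_isOfFinOrder_inA {i : ι} (j : X i) :
    ¬IsOfFinOrder (inA i (FreeGroup.of j) : FreeProd P X) := by
  intro h
  have h1 := ((MonoidHom.fst _ _).comp ((MonoidHom.snd _ _).comp (retr i))).isOfFinOrder h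
  simp only [MonoidHom.comp_apply, retr_inA] at h1
  exact not_isOfFinOrder_freeGroup_of j h1

theorem not_isOfFinOrder_inB {i : ι} (j : X i) :
    ¬IsOfFinOrder (inB i (FreeGroup.of j) : FreeProd P X) := by
  intro h
  have h1 := ((MonoidHom.snd _ _).comp ((MonoidHom.snd _ _).comp (retr i))).isOfFinOrder h
  simp only [MonoidHom.comp_apply, retr_inB] at h1
  exact not_isOfFinOrder_freeGroup_of j h1

theorem isUnit_card_complex (i : ι) : IsUnit (Fintype.card (P i) : ℂ) :=
  isUnit_iff_ne_zero.2 (Nat.cast_ne_zero.2 Fintype.card_ne_zero)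

variable (P X)

/-- The projection of the group von Neumann algebra given by averaging over the finite factor of
index `i`. -/
noncomputable def avgVN (i : ι) : groupVN (FreeProd P X) := groupRingToVN (FreeProd P X) (avg ℂ i)

variable {P X}

theorem avgVN_eq (i : ι) : avgVN P X i = scalarVN _ (Fintype.card (P i) : ℂ)⁻¹ *
    ∑ h : P i, groupToVN (FreeProd P X) (inP i h) := by
  rw [avgVN, avg, map_mul, map_sum, invCard, groupRingToVN_single, map_one, mul_one,
    Ring.inverse_eq_inv']
  simp only [groupRingToVN_of]

theorem avgVN_mul_self (i : ι) : avgVN P X i * avgVN P X i = avgVN P X i := by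
  rw [avgVN, ← map_mul, (avg_mul_self (isUnit_card_complex i)).eq]

theorem star_avgVN (i : ι) : star (avgVN P X i) = avgVN P X i := by
  rw [avgVN_eq, star_mul, star_scalarVN, star_sum, star_inv₀, star_natCast,
    ← (scalarVN_commute _ _).eq]
  congr 1
  simp only [star_groupToVN, ← map_inv]
  exact Fintype.sum_equiv (Equiv.inv _) _ _ fun _ => rfl

theorem vnTrace_avgVN (i : ι) : vnTrace _ (avgVN P X i) = (Fintype.card (P i) : ℂ)⁻¹ := by
  classical
  rw [avgVN_eq, vnTrace_scalarVN_mul, vnTrace_sum]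
  simp only [vnTrace_groupToVN, map_eq_one_iff _ (inP_injective (P := P) (X := X) i)]
  simp

theorem groupToVN_inA_commute_avgVN (i : ι) (f : FreeGroup (X i)) :
    Commute (groupToVN (FreeProd P X) (inA i f)) (avgVN P X i) := by
  have h := (avg_commute_inA (R := ℂ) (isUnit_card_complex (P := P) i) f).symm.map
    (groupRingToVN (FreeProd P X))
  rwa [groupRingToVN_of] at h

theorem groupToVN_inB_commute_avgVN (i : ι) (f : FreeGroup (X i)) :
    Commute (groupToVN (FreeProd P X) (inB i f)) (avgVN P X i) := by
  have h := (avg_commute_inB (R := ℂ) (isUnit_card_complex (P := P) i) f).symm.map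
    (groupRingToVN (FreeProd P X))
  rwa [groupRingToVN_of] at h

variable {R : Type} [Ring R]

local notation "RC" => MonoidAlgebra R (FreeProd P X)

variable (P X R)

/-- The modules of the resolution of length two. -/
noncomputable def shortX : ℕ → ModuleCat.{0} RC
  | 0 => ModuleCat.of RC RC
  | 1 => ModuleCat.of RC (weightedFree (wOne R : GenOne X → RC))
  | 2 => ModuleCat.of RC (weightedFree (wTwo R : GenTwo X → RC))
  | _ + 3 => ModuleCat.of RC PUnit

variable {P X R}

/-- The differentials of the resolution of length two. -/
noncomputable def shortD (hP : ∀ i, IsUnit (Fintype.card (P i) : R)) :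
    ∀ n, shortX P X R (n + 1) ⟶ shortX P X R n
  | 0 => ModuleCat.ofHom diffOne
  | 1 => ModuleCat.ofHom (diffTwo hP)
  | _ + 2 => 0

theorem shortD_comp (hP : ∀ i, IsUnit (Fintype.card (P i) : R)) :
    ∀ n, shortD (X := X) hP (n + 1) ≫ shortD hP n = 0
  | 0 => ModuleCat.hom_ext (LinearMap.ext fun y => (diffOne_eq_zero_iff hP _).2 ⟨y, rfl⟩)
  | _ + 1 => Limits.zero_comp

theorem shortX_projective (hP : ∀ i, IsUnit (Fintype.card (P i) : R)) :
    ∀ n, Projective (shortX P X R n)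
  | 0 => (IsProjective.iff_projective (R := RC) RC).1 inferInstance
  | 1 => (IsProjective.iff_projective (R := RC) (weightedFree (wOne R : GenOne X → RC))).1
      (projective_weightedFree (isIdempotentElem_wOne hP))
  | 2 => (IsProjective.iff_projective (R := RC) (weightedFree (wTwo R : GenTwo X → RC))).1
      (projective_weightedFree (isIdempotentElem_wTwo hP))
  | _ + 3 => (IsProjective.iff_projective (R := RC) PUnit).1 inferInstance

theorem shortD_exact (hP : ∀ i, IsUnit (Fintype.card (P i) : R)) :
    ∀ n (y : shortX P X R (n + 1)), (shortD hP n).hom y = 0 →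
      ∃ z, (shortD hP (n + 1)).hom z = y
  | 0 => fun y hy => (diffOne_eq_zero_iff hP y).1 hy
  | 1 => fun _ hy => ⟨0, (map_zero _).trans
      (diffTwo_injective hP (hy.trans (map_zero (diffTwo hP)).symm)).symm⟩
  | _ + 2 => fun _ _ => ⟨0, Subsingleton.elim (α := PUnit) _ _⟩

/-- The resolution of the trivial module by `weightedFree` modules. -/
noncomputable def shortResolution (hP : ∀ i, IsUnit (Fintype.card (P i) : R)) :
    ProjectiveResolution (trivMod R (FreeProd P X)) :=
  resolutionOf (shortX P X R) (shortD hP) (shortD_comp hP) (shortX_projective hP)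
    (show shortX P X R 0 ⟶ trivMod R (FreeProd P X) from
      ModuleCat.ofHom (Y := trivMod R (FreeProd P X)) (augLinear R (FreeProd P X)))
    (ModuleCat.hom_ext (LinearMap.ext fun y => (exists_diffOne_iff hP _).1 ⟨y, rfl⟩))
    (augLinear_surjective R (FreeProd P X))
    (fun y hy => (exists_diffOne_iff hP y).2 hy)
    (shortD_exact hP)

end FreeProdHomology

section BaseChangeMap

variable {S N : Type} [Ring S] [Ring N] (ψ : S →+* N)

/-- The linear map of extensions of scalars induced by a linear map. -/
noncomputable def BaseChange.map {M M' : Type} [AddCommMonoid M] [Module S M] [AddCommMonoid M']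
    [Module S M'] (f : M →ₗ[S] M') : BaseChange ψ M →ₗ[N] BaseChange ψ M' :=
  BaseChange.lift ψ ((BaseChange.mk ψ M').comp f)

theorem BaseChange.map_mk {M M' : Type} [AddCommMonoid M] [Module S M] [AddCommMonoid M']
    [Module S M'] (f : M →ₗ[S] M') (m : M) :
    BaseChange.map ψ f (BaseChange.mk ψ M m) = BaseChange.mk ψ M' (f m) :=
  BaseChange.lift_mk ψ _ m

theorem mapCoeff_linearCombination {T T' : Type} (v : T → T' →₀ S) (y : T →₀ S) :
    mapCoeff ψ T' (Finsupp.linearCombination S v y) =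
      Finsupp.linearCombination N (fun t => mapCoeff ψ T' (v t)) (mapCoeff ψ T y) := by
  induction y using Finsupp.induction_linear with
  | zero => simp only [map_zero]
  | add x y hx hy => simp only [map_add, hx, hy]
  | single t s =>
    rw [Finsupp.linearCombination_single, mapCoeff_single, Finsupp.linearCombination_single,
      map_smulₛₗ]

variable {T T' : Type} {w : T → S} {w' : T' → S} (v : T → T' →₀ S)
  (f : weightedFree w →ₗ[S] weightedFree w')

theorem baseChangeWeighted_map (hw : ∀ t, IsIdempotentElem (w t))
    (hw' : ∀ t, IsIdempotentElem (w' t))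
    (hf : ∀ y, (f y : T' →₀ S) = Finsupp.linearCombination S v y)
    (x : BaseChange ψ (weightedFree w)) :
    (baseChangeWeighted ψ hw' (BaseChange.map ψ f x) : T' →₀ N) =
      Finsupp.linearCombination N (fun t => mapCoeff ψ T' (v t)) (baseChangeWeighted ψ hw x) := by
  have h : Submodule.subtype _ ∘ₗ (baseChangeWeighted ψ hw').toLinearMap ∘ₗ BaseChange.map ψ f =
      Finsupp.linearCombination N (fun t => mapCoeff ψ T' (v t)) ∘ₗ Submodule.subtype _ ∘ₗ
        (baseChangeWeighted ψ hw).toLinearMap := by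
    refine BaseChange.hom_ext fun y => ?_
    simp only [LinearMap.comp_apply, BaseChange.map_mk, LinearEquiv.coe_coe,
      Submodule.subtype_apply, baseChangeWeighted_mk, hf, mapCoeff_linearCombination]
  exact LinearMap.congr_fun h x

/-- The kernel of the extension of a linear map between weighted free modules has the dimension of
the corresponding submodule of a free module. -/
theorem luckDim_ker_map (τ : N → ℂ) (hw : ∀ t, IsIdempotentElem (w t))
    (hw' : ∀ t, IsIdempotentElem (w' t))
    (hf : ∀ y, (f y : T' →₀ S) = Finsupp.linearCombination S v y) :
    luckDim τ (LinearMap.ker (BaseChange.map ψ f)) =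
      luckDim τ ((weightedFree fun t => ψ (w t)) ⊓ LinearMap.ker (Finsupp.linearCombination N
        fun t => mapCoeff ψ T' (v t)) : Submodule N (T →₀ N)) := by
  have hx := baseChangeWeighted_map ψ v f hw hw' hf
  have hker : ∀ x, BaseChange.map ψ f x = 0 ↔ Finsupp.linearCombination N
      (fun t => mapCoeff ψ T' (v t)) (baseChangeWeighted ψ hw x : T →₀ N) = 0 := by
    intro x
    rw [← hx, ZeroMemClass.coe_eq_zero, map_eq_zero_iff _ (LinearEquiv.injective _)]
  let φ : LinearMap.ker (BaseChange.map ψ f) →ₗ[N] (T →₀ N) :=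
    Submodule.subtype _ ∘ₗ (baseChangeWeighted ψ hw).toLinearMap ∘ₗ Submodule.subtype _
  have hφ : Function.Injective φ :=
    fun _ _ h => Subtype.ext ((baseChangeWeighted ψ hw).injective (Subtype.ext h))
  have hr : LinearMap.range φ = (weightedFree fun t => ψ (w t)) ⊓ LinearMap.ker
      (Finsupp.linearCombination N fun t => mapCoeff ψ T' (v t)) := by
    ext z
    constructor
    · rintro ⟨x, rfl⟩
      exact ⟨(baseChangeWeighted ψ hw x).2, (hker x).1 x.2⟩
    · rintro ⟨hz, hz'⟩
      have h1 := (baseChangeWeighted ψ hw).apply_symm_apply ⟨z, hz⟩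
      refine ⟨⟨(baseChangeWeighted ψ hw).symm ⟨z, hz⟩, (hker _).2 ?_⟩, congrArg Subtype.val h1⟩
      rw [h1]
      exact hz'
  exact luckDim_congr τ ((LinearEquiv.ofInjective φ hφ).trans (LinearEquiv.ofEq _ _ hr))

end BaseChangeMap

/-! ### Homology in degrees two and higher -/

section Homology

/-- The homology of the bar complex with coefficients, computed by extension of scalars from any
projective resolution of the trivial module. -/
noncomputable def barHomologyIso {R : Type} [Ring R] {G : Type} [Group G] {N : Type} [Ring N]
    (ψ : MonoidAlgebra R G →+* N) (φ : G →* N) (h : ∀ g, ψ (MonoidAlgebra.of R G g) = φ g)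
    (Q : ProjectiveResolution (trivMod R G)) (n : ℕ) :
    (barComplexOver φ).homology n ≅
      (((baseChange ψ).mapHomologicalComplex _).obj Q.complex).homology n :=
  (HomologicalComplex.homologyMapIso (baseChangeBar ψ φ h) n).symm ≪≫
    ((baseChange ψ).mapHomotopyEquiv
      (ProjectiveResolution.homotopyEquiv (barResolution R G) Q)).toHomologyIso n

theorem subsingleton_homology {N : Type} [Ring N] (K : ChainComplex (ModuleCat.{0} N) ℕ) (n : ℕ)
    [Subsingleton (K.X n)] : Subsingleton (K.homology n) := by
  have h : K.ExactAt n :=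
    ShortComplex.exact_of_isZero_X₂ _ (ModuleCat.isZero_of_subsingleton (K.X n))
  exact ModuleCat.subsingleton_of_isZero ((K.exactAt_iff_isZero_homology n).1 h)

/-- The homology in a degree with zero incoming differential is the kernel of the differential. -/
noncomputable def homologyEquivKer {N : Type} [Ring N] (K : ChainComplex (ModuleCat.{0} N) ℕ)
    (n : ℕ) (h : K.d (n + 2) (n + 1) = 0) :
    K.homology (n + 1) ≃ₗ[N] LinearMap.ker (K.d (n + 1) n).hom :=
  ((K.homologyIsoSc' (n + 2) (n + 1) n (by simp) (by simp)) ≪≫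
    (ShortComplex.asIsoHomologyπ (K.sc' (n + 2) (n + 1) n) h).symm ≪≫
    (K.sc' (n + 2) (n + 1) n).moduleCatCyclesIso).toLinearEquiv

variable {ι : Type} {P : ι → Type} [∀ i, Group (P i)] {X : ι → Type} [∀ i, Fintype (P i)]

variable (P X) in
/-- The resolution of length two over the complex group ring, with scalars extended to the group
von Neumann algebra. -/
noncomputable def shortVN : ChainComplex (ModuleCat.{0} (groupVN (FreeProd P X))) ℕ :=
  ((baseChange (groupRingToVN (FreeProd P X))).mapHomologicalComplex _).obj
    (shortResolution (X := X) (R := ℂ) (isUnit_card_complex (P := P))).complex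

variable (P X) in
theorem ell2Betti_eq_luckDim_homology (n : ℕ) : ell2Betti (FreeProd P X) n =
    luckDim (vnTrace (FreeProd P X)) ((shortVN P X).homology n) :=
  luckDim_congr _ (barHomologyIso (groupRingToVN (FreeProd P X)) (groupToVN (FreeProd P X))
    groupRingToVN_of (shortResolution isUnit_card_complex) n).toLinearEquiv

variable (P X) in
theorem subsingleton_shortVN (n : ℕ) : Subsingleton ((shortVN P X).X (n + 3)) :=
  inferInstanceAs (Subsingleton (BaseChange (groupRingToVN (FreeProd P X)) PUnit))

variable (P X) in
theorem ell2Betti_freeProd_of_three_le {n : ℕ} (hn : 3 ≤ n) : ell2Betti (FreeProd P X) n = 0 := by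
  obtain ⟨n, rfl⟩ := Nat.exists_eq_add_of_le' hn
  have := subsingleton_shortVN P X n
  have := subsingleton_homology (shortVN P X) (n + 3)
  rw [ell2Betti_eq_luckDim_homology]
  exact luckDim_eq_zero_of_subsingleton _ (map_zero (vnTraceHom _)) _

theorem shortVN_d : (shortVN P X).d 2 1 = (baseChange (groupRingToVN (FreeProd P X))).map
    (shortD (X := X) (isUnit_card_complex (P := P)) 1) :=
  congrArg (baseChange (groupRingToVN (FreeProd P X))).map
    (ChainComplex.of_d (shortX P X ℂ) (shortD isUnit_card_complex) 1)

theorem ell2Betti_freeProd_two_eq_ker : ell2Betti (FreeProd P X) 2 =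
    luckDim (vnTrace (FreeProd P X)) (LinearMap.ker (BaseChange.map (groupRingToVN
      (FreeProd P X)) (diffTwo (X := X) (R := ℂ) (isUnit_card_complex (P := P))))) := by
  rw [ell2Betti_eq_luckDim_homology]
  have h : (shortVN P X).d 3 2 = 0 := by
    have := subsingleton_shortVN P X 0
    exact (ModuleCat.isZero_of_subsingleton _).eq_of_src _ _
  rw [luckDim_congr _ (homologyEquivKer (shortVN P X) 1 h), shortVN_d]
  rfl

variable (P X) in
/-- The differential in degree two with coefficients in the group von Neumann algebra, on the
whole free module. -/
noncomputable def dTwoVN : (GenTwo X →₀ groupVN (FreeProd P X)) →ₗ[groupVN (FreeProd P X)]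
    (GenOne X →₀ groupVN (FreeProd P X)) :=
  Finsupp.linearCombination _ fun t => mapCoeff (groupRingToVN (FreeProd P X)) _ (dTwoGen ℂ t)

theorem ell2Betti_freeProd_two_eq : ell2Betti (FreeProd P X) 2 =
    luckDim (vnTrace (FreeProd P X)) ((weightedFree fun t : GenTwo X => avgVN P X t.1) ⊓
      LinearMap.ker (dTwoVN P X) : Submodule _ (GenTwo X →₀ groupVN (FreeProd P X))) := by
  rw [ell2Betti_freeProd_two_eq_ker]
  exact luckDim_ker_map (groupRingToVN (FreeProd P X)) (dTwoGen ℂ) (diffTwo isUnit_card_complex) _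
    (isIdempotentElem_wTwo isUnit_card_complex) (isIdempotentElem_wOne isUnit_card_complex)
    fun _ => rfl

theorem dTwoVN_single (t : GenTwo X) (T : groupVN (FreeProd P X)) :
    dTwoVN P X (Finsupp.single t T) =
      Finsupp.single ⟨t.1, some (Sum.inr t.2.2)⟩
        (T * ((groupToVN _ (inA t.1 (FreeGroup.of t.2.1)) - 1) * avgVN P X t.1)) -
      Finsupp.single ⟨t.1, some (Sum.inl t.2.1)⟩
        (T * ((groupToVN _ (inB t.1 (FreeGroup.of t.2.2)) - 1) * avgVN P X t.1)) := by
  rw [dTwoVN, Finsupp.linearCombination_single, dTwoGen, map_sub, mapCoeff_single,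
    mapCoeff_single, smul_sub, Finsupp.smul_single, Finsupp.smul_single, map_mul, map_mul, map_sub,
    map_sub, map_one, groupRingToVN_of, groupRingToVN_of]
  rfl

theorem dTwoVN_apply_none (z : GenTwo X →₀ groupVN (FreeProd P X)) (i : ι) :
    dTwoVN P X z ⟨i, none⟩ = 0 := by
  induction z using Finsupp.induction_linear with
  | zero => rw [map_zero]; rfl
  | add x y hx hy => rw [map_add, Finsupp.add_apply, hx, hy, add_zero]
  | single t T =>
    rw [dTwoVN_single, Finsupp.sub_apply, Finsupp.single_eq_of_ne, Finsupp.single_eq_of_ne,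
      sub_zero] <;> rintro ⟨⟩

theorem dTwoVN_apply_inr [∀ i, Fintype (X i)] (z : GenTwo X →₀ groupVN (FreeProd P X)) (i : ι)
    (k : X i) : dTwoVN P X z ⟨i, some (Sum.inr k)⟩ =
      ∑ j, z ⟨i, (j, k)⟩ * ((groupToVN _ (inA i (FreeGroup.of j)) - 1) * avgVN P X i) := by
  induction z using Finsupp.induction_linear with
  | zero => simp
  | add x y hx hy =>
    rw [map_add, Finsupp.add_apply, hx, hy]
    simp only [Finsupp.add_apply, add_mul, Finset.sum_add_distrib]
  | single t T =>
    obtain ⟨i', j', k'⟩ := t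
    have h0 : (⟨i', some (Sum.inl j')⟩ : GenOne X) ≠ ⟨i, some (Sum.inr k)⟩ := by rintro ⟨⟩
    rw [dTwoVN_single, Finsupp.sub_apply, Finsupp.single_eq_of_ne' h0, sub_zero]
    by_cases h : (⟨i', k'⟩ : Σ i, X i) = ⟨i, k⟩
    · cases h
      rw [Finsupp.single_eq_same, Finset.sum_eq_single j']
      · rw [Finsupp.single_eq_same]
      · intro j _ hne
        rw [Finsupp.single_eq_of_ne', zero_mul]
        rintro ⟨⟩
        exact hne rfl
      · exact fun hm => (hm (Finset.mem_univ _)).elim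
    · rw [Finsupp.single_eq_of_ne', Finset.sum_eq_zero]
      · intro j _
        rw [Finsupp.single_eq_of_ne', zero_mul]
        rintro ⟨⟩
        exact h rfl
      · rintro ⟨⟩
        exact h rfl

theorem dTwoVN_apply_inl [∀ i, Fintype (X i)] (z : GenTwo X →₀ groupVN (FreeProd P X)) (i : ι)
    (j : X i) : dTwoVN P X z ⟨i, some (Sum.inl j)⟩ =
      -∑ k, z ⟨i, (j, k)⟩ * ((groupToVN _ (inB i (FreeGroup.of k)) - 1) * avgVN P X i) := by
  induction z using Finsupp.induction_linear with
  | zero => simp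
  | add x y hx hy =>
    rw [map_add, Finsupp.add_apply, hx, hy]
    simp only [Finsupp.add_apply, add_mul, Finset.sum_add_distrib, neg_add]
  | single t T =>
    obtain ⟨i', j', k'⟩ := t
    have h0 : (⟨i', some (Sum.inr k')⟩ : GenOne X) ≠ ⟨i, some (Sum.inl j)⟩ := by rintro ⟨⟩
    rw [dTwoVN_single, Finsupp.sub_apply, Finsupp.single_eq_of_ne' h0, zero_sub]
    by_cases h : (⟨i', j'⟩ : Σ i, X i) = ⟨i, j⟩
    · cases h
      rw [Finsupp.single_eq_same, Finset.sum_eq_single k']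
      · rw [Finsupp.single_eq_same]
      · intro k _ hne
        rw [Finsupp.single_eq_of_ne', zero_mul]
        rintro ⟨⟩
        exact hne rfl
      · exact fun hm => (hm (Finset.mem_univ _)).elim
    · rw [Finsupp.single_eq_of_ne', Finset.sum_eq_zero, neg_zero]
      · intro k _
        rw [Finsupp.single_eq_of_ne', zero_mul]
        rintro ⟨⟩
        exact h rfl
      · rintro ⟨⟩
        exact h rfl

/-- The cycles in degree two split into the contributions of the indices `i`, each of which consists
of the rectangular arrays that are killed by the generators of both free groups. -/
theorem mem_weightedFree_inf_ker_iff [∀ i, Fintype (X i)] (z : GenTwo X →₀ groupVN (FreeProd P X)) :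
    z ∈ (weightedFree fun t : GenTwo X => avgVN P X t.1) ⊓ LinearMap.ker (dTwoVN P X) ↔
      ∀ i, (∀ t, z ⟨i, t⟩ * avgVN P X i = z ⟨i, t⟩) ∧
        (∀ k, ∑ j, z ⟨i, (j, k)⟩ * (groupToVN _ (inA i (FreeGroup.of j)) - 1) = 0) ∧
          ∀ j, ∑ k, z ⟨i, (j, k)⟩ * (groupToVN _ (inB i (FreeGroup.of k)) - 1) = 0 := by
  have hA : ∀ i f, (groupToVN (FreeProd P X) (inA i f) - 1) * avgVN P X i =
      avgVN P X i * (groupToVN (FreeProd P X) (inA i f) - 1) := fun i f =>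
    ((groupToVN_inA_commute_avgVN i f).sub_left (.one_left _)).eq
  have hB : ∀ i f, (groupToVN (FreeProd P X) (inB i f) - 1) * avgVN P X i =
      avgVN P X i * (groupToVN (FreeProd P X) (inB i f) - 1) := fun i f =>
    ((groupToVN_inB_commute_avgVN i f).sub_left (.one_left _)).eq
  rw [Submodule.mem_inf, mem_weightedFree', LinearMap.mem_ker]
  have key : (∀ t : GenTwo X, z t * avgVN P X t.1 = z t) → (dTwoVN P X z = 0 ↔ ∀ i,
      (∀ k, ∑ j, z ⟨i, (j, k)⟩ * (groupToVN _ (inA i (FreeGroup.of j)) - 1) = 0) ∧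
        ∀ j, ∑ k, z ⟨i, (j, k)⟩ * (groupToVN _ (inB i (FreeGroup.of k)) - 1) = 0) := by
    intro hz
    have hz' : ∀ i t T, z ⟨i, t⟩ * (avgVN P X i * T) = z ⟨i, t⟩ * T := fun i t T => by
      rw [← mul_assoc, hz ⟨i, t⟩]
    constructor
    · intro h i
      refine ⟨fun k => ?_, fun j => ?_⟩
      · have h1 := dTwoVN_apply_inr z i k
        rw [h] at h1
        simp only [hA, hz'] at h1
        exact h1.symm
      · have h1 := dTwoVN_apply_inl z i j
        rw [h] at h1
        simp only [hB, hz'] at h1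
        exact neg_eq_zero.1 h1.symm
    · intro h
      refine Finsupp.ext fun s => ?_
      rcases s with ⟨i, _ | j | k⟩
      · exact dTwoVN_apply_none z i
      · rw [dTwoVN_apply_inl]
        simp only [hB, hz']
        rw [(h i).2 j, neg_zero]; rfl
      · rw [dTwoVN_apply_inr]
        simp only [hA, hz']
        rw [(h i).1 k]; rfl
  constructor
  · rintro ⟨h, h'⟩ i
    exact ⟨fun t => h ⟨i, t⟩, (key h).1 h' i⟩
  · intro h
    have hz : ∀ t : GenTwo X, z t * avgVN P X t.1 = z t := fun t => (h t.1).1 t.2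
    exact ⟨hz, (key hz).2 fun i => (h i).2⟩

/-- The second `ℓ²`-Betti number of the free product: the factor of index `i` contributes
`(|X i| - 1)² / |P i|`. -/
theorem ell2Betti_freeProd_two [∀ i, Fintype (X i)] [∀ i, Nonempty (X i)] :
    ell2Betti (FreeProd P X) 2 =
      ∑' i, ENNReal.ofReal (((Fintype.card (X i) : ℝ) - 1) ^ 2 / Fintype.card (P i)) := by
  classical
  choose Q hQ hQ' hQy hQt using fun i => exists_proj_grid (J := X i) (avgVN_mul_self (X := X) i)
    (star_avgVN i) (fun j => inA i (FreeGroup.of j)) (fun j => inB i (FreeGroup.of j))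
    not_isOfFinOrder_inA not_isOfFinOrder_inB (fun j k => commute_inA_inB i _ _)
    (fun j => groupToVN_inA_commute_avgVN (P := P) i _) fun j => groupToVN_inB_commute_avgVN i _
  have h : (weightedFree fun t : GenTwo X => avgVN P X t.1) ⊓ LinearMap.ker (dTwoVN P X) =
      fixedRows Q := by
    ext z
    rw [mem_weightedFree_inf_ker_iff]
    exact forall_congr' fun i => (hQy i _).symm
  rw [ell2Betti_freeProd_two_eq, h, luckDim_fixedRows Q hQ hQ']
  refine tsum_congr fun i => ?_
  rw [hQt, vnTrace_avgVN]
  congr 1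
  rw [← Complex.ofReal_re (((Fintype.card (X i) : ℝ) - 1) ^ 2 / Fintype.card (P i))]
  push_cast
  rw [div_eq_mul_inv]

end Homology

/-! ### Homology in degree one -/

section FirstHomology

/-- A linear map to the cycles that hits no nonzero boundary bounds the dimension of the homology
from below. -/
theorem luckDim_le_homology {N : Type} [Ring N] (τ : N → ℂ) (K : ChainComplex (ModuleCat.{0} N) ℕ)
    (n : ℕ) {M : Type} [AddCommGroup M] [Module N M] (f : M →ₗ[N] K.X (n + 1))
    (hf : ∀ m, (K.d (n + 1) n).hom (f m) = 0)
    (hf' : ∀ m z, (K.d (n + 2) (n + 1)).hom z = f m → m = 0) :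
    luckDim τ M ≤ luckDim τ (K.homology (n + 1)) := by
  let S := K.sc' (n + 2) (n + 1) n
  let e : K.homology (n + 1) ≃ₗ[N] (LinearMap.ker S.g.hom ⧸ LinearMap.range S.moduleCatToCycles) :=
    ((K.homologyIsoSc' (n + 2) (n + 1) n (by simp) (by simp)) ≪≫
      S.moduleCatHomologyIso).toLinearEquiv
  rw [luckDim_congr τ e]
  let f' : M →ₗ[N] LinearMap.ker S.g.hom := LinearMap.codRestrict _ f hf
  refine luckDim_le_of_injective τ
    (Submodule.mkQ (LinearMap.range S.moduleCatToCycles) ∘ₗ f') ?_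
  refine (injective_iff_map_eq_zero _).2 fun m hm => ?_
  obtain ⟨z, hz⟩ := (Submodule.Quotient.mk_eq_zero _).1 hm
  exact hf' m z (congrArg Subtype.val hz)

/-- A derivation with values in `N` induces a functional on chains of degree one that vanishes on
boundaries. -/
theorem linearCombination_derivation_barD {G : Type} [Group G] {N : Type} [Ring N] (φ : G →* N)
    {D : G → N} (hD : IsDerivation φ D) (z : (Fin 2 → G) →₀ N) :
    Finsupp.linearCombination N (fun t : Fin 1 → G => D (t 0)) (barD φ 1 z) = 0 := by
  induction z using Finsupp.induction_linear with
  | zero => simp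
  | add x y hx hy => rw [map_add, map_add, hx, hy, add_zero]
  | single t n =>
    rw [barD_single, map_add, map_sum, Finsupp.linearCombination_single, Fin.sum_univ_two]
    simp only [map_zsmul, Finsupp.linearCombination_single, smul_eq_mul]
    have h0 : Fin.contractNth (0 : Fin 2) (· * ·) t 0 = t 0 * t 1 :=
      Fin.contractNth_apply_of_eq _ _ _ _ rfl
    have h1 : Fin.contractNth (1 : Fin 2) (· * ·) t 0 = t 0 :=
      Fin.contractNth_apply_of_lt _ _ _ _ (by simp)
    rw [h0, h1, hD]
    simp [mul_add, mul_assoc]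

variable {ι : Type} {P : ι → Type} [∀ i, Group (P i)] {X : ι → Type}

/-- A derivation of the free product that is inner on the factor of index `i` and zero on the
other factors. -/
theorem exists_isDerivation_inner_factor {N : Type} [Ring N] (φ : FreeProd P X →* N) (i : ι) :
    ∃ D : FreeProd P X → N, IsDerivation φ D ∧
      (∀ f, D (inA i f) = φ (inA i f) - 1) ∧ ∀ i', i' ≠ i → ∀ f, D (inA i' f) = 0 := by
  classical
  obtain ⟨D, hD, hDi⟩ := exists_isDerivation_coprodI φ
    (fun i' x => (φ (Monoid.CoprodI.of x) - 1) • if i' = i then (1 : N) else 0)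
    fun i' => IsDerivation.inner (φ.comp Monoid.CoprodI.of) _
  refine ⟨D, hD, fun f => (hDi i _).trans ?_, fun i' h f => (hDi i' _).trans ?_⟩
  · rw [if_pos rfl, smul_eq_mul, mul_one]; rfl
  · rw [if_neg h, smul_zero]

variable [∀ i, Fintype (P i)]

/-- For elements `g_0, …, g_n` of infinite order in different factors, the cycles `∑ y_j [g_j]` with
`∑ y_j (g_j - 1) = 0` form a module of dimension `n`, and derivations of the free product show that
no such cycle but zero is a boundary. -/
theorem le_ell2Betti_freeProd_one [Infinite ι] [∀ i, Nonempty (X i)] (n : ℕ) :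
    (n : ENNReal) ≤ ell2Betti (FreeProd P X) 1 := by
  classical
  let c : Fin (n + 1) → ι := fun j => Infinite.natEmbedding ι j
  have hc : Function.Injective c :=
    (Infinite.natEmbedding ι).injective.comp Fin.val_injective
  let g : Fin (n + 1) → FreeProd P X := fun j =>
    inA (c j) (FreeGroup.of (Classical.arbitrary (X (c j))))
  have hg : ∀ j, ¬IsOfFinOrder (g j) := fun j => not_isOfFinOrder_inA _
  obtain ⟨Q, hQ, -, hQy, hQt, -⟩ := exists_proj_rows (e := (1 : groupVN (FreeProd P X)))
    (mul_one 1) (star_one _) g hg fun j => Commute.one_right _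
  let F : (Unit × Fin (n + 1) → groupVN (FreeProd P X)) →ₗ[groupVN (FreeProd P X)]
      ((Fin 1 → FreeProd P X) →₀ groupVN (FreeProd P X)) :=
    ∑ j, Finsupp.lsingle (fun _ => g j) ∘ₗ LinearMap.proj ((), j)
  have hF : ∀ y, F y = ∑ j, Finsupp.single (fun _ => g j) (y ((), j)) := fun y => by
    simp [F, LinearMap.sum_apply]
  have hle := ofReal_matTrace_le_luckDim hQ LinearMap.id Function.injective_id
  have htr : (matTrace Q).re = n := by
    have h1 : vnTrace (FreeProd P X) 1 = 1 := by
      rw [← map_one (groupToVN _), vnTrace_groupToVN]; simp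
    rw [hQt, h1]
    simp
  rw [htr, ENNReal.ofReal_natCast] at hle
  refine hle.trans (luckDim_le_homology _ (barComplexOver (groupToVN (FreeProd P X))) 0
    (F ∘ₗ Submodule.subtype _) ?_ ?_)
  · rintro ⟨_, y, rfl⟩
    have hy := (hQy (Matrix.vecMul y Q)).1 (by rw [Matrix.vecMul_vecMul, hQ])
    rw [barComplexOver_d]
    refine (congrArg (barD (groupToVN (FreeProd P X)) 0) (hF _)).trans ?_
    rw [map_sum]
    simp only [barD_zero_single, ← Finsupp.single_sub]
    rw [← Finsupp.single_finsetSum]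
    refine Eq.trans (congrArg _ ?_) (Finsupp.single_zero _)
    rw [← hy.2]
    exact Finset.sum_congr rfl fun j _ => (mul_sub_one _ _).symm
  · rintro ⟨y, hy⟩ z hz
    rw [barComplexOver_d] at hz
    refine Subtype.ext (funext fun ⟨_, j⟩ => ?_)
    obtain ⟨D, hD, hDi, hD0⟩ := exists_isDerivation_inner_factor (groupToVN (FreeProd P X)) (c j)
    have h1 := linearCombination_derivation_barD _ hD z
    have hz' : barD (groupToVN (FreeProd P X)) 1 z = F y := hz
    rw [hz', hF, map_sum] at h1
    simp only [Finsupp.linearCombination_single, smul_eq_mul] at h1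
    rw [Finset.sum_eq_single j] at h1
    · rw [hDi] at h1
      exact eq_zero_of_mul_groupToVN_sub_one (hg j) h1
    · intro j' _ hj
      rw [hD0 _ fun h => hj (hc h), mul_zero]
    · simp

theorem ell2Betti_freeProd_one [Infinite ι] [∀ i, Nonempty (X i)] :
    ell2Betti (FreeProd P X) 1 = ⊤ :=
  ENNReal.eq_top_of_forall_nnreal_le fun r => by
    obtain ⟨n, hn⟩ := exists_nat_ge r
    exact le_trans (by exact_mod_cast hn) (le_ell2Betti_freeProd_one n)

end FirstHomology

/-! ### Expansion of a positive real number as a series of squares over powers -/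

section Expansion

/-- The greatest natural number smaller than `√t` (for `t > 0`). -/
noncomputable def strictSqrt (t : ℝ) : ℕ := ⌈√t⌉₊ - 1

/-- The rescaled remainders of the greedy expansion of `x`: the `n`-th partial sum of
`∑ᵢ rᵢ² / pⁱ` differs from `x` by `expansionRest p x n / pⁿ`. -/
noncomputable def expansionRest (p : ℕ) (x : ℝ) : ℕ → ℝ
  | 0 => x
  | n + 1 => p * (expansionRest p x n - (strictSqrt (expansionRest p x n) : ℝ) ^ 2)

theorem strictSqrt_lt {t : ℝ} (ht : 0 < t) : (strictSqrt t : ℝ) < √t := by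
  have h : 0 < ⌈√t⌉₊ := Nat.ceil_pos.2 (Real.sqrt_pos.2 ht)
  exact Nat.lt_ceil.1 (Nat.sub_lt h one_pos)

theorem sqrt_sub_one_le_strictSqrt (t : ℝ) : √t - 1 ≤ strictSqrt t := by
  have h1 := Nat.le_ceil (√t)
  have h2 : ((⌈√t⌉₊ : ℕ) : ℝ) ≤ ((⌈√t⌉₊ - 1 : ℕ) : ℝ) + 1 := by
    exact_mod_cast (by omega : ⌈√t⌉₊ ≤ ⌈√t⌉₊ - 1 + 1)
  rw [strictSqrt]
  linarith

theorem strictSqrt_sq_lt {t : ℝ} (ht : 0 < t) : (strictSqrt t : ℝ) ^ 2 < t := by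
  have h := strictSqrt_lt ht
  calc (strictSqrt t : ℝ) ^ 2 < √t ^ 2 := by gcongr
    _ = t := Real.sq_sqrt ht.le

theorem sub_strictSqrt_sq_le {t : ℝ} (ht : 0 < t) : t - (strictSqrt t : ℝ) ^ 2 ≤ 2 * √t := by
  have h1 := (strictSqrt_lt ht).le
  have h2 := sqrt_sub_one_le_strictSqrt t
  have h3 := Real.sq_sqrt ht.le
  have h4 : (0 : ℝ) ≤ strictSqrt t := Nat.cast_nonneg _
  nlinarith

variable {p : ℕ} {x : ℝ}

theorem expansionRest_pos (hp : 0 < p) (hx : 0 < x) (n : ℕ) : 0 < expansionRest p x n := by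
  induction n with
  | zero => exact hx
  | succ n ih => exact mul_pos (Nat.cast_pos.2 hp) (sub_pos.2 (strictSqrt_sq_lt ih))

theorem expansionRest_le (hp : 0 < p) (hx : 0 < x) (n : ℕ) :
    expansionRest p x n ≤ max x (4 * p ^ 2) := by
  induction n with
  | zero => exact le_max_left _ _
  | succ n ih =>
    have hB : 0 < max x (4 * (p : ℝ) ^ 2) := lt_max_of_lt_left hx
    have h1 : 2 * (p : ℝ) ≤ √(max x (4 * (p : ℝ) ^ 2)) :=
      Real.le_sqrt_of_sq_le ((le_of_eq (by ring)).trans (le_max_right _ _))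
    calc expansionRest p x (n + 1)
        = p * (expansionRest p x n - (strictSqrt (expansionRest p x n) : ℝ) ^ 2) := rfl
      _ ≤ p * (2 * √(expansionRest p x n)) := by
          gcongr
          exact sub_strictSqrt_sq_le (expansionRest_pos hp hx n)
      _ ≤ p * (2 * √(max x (4 * p ^ 2))) := by gcongr
      _ = 2 * p * √(max x (4 * p ^ 2)) := by ring
      _ ≤ √(max x (4 * p ^ 2)) * √(max x (4 * p ^ 2)) := by gcongr
      _ = max x (4 * p ^ 2) := Real.mul_self_sqrt hB.le

theorem sum_strictSqrt_add_expansionRest (hp : 0 < p) (n : ℕ) :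
    ∑ i ∈ Finset.range n, (strictSqrt (expansionRest p x i) : ℝ) ^ 2 / p ^ i +
      expansionRest p x n / p ^ n = x := by
  have hp' : (p : ℝ) ≠ 0 := Nat.cast_ne_zero.2 hp.ne'
  induction n with
  | zero => simp [expansionRest]
  | succ n ih =>
    rw [Finset.sum_range_succ]
    nth_rw 4 [← ih]
    rw [expansionRest]
    field_simp
    ring

/-- Every positive real number is a sum `∑ᵢ rᵢ² / pⁱ` in which infinitely many of the natural
numbers `rᵢ` are nonzero: every digit is chosen greedily, but so that the remainder stays
positive. -/
theorem exists_hasSum_sq_div_pow (hp : 1 < p) (hx : 0 < x) :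
    ∃ r : ℕ → ℕ, HasSum (fun i => (r i : ℝ) ^ 2 / p ^ i) x ∧ {i | r i ≠ 0}.Infinite := by
  have hp0 : 0 < p := by omega
  have hp1 : (1 : ℝ) < p := by exact_mod_cast hp
  refine ⟨fun i => strictSqrt (expansionRest p x i), ?_, fun hfin => ?_⟩
  · rw [hasSum_iff_tendsto_nat_of_nonneg fun i => by positivity]
    have hlim : Filter.Tendsto (fun n => max x (4 * (p : ℝ) ^ 2) * ((p : ℝ)⁻¹) ^ n)
        Filter.atTop (nhds 0) := by
      simpa using (tendsto_pow_atTop_nhds_zero_of_lt_one (by positivity)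
        (inv_lt_one_of_one_lt₀ hp1)).const_mul (max x (4 * (p : ℝ) ^ 2))
    have hrest : Filter.Tendsto (fun n => expansionRest p x n / (p : ℝ) ^ n)
        Filter.atTop (nhds 0) := by
      refine squeeze_zero (fun n => div_nonneg (expansionRest_pos hp0 hx n).le (by positivity))
        (fun n => ?_) hlim
      rw [inv_pow, ← div_eq_mul_inv]
      exact div_le_div_of_nonneg_right (expansionRest_le hp0 hx n) (by positivity)
    have h := hrest.const_sub x
    rw [sub_zero] at h
    refine h.congr fun n => ?_
    rw [sub_eq_iff_eq_add]
    exact (sum_strictSqrt_add_expansionRest hp0 n).symm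
  · -- Once all digits vanish, the rescaled remainder is multiplied by `p` at every step, which
    -- contradicts its boundedness.
    obtain ⟨m, hm⟩ := hfin.bddAbove
    have hgrow : ∀ k, expansionRest p x (m + 1 + k) = p ^ k * expansionRest p x (m + 1) := by
      intro k
      induction k with
      | zero => simp
      | succ k ih =>
        have h0 : strictSqrt (expansionRest p x (m + 1 + k)) = 0 := by
          by_contra h
          have := hm h
          omega
        rw [← add_assoc, expansionRest, h0, ih]
        ring
    have hpos := expansionRest_pos hp0 hx (m + 1)
    obtain ⟨k, hk⟩ := pow_unbounded_of_one_lt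
      (max x (4 * (p : ℝ) ^ 2) / expansionRest p x (m + 1)) hp1
    rw [div_lt_iff₀ hpos, ← hgrow] at hk
    exact absurd (expansionRest_le hp0 hx _) hk.not_ge

end Expansion

theorem mainTheorem8 (p : ℕ) (hp : p.Prime) (x : ℝ) (hx : 0 < x) :
    ∃ (C : Type) (_ : Group C),
      Countable C ∧ Group.ResiduallyFinite C ∧
      (∀ (R : Type u) [Ring R] [Nontrivial R], IsUnit (p : R) →
        cohomologicalDimension R C = 2) ∧
      ell2Betti C 1 = ⊤ ∧
      ell2Betti C 2 = ENNReal.ofReal x ∧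
      (∀ n : ℕ, 3 ≤ n → ell2Betti C n = 0) ∧
      ∃ r : ℕ → ℕ, Nonempty (C ≃* Monoid.CoprodI fun i : {i : ℕ // r i ≠ 0} =>
        Multiplicative (ZMod (p ^ (i : ℕ))) ×
          (FreeGroup (Fin (r i + 1)) × FreeGroup (Fin (r i + 1)))) := by
  obtain ⟨r, hr, hinf⟩ := exists_hasSum_sq_div_pow hp.one_lt hx
  have : Infinite {i : ℕ // r i ≠ 0} := hinf.to_subtype
  have : ∀ i : ℕ, NeZero (p ^ i) := fun i => ⟨pow_ne_zero i hp.ne_zero⟩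
  let P : {i : ℕ // r i ≠ 0} → Type := fun i => Multiplicative (ZMod (p ^ (i : ℕ)))
  let X : {i : ℕ // r i ≠ 0} → Type := fun i => Fin (r i + 1)
  let _ : ∀ i, CommGroup (P i) := fun i => inferInstanceAs (CommGroup (Multiplicative (ZMod _)))
  let _ : ∀ i, Fintype (P i) := fun i => inferInstanceAs (Fintype (Multiplicative (ZMod _)))
  let _ : ∀ i, Fintype (X i) := fun i => inferInstanceAs (Fintype (Fin _))
  have : ∀ i, Nonempty (X i) := fun i => ⟨(0 : Fin (r i + 1))⟩
  have hP : ∀ i, Fintype.card (P i) = p ^ (i : ℕ) := fun i =>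
    (Fintype.card_multiplicative _).trans (ZMod.card _)
  have : ∀ i, Group.ResiduallyFinite (FreeGroup (X i)) := fun i => residuallyFinite_freeGroup _
  refine ⟨FreeProd P X, inferInstance, countable_coprodI, residuallyFinite_coprodI,
    fun R _ _ hR => ?_, ell2Betti_freeProd_one, ?_,
    fun n hn => ell2Betti_freeProd_of_three_le P X hn, r, ⟨MulEquiv.refl _⟩⟩
  · refine cohomologicalDimension_freeProd (fun i => ?_)
      ⟨Classical.arbitrary _, Classical.arbitrary _, Classical.arbitrary _⟩
    rw [hP, Nat.cast_pow]
    exact hR.pow _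
  · rw [ell2Betti_freeProd_two, ← hr.tsum_eq,
      ENNReal.ofReal_tsum_of_nonneg (fun i => by positivity) hr.summable]
    refine Eq.trans (tsum_congr fun i => ?_)
      (tsum_subtype_eq_of_support_subset (f := fun i => ENNReal.ofReal ((r i : ℝ) ^ 2 / p ^ i))
        (s := {i | r i ≠ 0}) fun i hi h => hi ?_)
    · have hX : Fintype.card (X i) = r i + 1 := Fintype.card_fin _
      rw [hP, hX]
      push_cast
      rw [add_sub_cancel_right]
    · simp [h]
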